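/- A real random variable $X$ is called log-concave if its law has a density of the form $e^{-\phi}$ with respect to Lebesgue measure, where $\phi\colon\mathbb{R}\to(-\infty,+\infty]$ is convex. For $p\in\mathbb{R}\setminus\{0\}$ put $\|X\|_p=(\mathbb{E}|X|^p)^{1/p}\in[0,+\infty]$, and put $\|X\|_0=e^{\mathbb{E}\log|X|}$. At $p=0$ the expression $\Gamma(p+1)^{1/p}$ stands for its limit $e^{-\gamma}$, where $\gamma$ is the Euler--Mascheroni constant. Let $\mathcal{E}$ be a standard exponential random variable (density $e^{-x}$ on $(0,\infty)$), let $D$ be a standard double-exponential random variable (density $\frac12e^{-|x|}$ on $\mathbb{R}$), and for $p\ge1$ let $$C_p=\max\left\{\Gamma(p+1)^{1/p},\ \tfrac{e}{2}\|\mathcal{E}-1\|_p\right\},$$ which is finite. **Theorem.** Let $X$ be a log-concave random variable with mean $0$. Then $$\|X\|_p\ \ge\ \Gamma(p+1)^{1/p}\,\|X\|_1\quad\text{for every } -1<p\le1,\qquad\qquad \|X\|_p\ \le\ C_p\,\|X\|_1\quad\text{for every } p\ge1.$$ Both bounds are sharp. The variables $D$ and $\mathcal{E}-1$ are log-concave with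 mean $0$, and equality holds in the first bound for $X=D$, for every $-1<p\le1$. Moreover, the equation $\Gamma(p+1)^{1/p}=\frac e2\|\mathcal{E}-1\|_p$ has a unique solution $p_0$ in $(1,+\infty)$; it satisfies $2.9414<p_0<2.9415$, and - for $1\le p\le p_0$, $C_p=\Gamma(p+1)^{1/p}$ and equality holds in the second bound for $X=D$; - for $p\ge p_0$, $C_p=\frac e2\|\mathcal{E}-1\|_p$ and equality holds in the second bound for $X=\mathcal{E}-1$. -/

import Mathlib

open MeasureTheory ProbabilityTheory
open scoped ENNReal

noncomputable section

namespace LogConcaveMoments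

/-- Convexity of an extended-valued function `φ : ℝ → (-∞, +∞]`. -/
structure IsConvexPotential (φ : ℝ → EReal) : Prop where
  ne_bot : ∀ x, φ x ≠ ⊥
  convex : ∀ x y a b : ℝ, 0 < a → 0 < b → a + b = 1 →
    φ (a * x + b * y) ≤ (a : EReal) * φ x + (b : EReal) * φ y

/-- `X` is a log-concave random variable: its law has a density `e^{-φ}` with respect to Lebesgue
measure, with `φ : ℝ → (-∞, +∞]` convex (here `EReal.exp ⊥ = 0`). -/
def IsLogConcave {Ω : Type*} [MeasurableSpace Ω] (X : Ω → ℝ) (P : Measure Ω) : Prop :=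
  ∃ φ : ℝ → EReal, IsConvexPotential φ ∧
    HasLaw X ((volume : Measure ℝ).withDensity fun x => EReal.exp (-φ x)) P

/-- `X` has mean zero. -/
def HasMeanZero {Ω : Type*} [MeasurableSpace Ω] (X : Ω → ℝ) (P : Measure Ω) : Prop :=
  Integrable X P ∧ ∫ ω, X ω ∂P = 0

/-- The extended-valued expectation `𝔼 log |X|`, the difference of the expectations of the positive
and the negative part of `log |X|`, where `log 0 = -∞`. -/
def expLogAbs {Ω : Type*} [MeasurableSpace Ω] (X : Ω → ℝ) (P : Measure Ω) : EReal :=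
  ((∫⁻ ω, (ENNReal.log ‖X ω‖ₑ).toENNReal ∂P : ℝ≥0∞) : EReal) -
    ((∫⁻ ω, (-ENNReal.log ‖X ω‖ₑ).toENNReal ∂P : ℝ≥0∞) : EReal)

/-- `‖X‖_p = (𝔼 |X|^p)^{1/p} ∈ [0, ∞]` for real `p ≠ 0` (for `p < 0`, `0 ^ p = ∞` and `∞ ^ p = 0`),
and `‖X‖_0 = exp (𝔼 log |X|)`. -/
def momentNorm {Ω : Type*} [MeasurableSpace Ω] (X : Ω → ℝ) (p : ℝ) (P : Measure Ω) : ℝ≥0∞ :=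
  if p = 0 then EReal.exp (expLogAbs X P)
  else (∫⁻ ω, ‖X ω‖ₑ ^ p ∂P) ^ (1 / p)

/-- `Γ(p+1)^{1/p}`, with its limit `e^{-γ}` as value at `p = 0`. -/
def gammaRoot (p : ℝ) : ℝ :=
  if p = 0 then Real.exp (-Real.eulerMascheroniConstant)
  else Real.Gamma (p + 1) ^ (1 / p)

/-- The value of `gammaRoot` at `0` is the limit of `Γ(p+1)^{1/p}` as `p → 0`. -/
theorem tendsto_gammaRoot_zero :
    Filter.Tendsto (fun p : ℝ => Real.Gamma (p + 1) ^ (1 / p)) (nhdsWithin 0 {0}ᶜ)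
      (nhds (gammaRoot 0)) := by
  have h0 : HasDerivAt (fun p : ℝ => Real.Gamma (p + 1)) (-Real.eulerMascheroniConstant) 0 := by
    have h := Real.hasDerivAt_Gamma_one
    rw [← zero_add (1 : ℝ)] at h
    exact h.comp_add_const 0 1
  have h1 : HasDerivAt (fun p : ℝ => Real.log (Real.Gamma (p + 1)))
      (-Real.eulerMascheroniConstant) 0 := by
    simpa using h0.log (by simp)
  have h2 := (Real.continuous_exp.tendsto _).comp h1.tendsto_slope
  rw [gammaRoot, if_pos rfl]
  refine h2.congr' ?_
  have h3 : ∀ᶠ p : ℝ in nhdsWithin 0 {0}ᶜ, p ∈ Set.Ioi (-1 : ℝ) :=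
    nhdsWithin_le_nhds (Ioi_mem_nhds (by norm_num))
  filter_upwards [h3] with p hp
  have hp' : (0 : ℝ) < p + 1 := by
    have : (-1 : ℝ) < p := hp
    linarith
  rw [Real.rpow_def_of_pos (Real.Gamma_pos_of_pos hp')]
  simp [slope_def_field, div_eq_mul_inv]

/-- The standard double-exponential law, with density `e^{-|x|} / 2`. -/
def doubleExp : Measure ℝ :=
  (volume : Measure ℝ).withDensity fun x => ENNReal.ofReal (Real.exp (-|x|) / 2)

/-- `(e/2) ‖ℰ - 1‖_p` for a standard exponential random variable `ℰ`. -/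
def oneSidedConst (p : ℝ) : ℝ≥0∞ :=
  ENNReal.ofReal (Real.exp 1 / 2) * momentNorm (fun x : ℝ => x - 1) p (expMeasure 1)

/-- `C_p = max {Γ(p+1)^{1/p}, (e/2) ‖ℰ - 1‖_p}`. -/
def sharpConst (p : ℝ) : ℝ≥0∞ :=
  max (ENNReal.ofReal (gammaRoot p)) (oneSidedConst p)

end LogConcaveMoments

end

open LogConcaveMoments

noncomputable section

namespace LogConcaveMoments

open Filter Topology Set

/-! ### Tails of log-concave densities -/

/-! After scaling, `𝔼|X| = 1`. Every absolute moment of order `p ≠ 0, 1` is then an integral of the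
stop-loss transform `π(x) = 𝔼(|X| - x)₊` against a power of `x`, increasing in `π` for `p > 1` and
`p < 0` and decreasing for `0 < p < 1`. It therefore suffices to control `π`.

A log-concave density has log-concave tails, and `ψ(x) = 𝔼(X - x)₊` then lies below each of its
tangent exponentials (`TailLogConcave.upperStopLoss_le`). Mean zero gives `ψ(0) = 1/2` and `𝔼(-X -
x)₊ = ψ(-x) - x`. The tangent of `ψ` at `0`, continued on the negative side by a tangent of the
reflected transform at a later point, bounds `π` by a member of a one-parameter family
`extremalStopLoss t`, `0 ≤ t ≤ 1` (`exists_stopLoss_le_extremal`). Its ends are `D` (`t = 0`) and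
`(e/2)(ℰ - 1)` (`t = 1`), so the problem is reduced to this family.

Two facts about the family suffice. For `t > 0` its transform crosses `e^{-x}`, the transform of
`D`, exactly once and from below (`exists_crossesAt_exp`). Since `x^(p-q)` decreases when `p < q`, a
moment of order `q > 1` that is at most that of `D` forces the same comparison for `1 < p < q` and
`p < 0`, and the opposite one for `0 < p < 1`. Secondly, for `p ≥ 2.94` the moment, as a function of
`t`, is largest at `t = 0` or `t = 1` (`extremalMoment_le_max`): its derivative, once positive,
stays nonnegative, by a chain of sign arguments ending at explicit polynomials.

Rational bounds and continuity give a point `p₀` in `(2.9414, 2.9415)` where the two ends agree. At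
`p₀` all extremal moments are at most that of `D`. The crossing argument carries this below `p₀`,
which yields the upper bound up to `p₀` and the lower bound; above `p₀` the second fact applies
directly. A strict crossing argument at `t = 1` makes `p₀` unique, and `p = 0` follows by a limit
and Jensen's inequality. -/

theorem IsConvexPotential.measurable {φ : ℝ → EReal} (h : IsConvexPotential φ) : Measurable φ := by
  refine measurable_of_Iic fun c => ?_
  -- Sublevel sets of a convex function are intervals.
  suffices H : (φ ⁻¹' Set.Iic c).OrdConnected from H.measurableSet
  refine ⟨fun x hx y hy z hz => ?_⟩
  simp only [Set.mem_preimage, Set.mem_Iic] at hx hy ⊢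
  rcases eq_or_lt_of_le hz.1 with h1 | h1
  · rwa [← h1]
  rcases eq_or_lt_of_le hz.2 with h2 | h2
  · rwa [h2]
  have hxy : 0 < y - x := by linarith
  have ha : 0 < (y - z) / (y - x) := div_pos (by linarith) hxy
  have hb : 0 < (z - x) / (y - x) := div_pos (by linarith) hxy
  have hab : (y - z) / (y - x) + (z - x) / (y - x) = 1 := by field_simp; ring
  have key := h.convex x y _ _ ha hb hab
  have hzz : (y - z) / (y - x) * x + (z - x) / (y - x) * y = z := by field_simp; ring
  rw [hzz] at key
  refine key.trans ?_
  have hA : (0 : EReal) ≤ (((y - z) / (y - x) : ℝ) : EReal) := by exact_mod_cast ha.le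
  have hB : (0 : EReal) ≤ (((z - x) / (y - x) : ℝ) : EReal) := by exact_mod_cast hb.le
  calc _ ≤ (((y - z) / (y - x) : ℝ) : EReal) * c + (((z - x) / (y - x) : ℝ) : EReal) * c :=
        add_le_add (mul_le_mul_of_nonneg_left hx hA) (mul_le_mul_of_nonneg_left hy hB)
    _ = c := by
        rw [← EReal.right_distrib_of_nonneg hA hB, ← EReal.coe_add, hab]; simp

/-- The points `u + h` and `v` are convex combinations of `u` and `v + h` with interchanged weights,
so the two convexity inequalities add up to the claim. Infinite values are treated apart. -/
theorem IsConvexPotential.add_le_add {φ : ℝ → EReal} (hφ : IsConvexPotential φ) {u v h : ℝ}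
    (huv : u ≤ v) (hh : 0 ≤ h) : φ (u + h) + φ v ≤ φ u + φ (v + h) := by
  rcases eq_or_lt_of_le huv with rfl | huv
  · rw [add_comm]
  rcases eq_or_lt_of_le hh with rfl | hh
  · simp
  have hd : 0 < v - u + h := by linarith
  have ha : 0 < (v - u) / (v - u + h) := div_pos (by linarith) hd
  have hb : 0 < h / (v - u + h) := div_pos hh hd
  have hab : (v - u) / (v - u + h) + h / (v - u + h) = 1 := by field_simp
  have k1 := hφ.convex u (v + h) _ _ ha hb hab
  have k2 := hφ.convex u (v + h) _ _ hb ha (by rw [add_comm]; exact hab)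
  rw [show (v - u) / (v - u + h) * u + h / (v - u + h) * (v + h) = u + h by
    field_simp; ring] at k1
  rw [show h / (v - u + h) * u + (v - u) / (v - u + h) * (v + h) = v by
    field_simp; ring] at k2
  have nb := hφ.ne_bot
  generalize (v - u) / (v - u + h) = a at *
  generalize h / (v - u + h) = b at *
  rcases eq_or_ne (φ u) ⊤ with h1 | h1
  · rw [h1, EReal.top_add_of_ne_bot (nb _)]; exact le_top
  rcases eq_or_ne (φ (v + h)) ⊤ with h2 | h2
  · rw [h2, EReal.add_top_of_ne_bot (nb _)]; exact le_top
  lift φ u to ℝ using ⟨h1, nb _⟩ with A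
  lift φ (v + h) to ℝ using ⟨h2, nb _⟩ with B
  calc φ (u + h) + φ v ≤ ((a : EReal) * A + b * B) + (b * A + a * B) := _root_.add_le_add k1 k2
    _ = ((((a + b) * A + (a + b) * B : ℝ)) : EReal) := by
        norm_cast; ring_nf
    _ = A + B := by rw [hab]; simp

theorem IsConvexPotential.density_mul_le {φ : ℝ → EReal} (hφ : IsConvexPotential φ) {u v h : ℝ}
    (huv : u ≤ v) (hh : 0 ≤ h) :
    EReal.exp (-φ u) * EReal.exp (-φ (v + h)) ≤ EReal.exp (-φ (u + h)) * EReal.exp (-φ v) := by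
  have nb := hφ.ne_bot
  rw [← EReal.exp_add, ← EReal.exp_add, EReal.exp_le_exp_iff, ← sub_eq_add_neg, ← sub_eq_add_neg,
    ← EReal.neg_add (.inl (nb _)) (.inr (nb _)), ← EReal.neg_add (.inl (nb _)) (.inr (nb _)),
    EReal.neg_le_neg_iff]
  exact hφ.add_le_add huv hh

theorem IsConvexPotential.comp_neg {φ : ℝ → EReal} (hφ : IsConvexPotential φ) :
    IsConvexPotential fun x => φ (-x) where
  ne_bot x := hφ.ne_bot _
  convex x y a b ha hb hab := by
    have := hφ.convex (-x) (-y) a b ha hb hab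
    rwa [show a * -x + b * -y = -(a * x + b * y) by ring] at this

/-- The survival function `x ↦ μ (x, ∞)` is log-concave, in the form of a four-point inequality. -/
def TailLogConcave (μ : Measure ℝ) : Prop :=
  ∀ x y h : ℝ, x ≤ y → 0 ≤ h →
    μ.real (Set.Ioi x) * μ.real (Set.Ioi (y + h)) ≤ μ.real (Set.Ioi (x + h)) * μ.real (Set.Ioi y)

/-- Splitting the longer tails at `y` and `y + h` leaves the same product of two tails on both
sides. What remains is the pointwise four-point inequality integrated over `u ∈ (x, y]`, `v > y`. -/
theorem withDensity_tail_mul_le {f : ℝ → ℝ≥0∞} (hf : Measurable f)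
    (hfl : ∀ u v h : ℝ, u ≤ v → 0 ≤ h → f u * f (v + h) ≤ f (u + h) * f v)
    {x y h : ℝ} (hxy : x ≤ y) (hh : 0 ≤ h) :
    (volume.withDensity f) (Set.Ioi x) * (volume.withDensity f) (Set.Ioi (y + h)) ≤
      (volume.withDensity f) (Set.Ioi (x + h)) * (volume.withDensity f) (Set.Ioi y) := by
  set μ := volume.withDensity f with hμ
  have shift : ∀ (s : Set ℝ), MeasurableSet s → μ ((fun u => u + h) '' s) = ∫⁻ u in s, f (u + h) := by
    intro s hs
    have hms : MeasurableSet ((fun u : ℝ => u + h) '' s) :=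
      (MeasurableEquiv.addRight h).measurableEmbedding.measurableSet_image.2 hs
    rw [hμ, withDensity_apply _ hms]
    rw [← (measurePreserving_add_right (volume : Measure ℝ) h).setLIntegral_comp_emb
      (MeasurableEquiv.addRight h).measurableEmbedding]
  have e1 : μ (Set.Ioi (y + h)) = ∫⁻ v in Set.Ioi y, f (v + h) := by
    rw [← shift _ measurableSet_Ioi]; simp
  have e2 : μ (Set.Ioc (x + h) (y + h)) = ∫⁻ u in Set.Ioc x y, f (u + h) := by
    rw [← shift _ measurableSet_Ioc]; simp
  have split : ∀ a b : ℝ, a ≤ b → μ (Set.Ioi a) = μ (Set.Ioc a b) + μ (Set.Ioi b) := by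
    intro a b hab
    rw [← measure_union _ measurableSet_Ioi, Set.Ioc_union_Ioi_eq_Ioi hab]
    exact Set.disjoint_left.2 fun z hz hz' => not_lt.2 hz.2 hz'
  rw [split x y hxy, split (x + h) (y + h) (by linarith), add_mul, add_mul,
    mul_comm (μ (Set.Ioi (y + h))) (μ (Set.Ioi y))]
  gcongr ?_ + _
  rw [e1, e2, hμ, withDensity_apply _ measurableSet_Ioc, withDensity_apply _ measurableSet_Ioi]
  have hfh : Measurable fun u => f (u + h) := hf.comp (measurable_add_const h)
  rw [← lintegral_lintegral_mul hf.aemeasurable hfh.aemeasurable,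
    ← lintegral_lintegral_mul hfh.aemeasurable hf.aemeasurable]
  refine setLIntegral_mono' measurableSet_Ioc fun u hu => ?_
  refine setLIntegral_mono' measurableSet_Ioi fun v hv => ?_
  exact hfl u v h (hu.2.trans (le_of_lt hv)) hh

theorem IsConvexPotential.tailLogConcave {φ : ℝ → EReal} (hφ : IsConvexPotential φ)
    [IsFiniteMeasure (volume.withDensity fun x => EReal.exp (-φ x))] :
    TailLogConcave (volume.withDensity fun x => EReal.exp (-φ x)) := by
  intro x y h hxy hh
  simp only [measureReal_def, ← ENNReal.toReal_mul]
  refine ENNReal.toReal_mono (ENNReal.mul_ne_top (measure_ne_top _ _) (measure_ne_top _ _)) ?_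
  refine withDensity_tail_mul_le (EReal.measurable_exp.comp hφ.measurable.neg) ?_ hxy hh
  exact fun u v h huv hh => hφ.density_mul_le huv hh

/-- A positive continuous function satisfying midpoint log-concavity is quasi-concave. -/
theorem min_le_of_midpoint {g : ℝ → ℝ} (hg : Continuous g)
    (hmid : ∀ w h : ℝ, 0 ≤ h → g (w - h) * g (w + h) ≤ g w ^ 2) {x y z : ℝ} (hxy : x ≤ y)
    (hyz : y ≤ z) (hpos : ∀ w ∈ Set.Icc x z, 0 < g w) : min (g x) (g z) ≤ g y := by
  by_contra! hlt
  have hxz : x ≤ z := hxy.trans hyz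
  obtain ⟨w₀, hw₀, hmin⟩ := isCompact_Icc.exists_isMinOn (Set.nonempty_Icc.2 hxz) hg.continuousOn
  rw [isMinOn_iff] at hmin
  set s := Set.Icc x z ∩ {w | g w ≤ g w₀} with hs
  have hsc : IsCompact s := isCompact_Icc.inter_right (isClosed_le hg continuous_const)
  -- With the leftmost minimiser, a symmetric step gives a strictly larger value on the left and no
  -- smaller one on the right, contradicting the midpoint inequality.
  obtain ⟨w, hw, hwl⟩ := hsc.exists_isLeast ⟨w₀, hw₀, le_refl (g w₀)⟩
  have hwk : g w = g w₀ := le_antisymm hw.2 (hmin w hw.1)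
  have hwy : g w ≤ g y := hwk ▸ hmin y ⟨hxy, hyz⟩
  have h1 : x < w := by
    refine lt_of_le_of_ne hw.1.1 fun h => ?_
    subst h
    exact absurd (hlt.trans_le (min_le_left _ _)) (not_lt.2 hwy)
  have h2 : w < z := by
    refine lt_of_le_of_ne hw.1.2 fun h => ?_
    subst h
    exact absurd (hlt.trans_le (min_le_right _ _)) (not_lt.2 hwy)
  set h := min (w - x) (z - w)
  have hh : 0 < h := lt_min (by linarith) (by linarith)
  have hl : h ≤ w - x := min_le_left _ _
  have hr : h ≤ z - w := min_le_right _ _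
  have m1 : w - h ∈ Set.Icc x z := ⟨by linarith, by linarith⟩
  have m2 : w + h ∈ Set.Icc x z := ⟨by linarith, by linarith⟩
  have k1 : g w < g (w - h) := by
    by_contra! hc
    have := hwl (show w - h ∈ s from ⟨m1, hc.trans hwk.le⟩)
    linarith
  have k2 : g w ≤ g (w + h) := hwk ▸ hmin _ m2
  have k3 := hmid w h hh.le
  have k4 := hpos w hw.1
  nlinarith

/-! ### One-sided stop-loss transforms -/

/-- The upper stop-loss transform `𝔼 (Y - x)₊` of a law `μ` on the line. -/
def upperStopLoss (μ : Measure ℝ) (x : ℝ) : ℝ := ∫ y, max (y - x) 0 ∂μ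

theorem integrable_max_sub {μ : Measure ℝ} [IsFiniteMeasure μ] (hμ : Integrable (fun y => y) μ)
    (x : ℝ) : Integrable (fun y => max (y - x) 0) μ :=
  (hμ.sub (integrable_const x)).pos_part

theorem upperStopLoss_nonneg (μ : Measure ℝ) (x : ℝ) : 0 ≤ upperStopLoss μ x :=
  integral_nonneg fun _ => le_max_right _ _

/-- Together with `le_upperStopLoss_sub` this is the subgradient inequality of a convex function. No
order between `x` and `y` is assumed, so both sides of the difference quotient are squeezed at once.
-/
theorem upperStopLoss_sub_le {μ : Measure ℝ} [IsFiniteMeasure μ]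
    (hμ : Integrable (fun y => y) μ) (x y : ℝ) :
    upperStopLoss μ x - upperStopLoss μ y ≤ (y - x) * μ.real (Ioi x) := by
  rw [upperStopLoss, upperStopLoss, ← integral_sub (integrable_max_sub hμ x)
    (integrable_max_sub hμ y), mul_comm, ← smul_eq_mul, ← integral_indicator_const _ measurableSet_Ioi]
  refine integral_mono ((integrable_max_sub hμ x).sub (integrable_max_sub hμ y))
    ((integrable_const _).indicator measurableSet_Ioi) fun u => ?_
  by_cases hu : u ∈ Ioi x
  · simp only [indicator_of_mem hu]
    rw [max_eq_left (by linarith [mem_Ioi.1 hu] : (0 : ℝ) ≤ u - x)]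
    linarith [le_max_left (u - y) 0]
  · simp only [indicator_of_notMem hu]
    rw [max_eq_right (by linarith [notMem_Ioi.1 hu] : u - x ≤ 0)]
    linarith [le_max_right (u - y) 0]

theorem le_upperStopLoss_sub {μ : Measure ℝ} [IsFiniteMeasure μ]
    (hμ : Integrable (fun y => y) μ) (x y : ℝ) :
    (y - x) * μ.real (Ioi y) ≤ upperStopLoss μ x - upperStopLoss μ y := by
  rw [upperStopLoss, upperStopLoss, ← integral_sub (integrable_max_sub hμ x)
    (integrable_max_sub hμ y), mul_comm, ← smul_eq_mul, ← integral_indicator_const _ measurableSet_Ioi]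
  refine integral_mono ((integrable_const _).indicator measurableSet_Ioi)
    ((integrable_max_sub hμ x).sub (integrable_max_sub hμ y)) fun u => ?_
  by_cases hu : u ∈ Ioi y
  · simp only [indicator_of_mem hu]
    rw [max_eq_left (by linarith [mem_Ioi.1 hu] : (0 : ℝ) ≤ u - y)]
    linarith [le_max_left (u - x) 0]
  · simp only [indicator_of_notMem hu]
    rw [max_eq_right (by linarith [notMem_Ioi.1 hu] : u - y ≤ 0)]
    linarith [le_max_right (u - x) 0]

theorem antitone_tail (μ : Measure ℝ) [IsFiniteMeasure μ] :
    Antitone fun x => μ.real (Ioi x) :=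
  fun _ _ h => measureReal_mono (Ioi_subset_Ioi h)

theorem continuous_tail (μ : Measure ℝ) [IsFiniteMeasure μ] [NullSingletonClass μ] :
    Continuous fun x => μ.real (Ioi x) := by
  rw [continuous_iff_continuousAt]
  intro x
  have h : (fun x => μ.real (Ioi x)) = fun x => ∫ y, (Ioi x).indicator (fun _ => (1 : ℝ)) y ∂μ := by
    funext x
    rw [integral_indicator_const _ measurableSet_Ioi]; simp
  rw [h]
  refine tendsto_integral_filter_of_dominated_convergence (fun _ => 1) ?_ ?_ (integrable_const _) ?_
  · exact .of_forall fun y => (measurable_const.indicator measurableSet_Ioi).aestronglyMeasurable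
  · exact .of_forall fun y => .of_forall fun u => by
      by_cases hu : u ∈ Ioi y
      · simp [indicator_of_mem hu]
      · simp [indicator_of_notMem hu]
  · have hne : ∀ᵐ u ∂μ, u ≠ x := by
      rw [ae_iff]; simp
    filter_upwards [hne] with u hu
    refine tendsto_const_nhds.congr' ?_
    rcases lt_or_gt_of_ne hu with hu | hu
    · filter_upwards [lt_mem_nhds hu] with y hy
      rw [indicator_of_notMem (by simp [hu.le]), indicator_of_notMem (by simp [le_of_lt hy])]
    · filter_upwards [gt_mem_nhds hu] with y hy
      rw [indicator_of_mem (by simpa using hu), indicator_of_mem (by simpa using hy)]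

theorem hasDerivAt_upperStopLoss {μ : Measure ℝ} [IsFiniteMeasure μ] [NullSingletonClass μ]
    (hμ : Integrable (fun y => y) μ) (x : ℝ) :
    HasDerivAt (upperStopLoss μ) (-μ.real (Ioi x)) x := by
  rw [hasDerivAt_iff_tendsto_slope]
  have hc : Tendsto (fun y => μ.real (Ioi y)) (𝓝[≠] x) (𝓝 (μ.real (Ioi x))) :=
    (continuous_tail μ).continuousAt.tendsto.mono_left nhdsWithin_le_nhds
  have h1 : Tendsto (fun y => -μ.real (Ioi (min x y))) (𝓝[≠] x) (𝓝 (-μ.real (Ioi x))) := by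
    have : Continuous fun y => -μ.real (Ioi (min x y)) :=
      ((continuous_tail μ).comp (continuous_const.min continuous_id)).neg
    simpa using this.continuousAt.tendsto.mono_left (nhdsWithin_le_nhds (a := x) (s := {x}ᶜ))
  have h2 : Tendsto (fun y => -μ.real (Ioi (max x y))) (𝓝[≠] x) (𝓝 (-μ.real (Ioi x))) := by
    have : Continuous fun y => -μ.real (Ioi (max x y)) :=
      ((continuous_tail μ).comp (continuous_const.max continuous_id)).neg
    simpa using this.continuousAt.tendsto.mono_left (nhdsWithin_le_nhds (a := x) (s := {x}ᶜ))
  refine tendsto_of_tendsto_of_tendsto_of_le_of_le' h1 h2 ?_ ?_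
  · filter_upwards [self_mem_nhdsWithin] with y hy
    rw [slope_def_field]
    rcases lt_or_gt_of_ne (show y ≠ x from hy) with h | h
    · rw [min_eq_right h.le, le_div_iff_of_neg (by linarith)]
      linarith [upperStopLoss_sub_le hμ x y, upperStopLoss_sub_le hμ y x]
    · rw [min_eq_left h.le, le_div_iff₀ (by linarith)]
      linarith [upperStopLoss_sub_le hμ x y, upperStopLoss_sub_le hμ y x]
  · filter_upwards [self_mem_nhdsWithin] with y hy
    rw [slope_def_field]
    rcases lt_or_gt_of_ne (show y ≠ x from hy) with h | h
    · rw [max_eq_left h.le, div_le_iff_of_neg (by linarith)]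
      linarith [le_upperStopLoss_sub hμ x y, le_upperStopLoss_sub hμ y x]
    · rw [max_eq_right h.le, div_le_iff₀ (by linarith)]
      linarith [le_upperStopLoss_sub hμ x y, le_upperStopLoss_sub hμ y x]

theorem tendsto_upperStopLoss_atTop {μ : Measure ℝ} [IsFiniteMeasure μ]
    (hμ : Integrable (fun y => y) μ) : Tendsto (upperStopLoss μ) atTop (𝓝 0) := by
  have h0 : (0 : ℝ) = ∫ _, (0 : ℝ) ∂μ := by simp
  rw [h0]
  refine tendsto_integral_filter_of_dominated_convergence (fun y => |y|) ?_ ?_ hμ.abs ?_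
  · exact .of_forall fun x => (integrable_max_sub hμ x).aestronglyMeasurable
  · filter_upwards [eventually_ge_atTop 0] with x hx
    refine .of_forall fun y => ?_
    rw [Real.norm_eq_abs, abs_of_nonneg (le_max_right _ _)]
    exact max_le (by linarith [le_abs_self y]) (abs_nonneg y)
  · refine .of_forall fun y => tendsto_const_nhds.congr' ?_
    filter_upwards [eventually_ge_atTop y] with x hx
    rw [max_eq_right (by linarith)]

/-- Exponentially tilted log-concave tails are quasi-concave. -/
theorem TailLogConcave.min_le {μ : Measure ℝ} [IsFiniteMeasure μ] [NullSingletonClass μ]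
    (h : TailLogConcave μ) (l : ℝ) {x y z : ℝ} (hxy : x ≤ y) (hyz : y ≤ z) :
    min (μ.real (Ioi x) * Real.exp (l * x)) (μ.real (Ioi z) * Real.exp (l * z)) ≤
      μ.real (Ioi y) * Real.exp (l * y) := by
  rcases (measureReal_nonneg (μ := μ) (s := Ioi z)).eq_or_lt with h0 | h0
  · rw [← h0]
    exact (min_le_right _ _).trans (by rw [zero_mul]; positivity)
  -- The tilt `e^{lx}` is log-linear and preserves the midpoint inequality. Quasi-concavity of every
  -- tilt expresses log-concavity without taking logarithms of tails that may vanish.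
  refine min_le_of_midpoint (g := fun x => μ.real (Ioi x) * Real.exp (l * x))
    ((continuous_tail μ).mul (by fun_prop)) ?_ hxy hyz ?_
  · intro w k hk
    have := h (w - k) w k (by linarith) hk
    rw [sub_add_cancel] at this
    have he : Real.exp (l * (w - k)) * Real.exp (l * (w + k)) = Real.exp (l * w) ^ 2 := by
      rw [← Real.exp_add, ← Real.exp_nat_mul]; congr 1; push_cast; ring
    calc _ = (μ.real (Ioi (w - k)) * μ.real (Ioi (w + k))) *
          (Real.exp (l * (w - k)) * Real.exp (l * (w + k))) := by ring
      _ ≤ (μ.real (Ioi w) * μ.real (Ioi w)) * Real.exp (l * w) ^ 2 := by rw [he]; gcongr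
      _ = _ := by ring
  · intro w hw
    exact mul_pos (h0.trans_le (antitone_tail μ hw.2)) (Real.exp_pos _)

theorem nonpos_of_monotoneOn_of_tendsto {R : ℝ → ℝ} {x : ℝ} (hR : MonotoneOn R (Ici x))
    (hlim : Tendsto R atTop (𝓝 0)) : R x ≤ 0 := by
  refine ge_of_tendsto hlim ?_
  filter_upwards [eventually_ge_atTop x] with y hy
  exact hR self_mem_Ici hy hy

theorem tendsto_exp_neg_mul_atTop {l : ℝ} (hl : 0 < l) (C x₀ : ℝ) :
    Tendsto (fun x => C * Real.exp (-(l * (x - x₀)))) atTop (𝓝 0) := by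
  have h1 : Tendsto (fun x => l * (x - x₀)) atTop atTop :=
    (tendsto_atTop_add_const_right _ (-x₀) tendsto_id).const_mul_atTop hl
  simpa using (Real.tendsto_exp_neg_atTop_nhds_zero.comp h1).const_mul C

theorem hasDerivAt_stopLoss_sub_exp {μ : Measure ℝ} [IsFiniteMeasure μ] [NullSingletonClass μ]
    (hμ : Integrable (fun y => y) μ) {a l : ℝ} (hl : l ≠ 0) (x₀ x : ℝ) :
    HasDerivAt (fun x => upperStopLoss μ x - a / l * Real.exp (-(l * (x - x₀))))
      (-μ.real (Ioi x) + a * Real.exp (-(l * (x - x₀)))) x := by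
  have h1 : HasDerivAt (fun x => Real.exp (-(l * (x - x₀))))
      (Real.exp (-(l * (x - x₀))) * -(l * 1)) x :=
    ((((hasDerivAt_id x).sub_const x₀).const_mul l).neg).exp
  refine ((hasDerivAt_upperStopLoss hμ x).sub (h1.const_mul (a / l))).congr_deriv ?_
  field_simp
  ring

/-- Growth of a log-concave tail to the left of `x₀`. -/
theorem TailLogConcave.tail_sub_le {μ : Measure ℝ} [IsFiniteMeasure μ] [NullSingletonClass μ]
    (h : TailLogConcave μ) (hμ : Integrable (fun y => y) μ) {x₀ : ℝ}
    (hpos : 0 < upperStopLoss μ x₀) {x : ℝ} (hx : x ≤ x₀) :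
    μ.real (Ioi x) ≤ μ.real (Ioi x₀) *
      Real.exp (-(μ.real (Ioi x₀) / upperStopLoss μ x₀ * (x - x₀))) := by
  rcases eq_or_lt_of_le hx with rfl | hx
  · simp
  by_contra! hlt
  set a := μ.real (Ioi x₀) with ha
  set ψ := upperStopLoss μ x₀ with hψ
  have ha0 : 0 ≤ a := measureReal_nonneg
  have hcont : ContinuousAt (fun l => a * Real.exp (-(l * (x - x₀)))) (a / ψ) := by fun_prop
  have hev := hcont.eventually (gt_mem_nhds hlt)
  -- If the bound fails, it still fails for some rate `l` strictly above `a / ψ`. Log-concavity then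
  -- forces the tail after `x₀` below `a e^{-l(z - x₀)}`, whose integral `a / l` is smaller than
  -- `ψ`, a contradiction.
  obtain ⟨l, hl, hll⟩ := ((hev.filter_mono (nhdsWithin_le_nhds (s := Ioi (a / ψ)))).and
    self_mem_nhdsWithin).exists
  have hl0 : 0 < l := lt_of_le_of_lt (by positivity) (show a / ψ < l from hll)
  have key : ∀ z, x₀ ≤ z → μ.real (Ioi z) ≤ a * Real.exp (-(l * (z - x₀))) := by
    intro z hz
    have hm := h.min_le l hx.le hz
    have h1 : μ.real (Ioi x₀) * Real.exp (l * x₀) < μ.real (Ioi x) * Real.exp (l * x) := by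
      rw [← ha]
      calc a * Real.exp (l * x₀) = a * Real.exp (-(l * (x - x₀))) * Real.exp (l * x) := by
            rw [mul_assoc, ← Real.exp_add]; congr 2; ring
        _ < _ := by
            have := Real.exp_pos (l * x)
            exact mul_lt_mul_of_pos_right hl this
    rcases min_le_iff.1 hm with h2 | h2
    · exact absurd h2 (not_le.2 h1)
    · rw [← ha] at h2
      calc μ.real (Ioi z) = μ.real (Ioi z) * Real.exp (l * z) * Real.exp (-(l * z)) := by
            rw [mul_assoc, ← Real.exp_add]; simp
        _ ≤ a * Real.exp (l * x₀) * Real.exp (-(l * z)) := by gcongr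
        _ = _ := by rw [mul_assoc, ← Real.exp_add]; congr 2; ring
  have hR : MonotoneOn (fun x => upperStopLoss μ x - a / l * Real.exp (-(l * (x - x₀)))) (Ici x₀) := by
    refine monotoneOn_of_deriv_nonneg (convex_Ici _)
      (fun z _ => (hasDerivAt_stopLoss_sub_exp hμ hl0.ne' x₀ z).continuousAt.continuousWithinAt)
      (fun z _ => (hasDerivAt_stopLoss_sub_exp hμ hl0.ne' x₀ z).differentiableAt.differentiableWithinAt)
      fun z hz => ?_
    rw [(hasDerivAt_stopLoss_sub_exp hμ hl0.ne' x₀ z).deriv]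
    rw [interior_Ici] at hz
    linarith [key z (le_of_lt hz)]
  have hlim := (tendsto_upperStopLoss_atTop hμ).sub (tendsto_exp_neg_mul_atTop hl0 (a / l) x₀)
  rw [sub_zero] at hlim
  have hfin := nonpos_of_monotoneOn_of_tendsto hR hlim
  simp only [sub_self, mul_zero, neg_zero, Real.exp_zero, mul_one] at hfin
  rw [← hψ, sub_nonpos, le_div_iff₀ hl0] at hfin
  have : a < l * ψ := (div_lt_iff₀ hpos).1 hll
  linarith

theorem tail_pos_of_upperStopLoss_pos {μ : Measure ℝ} [IsFiniteMeasure μ] {x₀ : ℝ}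
    (hpos : 0 < upperStopLoss μ x₀) : 0 < μ.real (Ioi x₀) := by
  rw [measureReal_def, ENNReal.toReal_pos_iff]
  refine ⟨pos_iff_ne_zero.2 fun h0 => hpos.ne' ?_, measure_lt_top _ _⟩
  rw [upperStopLoss]
  refine integral_eq_zero_of_ae ?_
  have : ∀ᵐ y ∂μ, ¬ x₀ < y := by rw [ae_iff]; simp only [not_not]; exact h0
  filter_upwards [this] with y hy
  simpa using not_lt.1 hy

/-- The logarithmic tangent bound for the stop-loss transform of a law with log-concave tail. -/
theorem TailLogConcave.upperStopLoss_le {μ : Measure ℝ} [IsFiniteMeasure μ] [NullSingletonClass μ]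
    (h : TailLogConcave μ) (hμ : Integrable (fun y => y) μ) {x₀ : ℝ}
    (hpos : 0 < upperStopLoss μ x₀) (x : ℝ) :
    upperStopLoss μ x ≤ upperStopLoss μ x₀ *
      Real.exp (-(μ.real (Ioi x₀) / upperStopLoss μ x₀ * (x - x₀))) := by
  have ha0 := tail_pos_of_upperStopLoss_pos hpos
  have htail := fun z => h.tail_sub_le hμ hpos (x := z)
  set a := μ.real (Ioi x₀) with ha
  set ψ := upperStopLoss μ x₀ with hψ
  set l := a / ψ with hl
  have hl0 : 0 < l := by positivity
  have hal : a / l = ψ := by rw [hl]; field_simp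
  have hd := hasDerivAt_stopLoss_sub_exp (a := a) hμ hl0.ne' x₀
  set R := fun x => upperStopLoss μ x - a / l * Real.exp (-(l * (x - x₀))) with hR
  have hR0 : R x₀ = 0 := by simp [hR, hal, ← hψ]
  suffices R x ≤ 0 by
    simp only [hR, hal] at this; linarith
  have mono : ∀ s : Set ℝ, Convex ℝ s → (∀ z ∈ s, μ.real (Ioi z) ≤ a * Real.exp (-(l * (z - x₀)))) →
      MonotoneOn R s := by
    intro s hs hz
    refine monotoneOn_of_deriv_nonneg hs
      (fun z _ => (hd z).continuousAt.continuousWithinAt)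
      (fun z _ => (hd z).differentiableAt.differentiableWithinAt) fun z hz' => ?_
    rw [(hd z).deriv]
    linarith [hz z (interior_subset hz')]
  -- `R` vanishes at `x₀` and at infinity, and `R'` is the tangent exponential's tail minus the
  -- actual one. To the left of `x₀` it is nonnegative by `tail_sub_le`.
  rcases le_total x x₀ with hx | hx
  · rw [← hR0]
    exact mono (Iic x₀) (convex_Iic _) htail hx self_mem_Iic hx
  have conv : ∀ z, μ.real (Ioi z) * Real.exp (l * z) * Real.exp (-(l * z)) = μ.real (Ioi z) := by
    intro z; rw [mul_assoc, ← Real.exp_add]; simp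
  have conv' : ∀ z, a * Real.exp (l * x₀) * Real.exp (-(l * z)) =
      a * Real.exp (-(l * (z - x₀))) := by
    intro z; rw [mul_assoc, ← Real.exp_add]; congr 2; ring
  -- By quasi-concavity of the tilted tail, either `R' ≥ 0` on all of `[x, ∞)`, where `R` increases
  -- to `0`, or `R' ≤ 0` on `[x₀, x]`, where `R` decreases from `0`.
  rcases lt_or_ge (μ.real (Ioi x) * Real.exp (l * x)) (a * Real.exp (l * x₀)) with hc | hc
  · refine nonpos_of_monotoneOn_of_tendsto (mono (Ici x) (convex_Ici _) fun z hz => ?_) ?_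
    · have hm := h.min_le l hx hz
      rw [← ha] at hm
      have : μ.real (Ioi z) * Real.exp (l * z) ≤ a * Real.exp (l * x₀) := by
        rcases min_le_iff.1 hm with h2 | h2
        · exact absurd h2 (not_le.2 hc)
        · exact h2.trans hc.le
      rw [← conv z, ← conv' z]
      gcongr
    · simpa using (tendsto_upperStopLoss_atTop hμ).sub (tendsto_exp_neg_mul_atTop hl0 (a / l) x₀)
  · rw [← hR0]
    refine antitoneOn_of_deriv_nonpos (convex_Icc x₀ x)
      (fun z _ => (hd z).continuousAt.continuousWithinAt)
      (fun z _ => (hd z).differentiableAt.differentiableWithinAt) (fun z hz => ?_)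
      (left_mem_Icc.2 hx) (right_mem_Icc.2 hx) hx
    rw [(hd z).deriv]
    have hz' := interior_subset hz
    have hm := h.min_le l hz'.1 hz'.2
    rw [← ha, min_eq_left hc] at hm
    have : a * Real.exp (l * x₀) * Real.exp (-(l * z)) ≤
        μ.real (Ioi z) * Real.exp (l * z) * Real.exp (-(l * z)) := by gcongr
    rw [conv, conv'] at this
    linarith

/-! ### The extremal stop-loss transforms -/

/-- The stop-loss transform `𝔼 (|Y| - x)₊` of a law `μ` on the line. -/
def stopLoss (μ : Measure ℝ) (x : ℝ) : ℝ := ∫ y, max (|y| - x) 0 ∂μ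

/-- The decay rate of the normalised extremal law with parameter `t`. -/
def extremalRate (t : ℝ) : ℝ := 2 * Real.exp (-t) / (2 - t)

/-- The stop-loss transform of `|Y|` for `Y` proportional to `(ℰ - 1) - (1 - t) (ℰ' - 1)` with
`ℰ, ℰ'` independent standard exponentials, normalised by `𝔼 |Y| = 1`. It interpolates between
the double-exponential law (`t = 0`) and the one-sided one (`t = 1`). -/
def extremalStopLoss (t x : ℝ) : ℝ :=
  if extremalRate t * x ≤ t then Real.cosh (extremalRate t * x) - x
  else (Real.exp (-(extremalRate t * x)) +
    (1 - t) ^ 2 * Real.exp t * Real.exp (-((extremalRate t * x - t) / (1 - t)))) / 2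

theorem extremalRate_pos {t : ℝ} (ht : t ≤ 1) : 0 < extremalRate t :=
  div_pos (by positivity) (by linarith)

theorem stopLoss_eq_add {μ : Measure ℝ} [IsFiniteMeasure μ] (hi : Integrable (fun y => y) μ)
    {x : ℝ} (hx : 0 ≤ x) :
    stopLoss μ x = upperStopLoss μ x + upperStopLoss (μ.map Neg.neg) x := by
  have h1 : upperStopLoss (μ.map Neg.neg) x = ∫ y, max (-y - x) 0 ∂μ := by
    rw [upperStopLoss, integral_map measurable_neg.aemeasurable (by fun_prop)]
  have h2 : Integrable (fun y => max (-y - x) 0) μ := (hi.neg.sub (integrable_const x)).pos_part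
  rw [h1, stopLoss, upperStopLoss, ← integral_add (integrable_max_sub hi x) h2]
  congr 1
  funext y
  rcases le_total 0 y with hy | hy
  · rw [abs_of_nonneg hy, max_eq_right (by linarith : -y - x ≤ 0), add_zero]
  · rw [abs_of_nonpos hy, max_eq_right (by linarith : y - x ≤ 0), zero_add]

theorem stopLoss_map_neg (μ : Measure ℝ) : stopLoss (μ.map Neg.neg) = stopLoss μ := by
  funext x
  rw [stopLoss, stopLoss, integral_map measurable_neg.aemeasurable (by fun_prop)]
  simp

theorem upperStopLoss_map_neg {μ : Measure ℝ} [IsProbabilityMeasure μ]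
    (hi : Integrable (fun y => y) μ) (hm : ∫ y, y ∂μ = 0) (x : ℝ) :
    upperStopLoss (μ.map Neg.neg) x = upperStopLoss μ (-x) - x := by
  have h1 : upperStopLoss (μ.map Neg.neg) x = ∫ y, max (-y - x) 0 ∂μ := by
    rw [upperStopLoss, integral_map measurable_neg.aemeasurable (by fun_prop)]
  have h2 : ∫ y, (max (y - -x) 0 - (y + x)) ∂μ = upperStopLoss μ (-x) - x := by
    have h3 : Integrable (fun y => y + x) μ := hi.add (integrable_const x)
    rw [integral_sub (integrable_max_sub hi _) h3,
      integral_add hi (integrable_const x), hm, upperStopLoss]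
    simp
  rw [h1, ← h2]
  congr 1
  funext y
  rcases le_total 0 (y + x) with hy | hy
  · rw [max_eq_right (by linarith : -y - x ≤ 0), max_eq_left (by linarith)]; ring
  · rw [max_eq_left (by linarith : 0 ≤ -y - x), max_eq_right (by linarith)]; ring

theorem upperStopLoss_zero_of_mean_zero {μ : Measure ℝ} [IsProbabilityMeasure μ]
    (hi : Integrable (fun y => y) μ) (hm : ∫ y, y ∂μ = 0) (ha : ∫ y, |y| ∂μ = 1) :
    upperStopLoss μ 0 = 1 / 2 := by
  have h1 := stopLoss_eq_add hi le_rfl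
  rw [upperStopLoss_map_neg hi hm] at h1
  have h2 : stopLoss μ 0 = 1 := by
    rw [stopLoss, ← ha]
    congr 1
    funext y
    simp
  rw [h2] at h1
  simp only [neg_zero, sub_zero] at h1
  linarith

theorem tail_map_neg {μ : Measure ℝ} [IsProbabilityMeasure μ] [NullSingletonClass μ] (x : ℝ) :
    (μ.map Neg.neg).real (Ioi x) = 1 - μ.real (Ioi (-x)) := by
  have h1 : (μ.map Neg.neg).real (Ioi x) = μ.real (Iio (-x)) := by
    rw [map_measureReal_apply measurable_neg measurableSet_Ioi]
    congr 1
    ext y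
    simp only [mem_preimage, mem_Ioi, mem_Iio]
    constructor <;> intro h <;> linarith
  have h2 : μ.real (Iio (-x)) = μ.real (Iic (-x)) := measureReal_congr Iio_ae_eq_Iic
  have h3 := probReal_compl_eq_one_sub (μ := μ) (measurableSet_Ioi (a := -x))
  rw [compl_Ioi] at h3
  rw [h1, h2, h3]

theorem exists_exp_mul_two_sub_eq {z : ℝ} (h2 : 2 ≤ z) (he : z ≤ Real.exp 1) :
    ∃ t ∈ Icc (0 : ℝ) 1, Real.exp t * (2 - t) = z := by
  have hc : ContinuousOn (fun t : ℝ => Real.exp t * (2 - t)) (Icc 0 1) := by fun_prop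
  have := intermediate_value_Icc (zero_le_one (α := ℝ)) hc
  refine this ⟨by simpa using h2, ?_⟩
  norm_num
  exact he

/-- With `a = μ(0, ∞)`, the tangent of `ψ` at `0` gives `ψ(x) ≤ e^{-2ax}/2` and `ψ(-x) - x ≤
e^{2ax}/2 - x`. The second bound is used only up to `τ = t/(2a)`, and from there on the tangent of
the reflected transform takes over. The assumption `a ≤ 1/2`, free up to reflection, gives `1/a ≥
2`. -/
theorem stopLoss_le_extremal_of_tail_le {μ : Measure ℝ} [IsProbabilityMeasure μ]
    [NullSingletonClass μ] (hr : TailLogConcave μ) (hl : TailLogConcave (μ.map Neg.neg))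
    (hi : Integrable (fun y => y) μ) (hm : ∫ y, y ∂μ = 0) (ha : ∫ y, |y| ∂μ = 1)
    (hhalf : μ.real (Ioi 0) ≤ 1 / 2) :
    ∃ t ∈ Icc (0 : ℝ) 1, ∀ x, 0 ≤ x → stopLoss μ x ≤ extremalStopLoss t x := by
  have hψ := upperStopLoss_zero_of_mean_zero hi hm ha
  have hψ0 : 0 < upperStopLoss μ 0 := by rw [hψ]; norm_num
  have ha0 := tail_pos_of_upperStopLoss_pos hψ0
  have hS := fun x => hr.tail_sub_le hi hψ0 (x := x)
  have hΨ := fun x => hr.upperStopLoss_le hi hψ0 x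
  have hneg := upperStopLoss_map_neg hi hm
  have htneg := tail_map_neg (μ := μ)
  set ν := μ.map Neg.neg with hν
  have : IsProbabilityMeasure ν := Measure.isProbabilityMeasure_map measurable_neg.aemeasurable
  have : NullSingletonClass ν := ⟨fun x => by
    rw [hν, Measure.map_apply measurable_neg (measurableSet_singleton x)]
    simp⟩
  have hiν : Integrable (fun y => y) ν := by
    rw [hν, integrable_map_measure (by fun_prop) measurable_neg.aemeasurable]
    exact hi.neg
  rw [hψ] at hS hΨ
  set a := μ.real (Ioi 0) with hadef
  simp only [sub_zero, show a / (1 / 2) = 2 * a by ring] at hS hΨ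
  -- the inequality of Grünbaum
  have hgr : 1 / a ≤ Real.exp 1 := by
    -- The chosen point minimises `e^{2ax}/2 - x`, an upper bound for a nonnegative quantity.
    have h0 := upperStopLoss_nonneg ν (Real.log (1 / a) / (2 * a))
    rw [hneg] at h0
    have h1 := hΨ (-(Real.log (1 / a) / (2 * a)))
    have h2 : -(2 * a * -(Real.log (1 / a) / (2 * a))) = Real.log (1 / a) := by field_simp
    rw [h2, Real.exp_log (by positivity)] at h1
    have h3 : Real.log (1 / a) / (2 * a) ≤ 1 / 2 * (1 / a) := by linarith
    rw [div_le_iff₀ (by positivity)] at h3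
    have h4 : 1 / 2 * (1 / a) * (2 * a) = 1 := by field_simp
    rw [h4, Real.log_le_iff_le_exp (by positivity)] at h3
    exact h3
  obtain ⟨t, ht, hta⟩ := exists_exp_mul_two_sub_eq
    (by rw [le_div_iff₀ ha0]; linarith : 2 ≤ 1 / a) hgr
  have h2t : 0 < 2 - t := by linarith [ht.2]
  have hat : a * (Real.exp t * (2 - t)) = 1 := by rw [hta]; field_simp
  have hrate : extremalRate t = 2 * a := by
    rw [extremalRate, Real.exp_neg, div_eq_iff h2t.ne']
    field_simp
    linear_combination -hat
  refine ⟨t, ht, fun x hx => ?_⟩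
  rw [stopLoss_eq_add hi hx, ← hν, extremalStopLoss, hrate]
  have hx1 := hΨ x
  split_ifs with hxt
  · have hx2 := hΨ (-x)
    rw [show -(2 * a * -x) = 2 * a * x by ring] at hx2
    rw [hneg, Real.cosh_eq]
    linarith
  · push Not at hxt
    -- The relation `1/a = e^t (2 - t)` is what makes the two branches join with equal value and
    -- slope at `τ`: there `e^{2aτ}/2 - τ = (1-t)² e^t / 2`, and the tail bound `1 - a e^t` is this
    -- value times the rate `2a/(1-t)`.
    set τ := t / (2 * a) with hτ
    have hτ0 : 0 ≤ τ := div_nonneg ht.1 (by positivity)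
    have hτt : 2 * a * τ = t := by rw [hτ]; field_simp
    have hτx : τ ≤ x := by rw [hτ, div_le_iff₀ (by positivity)]; linarith
    have hΦτ : upperStopLoss ν τ ≤ (1 - t) ^ 2 * Real.exp t / 2 := by
      rw [hneg]
      have h1 := hΨ (-τ)
      rw [show -(2 * a * -τ) = 2 * a * τ by ring, hτt] at h1
      have h2 : τ = t * (Real.exp t * (2 - t)) / 2 := by
        rw [hta, hτ]; field_simp
      nlinarith
    have hTτ : 1 - a * Real.exp t ≤ ν.real (Ioi τ) := by
      rw [htneg]
      have h1 := hS (-τ) (by linarith)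
      rw [show -(2 * a * -τ) = 2 * a * τ by ring, hτt] at h1
      linarith
    have hanti : upperStopLoss ν x ≤ upperStopLoss ν τ := by
      have := le_upperStopLoss_sub hiν τ x
      have h0 : 0 ≤ (x - τ) * ν.real (Ioi x) := mul_nonneg (by linarith) measureReal_nonneg
      linarith
    suffices H : upperStopLoss ν x ≤
        (1 - t) ^ 2 * Real.exp t * Real.exp (-((2 * a * x - t) / (1 - t))) / 2 by linarith
    -- A zero value at `τ` stays zero afterwards; this includes `t = 1`, where the rate is
    -- undefined.
    rcases (upperStopLoss_nonneg ν τ).eq_or_lt with h0 | hpos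
    · rw [← h0] at hanti
      exact hanti.trans (by positivity)
    · have ht1 : t < 1 := by
        refine lt_of_le_of_ne ht.2 fun h => ?_
        rw [h] at hΦτ
        norm_num at hΦτ
        linarith
      have hs : 0 < 1 - t := by linarith
      refine (hl.upperStopLoss_le hiν hpos x).trans ?_
      have hlow : 2 * a / (1 - t) ≤ ν.real (Ioi τ) / upperStopLoss ν τ := by
        rw [div_le_div_iff₀ hs hpos]
        have e1 : a * Real.exp t = 1 / (2 - t) := by
          rw [eq_div_iff h2t.ne']; linarith
        have e2 : 1 - a * Real.exp t = (1 - t) / (2 - t) := by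
          rw [e1]; field_simp; ring
        calc 2 * a * upperStopLoss ν τ ≤ 2 * a * ((1 - t) ^ 2 * Real.exp t / 2) := by gcongr
          _ = (1 - a * Real.exp t) * (1 - t) := by
              rw [e2, show 2 * a * ((1 - t) ^ 2 * Real.exp t / 2) =
                (a * Real.exp t) * (1 - t) ^ 2 by ring, e1]
              field_simp
          _ ≤ _ := by gcongr
      have hexp : Real.exp (-(ν.real (Ioi τ) / upperStopLoss ν τ * (x - τ))) ≤
          Real.exp (-((2 * a * x - t) / (1 - t))) := by
        rw [Real.exp_le_exp, neg_le_neg_iff]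
        calc (2 * a * x - t) / (1 - t) = 2 * a / (1 - t) * (x - τ) := by
              rw [← hτt]; ring
          _ ≤ _ := mul_le_mul_of_nonneg_right hlow (by linarith)
      calc _ ≤ (1 - t) ^ 2 * Real.exp t / 2 * Real.exp (-((2 * a * x - t) / (1 - t))) := by
            gcongr
        _ = _ := by ring

/-- The stop-loss transform of a normalised mean-zero law with log-concave tails lies below an
extremal one. -/
theorem exists_stopLoss_le_extremal {μ : Measure ℝ} [IsProbabilityMeasure μ]
    [NullSingletonClass μ] (hr : TailLogConcave μ) (hl : TailLogConcave (μ.map Neg.neg))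
    (hi : Integrable (fun y => y) μ) (hm : ∫ y, y ∂μ = 0) (ha : ∫ y, |y| ∂μ = 1) :
    ∃ t ∈ Icc (0 : ℝ) 1, ∀ x, 0 ≤ x → stopLoss μ x ≤ extremalStopLoss t x := by
  rcases le_total (μ.real (Ioi 0)) (1 / 2) with h | h
  · exact stopLoss_le_extremal_of_tail_le hr hl hi hm ha h
  have htn := tail_map_neg (μ := μ) 0
  rw [← stopLoss_map_neg]
  set ν := μ.map Neg.neg with hν
  have : IsProbabilityMeasure ν := Measure.isProbabilityMeasure_map measurable_neg.aemeasurable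
  have : NullSingletonClass ν := ⟨fun x => by
    rw [hν, Measure.map_apply measurable_neg (measurableSet_singleton x)]
    simp⟩
  have hνμ : ν.map Neg.neg = μ := by
    rw [hν, Measure.map_map measurable_neg measurable_neg]
    simp
  refine stopLoss_le_extremal_of_tail_le hl (by rwa [hνμ]) ?_ ?_ ?_ ?_
  · rw [hν, integrable_map_measure (by fun_prop) measurable_neg.aemeasurable]
    exact hi.neg
  · rw [hν, integral_map measurable_neg.aemeasurable (by fun_prop), integral_neg, hm, neg_zero]
  · rw [hν, integral_map measurable_neg.aemeasurable (by fun_prop)]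
    simpa using ha
  · rw [htn, neg_zero]; linarith

/-! ### Moments as integrals of the stop-loss transform -/

/-- The kernel `r`, `m - r` or `x - m + r`, according to the range of `p`. -/
def stopLossKernel (p x m r : ℝ) : ℝ := if 1 < p then r else if 0 < p then m - r else x - m + r

/-- The integral of the stop-loss kernel against `x ^ (p - 2)`. -/
def stopLossIntegral (p : ℝ) (π : ℝ → ℝ) : ℝ≥0∞ :=
  ∫⁻ x in Ioi 0, ENNReal.ofReal (x ^ (p - 2) * stopLossKernel p x 1 (π x))

/-- The `p`-th absolute moment expressed through a stop-loss transform with `𝔼 |Y| = 1`. -/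
def stopLossMoment (p : ℝ) (π : ℝ → ℝ) : ℝ≥0∞ :=
  ENNReal.ofReal |p * (p - 1)| * stopLossIntegral p π

theorem setLIntegral_Ioi_zero_of_split {f g h : ℝ → ℝ} {y A B : ℝ} (hy : 0 < y)
    (hf0 : ∀ x, 0 < x → 0 ≤ f x) (hg : ∀ x, 0 < x → x ≤ y → f x = g x) (hh : ∀ x, y < x → f x = h x)
    (hgi : IntegrableOn g (Ioc 0 y)) (hhi : IntegrableOn h (Ioi y))
    (hA : ∫ x in Ioc 0 y, g x = A) (hB : ∫ x in Ioi y, h x = B) :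
    ∫⁻ x in Ioi 0, ENNReal.ofReal (f x) = ENNReal.ofReal (A + B) := by
  have e1 : EqOn f g (Ioc 0 y) := fun x hx => hg x hx.1 hx.2
  have e2 : EqOn f h (Ioi y) := fun x hx => hh x hx
  have f1 : IntegrableOn f (Ioc 0 y) := hgi.congr_fun e1.symm measurableSet_Ioc
  have f2 : IntegrableOn f (Ioi y) := hhi.congr_fun e2.symm measurableSet_Ioi
  have hu : Ioc 0 y ∪ Ioi y = Ioi 0 := Ioc_union_Ioi_eq_Ioi hy.le
  have f3 : IntegrableOn f (Ioi 0) := by rw [← hu]; exact f1.union f2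
  have hd : Disjoint (Ioc 0 y) (Ioi y) := Set.disjoint_left.2 fun z hz hz' => not_lt.2 hz.2 hz'
  rw [← ofReal_integral_eq_lintegral_ofReal f3
    ((ae_restrict_iff' measurableSet_Ioi).2 (.of_forall fun x hx => hf0 x hx)), ← hu,
    setIntegral_union hd measurableSet_Ioi f1 f2, setIntegral_congr_fun measurableSet_Ioc e1,
    setIntegral_congr_fun measurableSet_Ioi e2, hA, hB]

theorem integral_Ioc_rpow {r y : ℝ} (hr : -1 < r) (hy : 0 ≤ y) :
    ∫ x in Ioc 0 y, x ^ r = y ^ (r + 1) / (r + 1) := by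
  rw [← intervalIntegral.integral_of_le hy, integral_rpow (.inl hr), Real.zero_rpow (by linarith),
    sub_zero]

theorem integrableOn_Ioc_rpow {r : ℝ} (hr : -1 < r) (y : ℝ) :
    IntegrableOn (fun x : ℝ => x ^ r) (Ioc 0 y) :=
  (intervalIntegral.intervalIntegrable_rpow' hr (a := 0) (b := y)).1

/-- Up to sign, `p(p-1) x^(p-2)` is the second derivative of `x^p`. The kernel is `(y - x)₊`, `min x
y` or `(x - y)₊` as `p > 1`, `0 < p < 1` or `p < 0`: these differ by affine terms chosen so that the
integral converges at both ends. -/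
theorem ofReal_rpow_eq_lintegral_stopLossKernel {p y : ℝ} (hp0 : p ≠ 0) (hp1 : p ≠ 1)
    (hy : 0 < y) :
    ENNReal.ofReal y ^ p = ENNReal.ofReal |p * (p - 1)| *
      ∫⁻ x in Ioi 0, ENNReal.ofReal (x ^ (p - 2) * stopLossKernel p x y (max (y - x) 0)) := by
  have hyp : y * y ^ (p - 1) = y ^ p := by
    rw [← Real.rpow_one_add' hy.le (by simpa using hp0)]; simp
  rcases lt_trichotomy p 0 with h0 | h0 | h0
  · have hk : ∀ x, stopLossKernel p x y (max (y - x) 0) = max (x - y) 0 := by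
      intro x
      rw [stopLossKernel, if_neg (by linarith), if_neg (by linarith)]
      rcases le_total x y with h | h
      · rw [max_eq_left (by linarith), max_eq_right (by linarith)]; ring
      · rw [max_eq_right (by linarith), max_eq_left (by linarith)]; ring
    have i1 : IntegrableOn (fun x : ℝ => x ^ (p - 1)) (Ioi y) :=
      integrableOn_Ioi_rpow_of_lt (by linarith) hy
    have i2 : IntegrableOn (fun x : ℝ => y * x ^ (p - 2)) (Ioi y) :=
      (integrableOn_Ioi_rpow_of_lt (by linarith) hy).const_mul y
    rw [setLIntegral_Ioi_zero_of_split (g := fun _ => 0)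
      (h := fun x => x ^ (p - 1) - y * x ^ (p - 2)) (A := 0) (B := y ^ p / |p * (p - 1)|) hy ?_ ?_ ?_
      (by simp) (i1.sub i2) (by simp)]
    · rw [← ENNReal.ofReal_mul (abs_nonneg _), ENNReal.ofReal_rpow_of_pos hy, zero_add,
        mul_div_cancel₀ _ (abs_pos.2 (mul_ne_zero hp0 (sub_ne_zero.2 hp1))).ne']
    · rw [integral_sub i1 i2, integral_const_mul, integral_Ioi_rpow_of_lt (by linarith) hy,
        integral_Ioi_rpow_of_lt (by linarith) hy, abs_of_pos (by nlinarith),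
        show p - 1 + 1 = p by ring, show p - 2 + 1 = p - 1 by ring,
        mul_div_assoc', mul_neg, hyp]
      have : p - 1 ≠ 0 := by linarith
      field_simp
      ring
    · intro x hx
      rw [hk]; positivity
    · intro x _ hxy
      rw [hk, max_eq_right (by linarith), mul_zero]
    · intro x hxy
      have hx : 0 < x := hy.trans hxy
      rw [hk, max_eq_left (by linarith), show p - 1 = (p - 2) + 1 by ring, Real.rpow_add_one hx.ne']
      ring
  · exact absurd h0 hp0
  rcases lt_or_gt_of_ne hp1 with h1 | h1
  · have hk : ∀ x, stopLossKernel p x y (max (y - x) 0) = min x y := by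
      intro x
      rw [stopLossKernel, if_neg (by linarith), if_pos h0]
      rcases le_total x y with h | h
      · rw [max_eq_left (by linarith), min_eq_left h]; ring
      · rw [max_eq_right (by linarith), min_eq_right h]; ring
    rw [setLIntegral_Ioi_zero_of_split (g := fun x => x ^ (p - 1))
      (h := fun x => y * x ^ (p - 2)) (A := y ^ p / p) (B := y ^ p / (1 - p)) hy ?_ ?_ ?_
      (integrableOn_Ioc_rpow (by linarith) y)
      ((integrableOn_Ioi_rpow_of_lt (by linarith) hy).const_mul y)]
    · rw [← ENNReal.ofReal_mul (abs_nonneg _), ENNReal.ofReal_rpow_of_pos hy,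
        abs_of_neg (by nlinarith)]
      congr 1
      have : 1 - p ≠ 0 := by linarith
      field_simp
      ring
    · rw [integral_Ioc_rpow (by linarith) hy.le]; simp
    · rw [integral_const_mul, integral_Ioi_rpow_of_lt (by linarith) hy,
        show p - 2 + 1 = p - 1 by ring, mul_div_assoc', mul_neg, hyp, ← neg_div_neg_eq, neg_neg, neg_sub]
    · intro x hx
      rw [hk]; positivity
    · intro x hx hxy
      rw [hk, min_eq_left hxy, show p - 1 = (p - 2) + 1 by ring, Real.rpow_add_one hx.ne']
    · intro x hxy
      rw [hk, min_eq_right hxy.le, mul_comm]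
  · have hk : ∀ x, stopLossKernel p x y (max (y - x) 0) = max (y - x) 0 := by
      intro x
      rw [stopLossKernel, if_pos h1]
    have i1 : IntegrableOn (fun x : ℝ => x ^ (p - 1)) (Ioc 0 y) :=
      integrableOn_Ioc_rpow (by linarith) y
    have i2 : IntegrableOn (fun x : ℝ => y * x ^ (p - 2)) (Ioc 0 y) :=
      (integrableOn_Ioc_rpow (by linarith) y).const_mul y
    rw [setLIntegral_Ioi_zero_of_split (h := fun _ => 0)
      (g := fun x => y * x ^ (p - 2) - x ^ (p - 1)) (B := 0) (A := y ^ p / |p * (p - 1)|) hy ?_ ?_ ?_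
      (i2.sub i1) (by simp) ?_ (by simp)]
    · rw [← ENNReal.ofReal_mul (abs_nonneg _), ENNReal.ofReal_rpow_of_pos hy, add_zero,
        mul_div_cancel₀ _ (abs_pos.2 (mul_ne_zero hp0 (sub_ne_zero.2 hp1))).ne']
    · intro x hx
      rw [hk]; positivity
    · intro x hx hxy
      rw [hk, max_eq_left (by linarith), show p - 1 = (p - 2) + 1 by ring, Real.rpow_add_one hx.ne']
      ring
    · intro x hxy
      rw [hk, max_eq_right (by linarith), mul_zero]
    · rw [integral_sub i2 i1, integral_const_mul, integral_Ioc_rpow (by linarith) hy.le,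
        integral_Ioc_rpow (by linarith) hy.le, abs_of_pos (by nlinarith),
        show p - 1 + 1 = p by ring, show p - 2 + 1 = p - 1 by ring,
        mul_div_assoc', hyp]
      have : p - 1 ≠ 0 := by linarith
      field_simp
      ring

theorem stopLossKernel_nonneg {p x y : ℝ} (hx : 0 ≤ x) (hy : 0 ≤ y) :
    0 ≤ stopLossKernel p x y (max (y - x) 0) := by
  rw [stopLossKernel]
  split_ifs
  · exact le_max_right _ _
  · rw [sub_nonneg]; exact max_le (by linarith) hy
  · linarith [le_max_left (y - x) 0]

/-- Tonelli's theorem: the kernel is affine in `|y|` and `(|y| - x)₊`, so its mean involves only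
`𝔼|Y| = 1` and the stop-loss transform. The absence of atoms discards `y = 0`, where the pointwise
identity is not available. -/
theorem lintegral_enorm_rpow_eq_stopLossMoment {μ : Measure ℝ} [IsProbabilityMeasure μ]
    [NullSingletonClass μ] (hi : Integrable (fun y => y) μ) (ha : ∫ y, |y| ∂μ = 1) {p : ℝ}
    (hp0 : p ≠ 0) (hp1 : p ≠ 1) :
    ∫⁻ y, ‖y‖ₑ ^ p ∂μ = stopLossMoment p (stopLoss μ) := by
  have h1 : ∫⁻ y, ‖y‖ₑ ^ p ∂μ = ∫⁻ y, (ENNReal.ofReal |p * (p - 1)| * ∫⁻ x in Ioi 0,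
      ENNReal.ofReal (x ^ (p - 2) * stopLossKernel p x |y| (max (|y| - x) 0))) ∂μ := by
    refine lintegral_congr_ae ?_
    have hne : ∀ᵐ y ∂μ, y ≠ 0 := by rw [ae_iff]; simp
    filter_upwards [hne] with y hy
    rw [← ofReal_rpow_eq_lintegral_stopLossKernel hp0 hp1 (abs_pos.2 hy), Real.enorm_eq_ofReal_abs]
  have hmeas : Measurable fun q : ℝ × ℝ =>
      ENNReal.ofReal (q.2 ^ (p - 2) * stopLossKernel p q.2 |q.1| (max (|q.1| - q.2) 0)) := by
    unfold stopLossKernel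
    split_ifs <;> fun_prop
  rw [h1, lintegral_const_mul' _ _ ENNReal.ofReal_ne_top, stopLossMoment, stopLossIntegral,
    lintegral_lintegral_swap hmeas.aemeasurable]
  congr 1
  refine setLIntegral_congr_fun measurableSet_Ioi fun x hx => ?_
  have hx0 : (0 : ℝ) < x := hx
  have im : Integrable (fun y => max (|y| - x) 0) μ := (hi.abs.sub (integrable_const x)).pos_part
  have ik : Integrable (fun y => stopLossKernel p x |y| (max (|y| - x) 0)) μ := by
    unfold stopLossKernel
    split_ifs
    · exact im
    · exact hi.abs.sub im
    · exact ((integrable_const x).sub hi.abs).add im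
  have hk : ∫ y, stopLossKernel p x |y| (max (|y| - x) 0) ∂μ =
      stopLossKernel p x 1 (stopLoss μ x) := by
    unfold stopLossKernel stopLoss
    split_ifs
    · rfl
    · rw [integral_sub hi.abs im, ha]
    · have : Integrable (fun y => x - |y|) μ := (integrable_const x).sub hi.abs
      rw [integral_add this im, integral_sub (integrable_const x) hi.abs, ha]; simp
  rw [← ofReal_integral_eq_lintegral_ofReal (ik.const_mul _)
    (.of_forall fun y => mul_nonneg (by positivity)
      (stopLossKernel_nonneg hx0.le (abs_nonneg y))), integral_const_mul, hk]

theorem stopLossKernel_le {p x m r r' : ℝ} (hp : p ≤ 0 ∨ 1 < p) (h : r ≤ r') :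
    stopLossKernel p x m r ≤ stopLossKernel p x m r' := by
  rw [stopLossKernel, stopLossKernel]
  split_ifs with h1 h2
  · exact h
  · rcases hp with hp | hp <;> linarith
  · linarith

theorem stopLossKernel_le' {p x m r r' : ℝ} (hp : 0 < p) (hp1 : p ≤ 1) (h : r ≤ r') :
    stopLossKernel p x m r' ≤ stopLossKernel p x m r := by
  rw [stopLossKernel, stopLossKernel, if_neg (by linarith), if_pos hp, if_neg (by linarith),
    if_pos hp]
  linarith

theorem stopLossMoment_mono {p : ℝ} (hp : p ≤ 0 ∨ 1 < p) {π π' : ℝ → ℝ}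
    (h : ∀ x, 0 < x → π x ≤ π' x) : stopLossMoment p π ≤ stopLossMoment p π' := by
  rw [stopLossMoment, stopLossMoment, stopLossIntegral, stopLossIntegral]
  refine mul_le_mul' le_rfl (setLIntegral_mono' measurableSet_Ioi fun x hx =>
    ENNReal.ofReal_le_ofReal ?_)
  exact mul_le_mul_of_nonneg_left (stopLossKernel_le hp (h x hx))
    (Real.rpow_nonneg (le_of_lt hx) _)

theorem stopLossMoment_anti {p : ℝ} (hp : 0 < p) (hp1 : p ≤ 1) {π π' : ℝ → ℝ}
    (h : ∀ x, 0 < x → π x ≤ π' x) : stopLossMoment p π' ≤ stopLossMoment p π := by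
  rw [stopLossMoment, stopLossMoment, stopLossIntegral, stopLossIntegral]
  refine mul_le_mul' le_rfl (setLIntegral_mono' measurableSet_Ioi fun x hx =>
    ENNReal.ofReal_le_ofReal ?_)
  exact mul_le_mul_of_nonneg_left (stopLossKernel_le' hp hp1 (h x hx))
    (Real.rpow_nonneg (le_of_lt hx) _)

/-! ### Comparison of stop-loss transforms that cross once -/

/-- Elementary bounds satisfied by the stop-loss transform of a law with `𝔼 |Y| = 1`. -/
structure IsStopLoss (π : ℝ → ℝ) : Prop where
  measurable : Measurable π
  nonneg : ∀ x, 0 < x → 0 ≤ π x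
  le_one : ∀ x, 0 < x → π x ≤ 1
  one_sub_le : ∀ x, 0 < x → 1 - x ≤ π x

/-- Each bound in `IsStopLoss` covers one range of `p`. Nonnegativity is what makes `ENNReal.ofReal`
additive on the integrands. -/
theorem IsStopLoss.kernel_nonneg {π : ℝ → ℝ} (h : IsStopLoss π) (p : ℝ) {x : ℝ} (hx : 0 < x) :
    0 ≤ stopLossKernel p x 1 (π x) := by
  have h1 := h.nonneg x hx
  have h2 := h.le_one x hx
  have h3 := h.one_sub_le x hx
  rw [stopLossKernel]
  split_ifs <;> linarith

theorem IsStopLoss.measurable_integrand {π : ℝ → ℝ} (h : IsStopLoss π) (p : ℝ) :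
    Measurable fun x => ENNReal.ofReal (x ^ (p - 2) * stopLossKernel p x 1 (π x)) := by
  have := h.measurable
  unfold stopLossKernel
  split_ifs <;> fun_prop

/-- `π` lies below `π'` before `c` and above it after `c`. -/
def CrossesAt (c : ℝ) (π π' : ℝ → ℝ) : Prop :=
  (∀ x, 0 < x → x < c → π x ≤ π' x) ∧ ∀ x, c < x → π' x ≤ π x

/-- The factor `x^(p-q)` is decreasing and equals `c^(p-q)` exactly where `π - π'` changes sign. -/
theorem CrossesAt.mul_le {c : ℝ} {π π' : ℝ → ℝ} (h : CrossesAt c π π') (hc : 0 < c) {p q x : ℝ}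
    (hpq : p < q) (hx : 0 < x) :
    x ^ (p - 2) * (π x - π' x) ≤ c ^ (p - q) * x ^ (q - 2) * (π x - π' x) := by
  have e : x ^ (p - 2) = x ^ (p - q) * x ^ (q - 2) := by
    rw [← Real.rpow_add hx]; congr 1; ring
  have hxq := Real.rpow_nonneg hx.le (q - 2)
  rw [e]
  rcases lt_trichotomy x c with hxc | rfl | hxc
  · have h1 := Real.rpow_le_rpow_of_nonpos hx hxc.le (by linarith : p - q ≤ 0)
    have h2 := h.1 x hx hxc
    exact mul_le_mul_of_nonpos_right (mul_le_mul_of_nonneg_right h1 hxq) (by linarith)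
  · exact le_rfl
  · have h1 := Real.rpow_le_rpow_of_nonpos hc hxc.le (by linarith : p - q ≤ 0)
    have h2 := h.2 x hxc
    exact mul_le_mul_of_nonneg_right (mul_le_mul_of_nonneg_right h1 hxq) (by linarith)

theorem stopLossIntegral_add_mul {π π' : ℝ → ℝ} (h : IsStopLoss π) (h' : IsStopLoss π')
    (p q : ℝ) {k : ℝ} (hk : 0 ≤ k) :
    stopLossIntegral p π + ENNReal.ofReal k * stopLossIntegral q π' =
      ∫⁻ x in Ioi 0, ENNReal.ofReal (x ^ (p - 2) * stopLossKernel p x 1 (π x) +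
        k * x ^ (q - 2) * stopLossKernel q x 1 (π' x)) := by
  rw [stopLossIntegral, stopLossIntegral, ← lintegral_const_mul' _ _ ENNReal.ofReal_ne_top,
    ← lintegral_add_left (h.measurable_integrand p)]
  refine setLIntegral_congr_fun measurableSet_Ioi fun x hx => ?_
  have hx0 : (0 : ℝ) < x := hx
  have h1 := h.kernel_nonneg p hx0
  have h2 := h'.kernel_nonneg q hx0
  rw [← ENNReal.ofReal_mul hk, ← ENNReal.ofReal_add (by positivity) (by positivity), mul_assoc]

/-- This is `mul_le` integrated. Terms are moved across so that no subtraction of possibly infinite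
integrals occurs; the affine parts of the kernel are the same on both sides and cancel. -/
theorem CrossesAt.stopLossIntegral_add_le {c : ℝ} {π π' : ℝ → ℝ} (hx : CrossesAt c π π')
    (hc : 0 < c) (h : IsStopLoss π) (h' : IsStopLoss π') {p q : ℝ} (hpq : p < q) (hq : 1 < q)
    (hp : p ≤ 0 ∨ 1 < p) :
    stopLossIntegral p π + ENNReal.ofReal (c ^ (p - q)) * stopLossIntegral q π' ≤
      stopLossIntegral p π' + ENNReal.ofReal (c ^ (p - q)) * stopLossIntegral q π := by
  have hk : 0 ≤ c ^ (p - q) := Real.rpow_nonneg hc.le _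
  rw [stopLossIntegral_add_mul h h' p q hk, stopLossIntegral_add_mul h' h p q hk]
  refine setLIntegral_mono' measurableSet_Ioi fun x hx0 => ENNReal.ofReal_le_ofReal ?_
  have key := hx.mul_le hc hpq hx0
  simp only [stopLossKernel, if_pos hq]
  split_ifs with h1 h2
  · linarith
  · rcases hp with hp | hp <;> linarith
  · linarith

theorem CrossesAt.stopLossIntegral_add_le' {c : ℝ} {π π' : ℝ → ℝ} (hx : CrossesAt c π π')
    (hc : 0 < c) (h : IsStopLoss π) (h' : IsStopLoss π') {p q : ℝ} (hq : 1 < q)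
    (hp : 0 < p) (hp1 : p ≤ 1) :
    stopLossIntegral p π' + ENNReal.ofReal (c ^ (p - q)) * stopLossIntegral q π' ≤
      stopLossIntegral p π + ENNReal.ofReal (c ^ (p - q)) * stopLossIntegral q π := by
  have hk : 0 ≤ c ^ (p - q) := Real.rpow_nonneg hc.le _
  rw [stopLossIntegral_add_mul h' h' p q hk, stopLossIntegral_add_mul h h p q hk]
  refine setLIntegral_mono' measurableSet_Ioi fun x hx0 => ENNReal.ofReal_le_ofReal ?_
  have key := hx.mul_le hc (p := p) (q := q) (by linarith) hx0
  simp only [stopLossKernel, if_pos hq, if_neg (not_lt.2 hp1), if_pos hp]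
  linarith

theorem CrossesAt.stopLossIntegral_add_lt {c : ℝ} {π π' : ℝ → ℝ} (hx : CrossesAt c π π')
    (hc : 0 < c) (h : IsStopLoss π) (h' : IsStopLoss π') {p q : ℝ} (hpq : p < q) (hp : 1 < p)
    (hlt : ∀ x, c < x → π' x < π x) (hfp : stopLossIntegral p π' ≠ ⊤)
    (hfq : stopLossIntegral q π ≠ ⊤) :
    stopLossIntegral p π + ENNReal.ofReal (c ^ (p - q)) * stopLossIntegral q π' <
      stopLossIntegral p π' + ENNReal.ofReal (c ^ (p - q)) * stopLossIntegral q π := by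
  have hq : 1 < q := hp.trans hpq
  have hle := hx.stopLossIntegral_add_le hc h h' hpq hq (.inr hp)
  have hfin := ne_top_of_le_ne_top
    (ENNReal.add_ne_top.2 ⟨hfp, ENNReal.mul_ne_top ENNReal.ofReal_ne_top hfq⟩) hle
  have hk : 0 ≤ c ^ (p - q) := Real.rpow_nonneg hc.le _
  rw [stopLossIntegral_add_mul h h' p q hk] at hfin ⊢
  rw [stopLossIntegral_add_mul h' h p q hk]
  have m := h.measurable
  have m' := h'.measurable
  refine lintegral_strict_mono_of_ae_le_of_ae_lt_on (s := Ioi c) ?_ hfin ?_ ?_ ?_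
  · simp only [stopLossKernel, if_pos hq, if_pos hp]
    fun_prop
  · refine (ae_restrict_iff' measurableSet_Ioi).2 (.of_forall fun x hx0 => ?_)
    refine ENNReal.ofReal_le_ofReal ?_
    have key := hx.mul_le hc hpq hx0
    simp only [stopLossKernel, if_pos hq, if_pos hp]
    linarith
  · rw [Measure.restrict_apply measurableSet_Ioi, Ioi_inter_Ioi, max_eq_left hc.le]
    simp
  · refine .of_forall fun x hxc => ?_
    have hx0 : 0 < x := hc.trans hxc
    have n1 := h.nonneg x hx0
    have n2 := h'.nonneg x hx0
    have hlt' := hlt x hxc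
    have n3 : 0 < π x := n2.trans_lt hlt'
    have hcp : 0 < c ^ (p - q) := Real.rpow_pos_of_pos hc _
    have hxq := Real.rpow_pos_of_pos hx0 (q - 2)
    simp only [stopLossKernel, if_pos hq, if_pos hp]
    rw [ENNReal.ofReal_lt_ofReal_iff (by positivity)]
    have e : x ^ (p - 2) = x ^ (p - q) * x ^ (q - 2) := by
      rw [← Real.rpow_add hx0]; congr 1; ring
    have h1 := Real.rpow_lt_rpow_of_neg hc hxc (by linarith : p - q < 0)
    have h2 := mul_lt_mul_of_pos_right (mul_lt_mul_of_pos_right h1 hxq) (sub_pos.2 hlt')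
    rw [e]
    linarith

theorem stopLossMoment_le_iff {p : ℝ} (hp0 : p ≠ 0) (hp1 : p ≠ 1) {π π' : ℝ → ℝ} :
    stopLossMoment p π ≤ stopLossMoment p π' ↔ stopLossIntegral p π ≤ stopLossIntegral p π' := by
  have h : ENNReal.ofReal |p * (p - 1)| ≠ 0 :=
    (ENNReal.ofReal_pos.2 (abs_pos.2 (mul_ne_zero hp0 (sub_ne_zero.2 hp1)))).ne'
  exact ENNReal.mul_le_mul_iff_right h ENNReal.ofReal_ne_top

theorem stopLossMoment_ne_top_iff {p : ℝ} (hp0 : p ≠ 0) (hp1 : p ≠ 1) {π : ℝ → ℝ} :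
    stopLossMoment p π ≠ ⊤ ↔ stopLossIntegral p π ≠ ⊤ := by
  have h : ENNReal.ofReal |p * (p - 1)| ≠ 0 :=
    (ENNReal.ofReal_pos.2 (abs_pos.2 (mul_ne_zero hp0 (sub_ne_zero.2 hp1)))).ne'
  rw [stopLossMoment, Ne, Ne, ENNReal.mul_eq_top]
  simp only [h, ENNReal.ofReal_ne_top, ne_eq, not_false_eq_true, true_and, false_and, or_false]

theorem CrossesAt.stopLossMoment_le {c : ℝ} {π π' : ℝ → ℝ} (hx : CrossesAt c π π')
    (hc : 0 < c) (h : IsStopLoss π) (h' : IsStopLoss π') {p q : ℝ} (hpq : p < q) (hq : 1 < q)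
    (hp : p < 0 ∨ 1 < p) (hfin : stopLossMoment q π' ≠ ⊤)
    (hle : stopLossMoment q π ≤ stopLossMoment q π') :
    stopLossMoment p π ≤ stopLossMoment p π' := by
  have hp0 : p ≠ 0 := by rcases hp with h | h <;> linarith
  have hp1 : p ≠ 1 := by rcases hp with h | h <;> linarith
  rw [stopLossMoment_ne_top_iff (by linarith) (by linarith)] at hfin
  rw [stopLossMoment_le_iff (by linarith) (by linarith)] at hle
  rw [stopLossMoment_le_iff hp0 hp1]
  have key := hx.stopLossIntegral_add_le hc h h' hpq hq (hp.imp_left le_of_lt)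
  exact (ENNReal.add_le_add_iff_right (ENNReal.mul_ne_top ENNReal.ofReal_ne_top hfin)).1
    (key.trans (by gcongr))

/-- The comparison is reversed here because the kernel decreases in `π` when `0 < p < 1`. -/
theorem CrossesAt.le_stopLossMoment {c : ℝ} {π π' : ℝ → ℝ} (hx : CrossesAt c π π')
    (hc : 0 < c) (h : IsStopLoss π) (h' : IsStopLoss π') {p q : ℝ} (hq : 1 < q)
    (hp : 0 < p) (hp1 : p < 1) (hfin : stopLossMoment q π' ≠ ⊤)
    (hle : stopLossMoment q π ≤ stopLossMoment q π') :
    stopLossMoment p π' ≤ stopLossMoment p π := by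
  rw [stopLossMoment_ne_top_iff (by linarith) (by linarith)] at hfin
  rw [stopLossMoment_le_iff (by linarith) (by linarith)] at hle
  rw [stopLossMoment_le_iff hp.ne' hp1.ne]
  have key := hx.stopLossIntegral_add_le' hc h h' hq hp hp1.le
  exact (ENNReal.add_le_add_iff_right (ENNReal.mul_ne_top ENNReal.ofReal_ne_top hfin)).1
    (key.trans (by gcongr))

/-- Strictness comes from strict inequality of the transforms after the crossing; it yields
uniqueness of the transition point. -/
theorem CrossesAt.stopLossMoment_lt {c : ℝ} {π π' : ℝ → ℝ} (hx : CrossesAt c π π')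
    (hc : 0 < c) (h : IsStopLoss π) (h' : IsStopLoss π') {p q : ℝ} (hpq : p < q) (hp : 1 < p)
    (hlt : ∀ x, c < x → π' x < π x) (hfp : stopLossMoment p π' ≠ ⊤)
    (hfq : stopLossMoment q π' ≠ ⊤) (hle : stopLossMoment q π ≤ stopLossMoment q π') :
    stopLossMoment p π < stopLossMoment p π' := by
  have hle' := ne_top_of_le_ne_top hfq hle
  rw [stopLossMoment_ne_top_iff (by linarith) (by linarith)] at hfp hfq hle'
  rw [stopLossMoment_le_iff (by linarith) (by linarith)] at hle
  rw [← not_le, stopLossMoment_le_iff (by linarith) (by linarith), not_le]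
  have key := hx.stopLossIntegral_add_lt hc h h' hpq hp hlt hfp hle'
  refine (ENNReal.add_lt_add_iff_right
    (ENNReal.mul_ne_top ENNReal.ofReal_ne_top hfq (a := ENNReal.ofReal (c ^ (p - q))))).1
    (key.trans_le (by gcongr))

section

/-! ### The extremal transforms cross the exponential one exactly once -/

theorem two_lt_exp_mul_two_sub {t : ℝ} (h0 : 0 < t) (h1 : t ≤ 1) : 2 < Real.exp t * (2 - t) := by
  have h := Real.quadratic_le_exp_of_nonneg h0.le
  have h2 : (1 + t + t ^ 2 / 2) * (2 - t) ≤ Real.exp t * (2 - t) :=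
    mul_le_mul_of_nonneg_right h (by linarith)
  have : 0 < t * (2 - t ^ 2) := mul_pos h0 (by nlinarith)
  nlinarith

theorem extremalRate_lt_one {t : ℝ} (h0 : 0 < t) (h1 : t ≤ 1) : extremalRate t < 1 := by
  rw [extremalRate, div_lt_one (by linarith), Real.exp_neg, ← div_eq_mul_inv,
    div_lt_iff₀ (Real.exp_pos t), mul_comm]
  exact two_lt_exp_mul_two_sub h0 h1

@[simp] theorem extremalRate_zero : extremalRate 0 = 1 := by simp [extremalRate]

theorem one_sub_le_extremalRate {t : ℝ} (h0 : 0 ≤ t) (h1 : t ≤ 1) : 1 - t ≤ extremalRate t := by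
  rw [extremalRate, le_div_iff₀ (by linarith)]
  have h := Real.add_one_le_exp (-t)
  nlinarith

theorem isStopLoss_exp : IsStopLoss fun x => Real.exp (-x) where
  measurable := by fun_prop
  nonneg x _ := (Real.exp_pos _).le
  le_one x hx := Real.exp_le_one_iff.2 (by linarith)
  one_sub_le x _ := by linarith [Real.add_one_le_exp (-x)]

theorem extremalStopLoss_zero {x : ℝ} (hx : 0 < x) : extremalStopLoss 0 x = Real.exp (-x) := by
  rw [extremalStopLoss, extremalRate_zero, if_neg (by linarith)]
  simp

theorem cosh_le_one_add {v : ℝ} (h0 : 0 ≤ v) (h1 : v ≤ 1) : Real.cosh v ≤ 1 + v := by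
  have h := Real.cosh_le_exp_half_sq v
  have h2 := Real.exp_bound_div_one_sub_of_interval (x := v ^ 2 / 2) (by positivity) (by nlinarith)
  have h3 : 1 / (1 - v ^ 2 / 2) ≤ 1 + v := by
    rw [div_le_iff₀ (by nlinarith)]
    nlinarith [mul_nonneg h0 (sub_nonneg.2 h1), mul_nonneg (mul_nonneg h0 h0) (sub_nonneg.2 h1)]
  linarith

theorem isStopLoss_extremal {t : ℝ} (h0 : 0 ≤ t) (h1 : t ≤ 1) :
    IsStopLoss (extremalStopLoss t) := by
  have hβ := extremalRate_pos h1
  have hβ1 : extremalRate t ≤ 1 := by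
    rcases h0.eq_or_lt with rfl | h
    · simp
    · exact (extremalRate_lt_one h h1).le
  have hβe : extremalRate t * (Real.exp t * (2 - t)) = 2 := by
    rw [extremalRate, Real.exp_neg]
    have : 2 - t ≠ 0 := by linarith
    field_simp
  have het := Real.add_one_le_exp t
  refine ⟨?_, fun x hx => ?_, fun x hx => ?_, fun x hx => ?_⟩
  · unfold extremalStopLoss
    refine Measurable.ite ?_ (by fun_prop) (by fun_prop)
    exact measurableSet_le (by fun_prop) (by fun_prop)
  · rw [extremalStopLoss]
    split_ifs with hc
    · rw [sub_nonneg]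
      have hx2 : x = extremalRate t * x * (Real.exp t * (2 - t)) / 2 := by
        linear_combination (-x / 2) * hβe
      rw [Real.cosh_eq]
      set v := extremalRate t * x with hv
      have hv0 : 0 ≤ v := by positivity
      -- Tangents of `e^{-v}` at `0` and of `e^v` at `t`. They leave the nonnegative remainder `(1 -
      -- v)(1 + e^t (1 - t))/2`.
      have k1 := Real.add_one_le_exp (-v)
      have k2 := Real.add_one_le_exp (v - t)
      have k3 : Real.exp v = Real.exp t * Real.exp (v - t) := by rw [← Real.exp_add]; congr 1; ring
      have k4 : Real.exp t * (v - t + 1) ≤ Real.exp v := by rw [k3]; gcongr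
      rw [hx2]
      have k5 : 0 ≤ Real.exp t * (1 - t) := mul_nonneg (Real.exp_pos t).le (by linarith)
      have k6 : 0 ≤ (1 - v) * (1 + Real.exp t * (1 - t)) :=
        mul_nonneg (by linarith) (by linarith)
      nlinarith
    · have : 0 ≤ (1 - t) ^ 2 * Real.exp t := by positivity
      positivity
  · rw [extremalStopLoss]
    split_ifs with hc
    · have := cosh_le_one_add (v := extremalRate t * x) (by positivity) (by linarith)
      nlinarith
    · push Not at hc
      have k1 : Real.exp (-(extremalRate t * x)) ≤ 1 := Real.exp_le_one_iff.2 (by linarith)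
      have k2 : Real.exp (-((extremalRate t * x - t) / (1 - t))) ≤ 1 := by
        refine Real.exp_le_one_iff.2 (neg_nonpos.2 (div_nonneg ?_ ?_)) <;> linarith
      have k3 : (1 - t) ^ 2 * Real.exp t ≤ 1 := by
        have := Real.add_one_le_exp (-t)
        calc (1 - t) ^ 2 * Real.exp t ≤ (1 - t) * 1 * Real.exp t := by
              rw [sq]; gcongr; linarith
          _ ≤ Real.exp (-t) * 1 * Real.exp t := by gcongr; linarith
          _ = 1 := by rw [mul_one, ← Real.exp_add]; simp
      have k4 := mul_le_mul k3 k2 (Real.exp_pos _).le zero_le_one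
      linarith
  · rw [extremalStopLoss]
    split_ifs with hc
    · linarith [Real.one_le_cosh (extremalRate t * x)]
    · push Not at hc
      have hx2 : x = extremalRate t * x * (Real.exp t * (2 - t)) / 2 := by
        linear_combination (-x / 2) * hβe
      set v := extremalRate t * x with hv
      have k1 := Real.add_one_le_exp (-v)
      have k2 := Real.add_one_le_exp (-((v - t) / (1 - t)))
      have k3 : (1 - t) ^ 2 * Real.exp t * (1 - (v - t) / (1 - t)) =
          Real.exp t * ((1 - t) ^ 2 - (1 - t) * (v - t)) := by
        rcases eq_or_ne (1 - t) 0 with h | h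
        · rw [h]; simp
        · field_simp
      have k4 : (1 - t) ^ 2 * Real.exp t * (1 - (v - t) / (1 - t)) ≤
          (1 - t) ^ 2 * Real.exp t * Real.exp (-((v - t) / (1 - t))) := by
        gcongr; linarith
      have k5 : (1 + t) * (1 - t + v) ≤ Real.exp t * (1 - t + v) := by
        gcongr; linarith
      have k6 : 0 ≤ t * (v - t) := mul_nonneg h0 (by linarith)
      rw [hx2]
      nlinarith

section crossing

variable {b : ℝ}

theorem hasDerivAt_coshPart (x : ℝ) :
    HasDerivAt (fun x => Real.cosh (b * x) - x - Real.exp (-x))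
      (b * Real.sinh (b * x) - 1 + Real.exp (-x)) x := by
  have h1 : HasDerivAt (fun x => Real.cosh (b * x)) (Real.sinh (b * x) * (b * 1)) x :=
    ((hasDerivAt_id x).const_mul b).cosh
  have h2 : HasDerivAt (fun x => Real.exp (-x)) (Real.exp (-x) * -1) x := (hasDerivAt_neg x).exp
  exact ((h1.sub (hasDerivAt_id x)).sub h2).congr_deriv (by ring)

theorem hasDerivAt_coshPart_deriv (x : ℝ) :
    HasDerivAt (fun x => b * Real.sinh (b * x) - 1 + Real.exp (-x))
      (b ^ 2 * Real.cosh (b * x) - Real.exp (-x)) x := by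
  have h1 : HasDerivAt (fun x => Real.sinh (b * x)) (Real.cosh (b * x) * (b * 1)) x :=
    ((hasDerivAt_id x).const_mul b).sinh
  have h2 : HasDerivAt (fun x => Real.exp (-x)) (Real.exp (-x) * -1) x := (hasDerivAt_neg x).exp
  exact (((h1.const_mul b).sub_const 1).add h2).congr_deriv (by ring)

/-- If `f a < f c` then the derivative is positive somewhere in between. -/
theorem exists_deriv_pos {f f' : ℝ → ℝ} (hf : ∀ x, HasDerivAt f (f' x) x) {a c : ℝ} (hac : a < c)
    (h : f a < f c) : ∃ x ∈ Ioo a c, 0 < f' x := by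
  obtain ⟨x, hx, hfx⟩ := exists_hasDerivAt_eq_slope f f' hac
    (fun y _ => (hf y).continuousAt.continuousWithinAt) fun y _ => hf y
  exact ⟨x, hx, by rw [hfx]; exact div_pos (by linarith) (by linarith)⟩

theorem lt_of_deriv_pos {f f' : ℝ → ℝ} (hf : ∀ x, HasDerivAt f (f' x) x) {a c : ℝ} (hac : a < c)
    (h : ∀ x, a < x → 0 < f' x) : f a < f c := by
  obtain ⟨x, hx, hfx⟩ := exists_hasDerivAt_eq_slope f f' hac
    (fun y _ => (hf y).continuousAt.continuousWithinAt) fun y _ => hf y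
  have := h x hx.1
  rw [hfx, div_pos_iff_of_pos_right (by linarith)] at this
  linarith

/-- The function and its first derivative vanish at `0`, and the second derivative `b² cosh(bx) -
e^{-x}` is increasing on `x > 0`. A positive value forces, by two mean value arguments, a positive
second derivative earlier; from then on everything stays positive. -/
theorem coshPart_pos (hb : 0 < b) {x : ℝ} (hx : 0 < x)
    (h : 0 < Real.cosh (b * x) - x - Real.exp (-x)) :
    0 < b * Real.sinh (b * x) - 1 + Real.exp (-x) ∧
      ∀ y, x < y → 0 < Real.cosh (b * y) - y - Real.exp (-y) := by
  obtain ⟨ξ, hξ, hξ'⟩ := exists_deriv_pos (hasDerivAt_coshPart (b := b)) hx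
    (by simpa using h)
  obtain ⟨ζ, hζ, hζ'⟩ := exists_deriv_pos (hasDerivAt_coshPart_deriv (b := b)) hξ.1
    (by simpa using hξ')
  have h2 : ∀ y, ζ < y → 0 < b ^ 2 * Real.cosh (b * y) - Real.exp (-y) := by
    intro y hy
    have k1 : Real.cosh (b * ζ) ≤ Real.cosh (b * y) := by
      rw [Real.cosh_le_cosh, abs_of_pos (mul_pos hb hζ.1), abs_of_pos (mul_pos hb (hζ.1.trans hy))]
      gcongr
    have k2 : Real.exp (-y) ≤ Real.exp (-ζ) := Real.exp_le_exp.2 (by linarith)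
    have k3 := mul_le_mul_of_nonneg_left k1 (sq_nonneg b)
    linarith
  have h1 : ∀ y, ξ < y → 0 < b * Real.sinh (b * y) - 1 + Real.exp (-y) := by
    intro y hy
    exact hξ'.trans (lt_of_deriv_pos (hasDerivAt_coshPart_deriv (b := b)) hy
      fun z hz => h2 z (hζ.2.trans hz))
  refine ⟨h1 x hξ.2, fun y hy => h.trans ?_⟩
  exact lt_of_deriv_pos (hasDerivAt_coshPart (b := b)) hy fun z hz => h1 z (hξ.2.trans hz)

/-- The second derivative at `0` is `b² - 1 < 0`, so the function cannot be positive immediately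
after `0`. -/
theorem exists_coshPart_nonpos (hb : 0 < b) (hb1 : b < 1) {τ : ℝ} (hτ : 0 < τ) :
    ∃ x, 0 < x ∧ x ≤ τ ∧ Real.cosh (b * x) - x - Real.exp (-x) ≤ 0 := by
  have hc : ContinuousAt (fun x => b ^ 2 * Real.cosh (b * x) - Real.exp (-x)) 0 := by fun_prop
  have h0 : b ^ 2 * Real.cosh (b * 0) - Real.exp (-0) < 0 := by
    simp only [mul_zero, Real.cosh_zero, mul_one, neg_zero, Real.exp_zero]; nlinarith
  obtain ⟨δ, hδ, hball⟩ := Metric.eventually_nhds_iff.1 (hc.eventually (gt_mem_nhds h0))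
  refine ⟨min (δ / 2) τ, lt_min (by linarith) hτ, min_le_right _ _, ?_⟩
  by_contra! hpos
  have hx : 0 < min (δ / 2) τ := lt_min (by linarith) hτ
  obtain ⟨ξ, hξ, hξ'⟩ := exists_deriv_pos (hasDerivAt_coshPart (b := b)) hx (by simpa using hpos)
  obtain ⟨ζ, hζ, hζ'⟩ := exists_deriv_pos (hasDerivAt_coshPart_deriv (b := b)) hξ.1
    (by simpa using hξ')
  have hζd : ζ < δ := (hζ.2.trans hξ.2).trans_le ((min_le_left _ _).trans (by linarith))
  have := hball (y := ζ) (by rw [Real.dist_eq, sub_zero, abs_of_pos hζ.1]; exact hζd)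
  linarith

theorem hasDerivAt_expPart (A B C x : ℝ) :
    HasDerivAt (fun x => 1 + C * Real.exp (-(A * x)) - 2 * Real.exp (-(B * x)))
      (2 * B * Real.exp (-(B * x)) - C * A * Real.exp (-(A * x))) x := by
  have h : ∀ A : ℝ, HasDerivAt (fun x => Real.exp (-(A * x))) (Real.exp (-(A * x)) * -(A * 1)) x :=
    fun A => ((hasDerivAt_id x).const_mul A).neg.exp
  exact ((((h A).const_mul C).const_add 1).sub ((h B).const_mul 2)).congr_deriv (by ring)

/-- Factoring out `e^{-Bx}` leaves `2B - CA e^{-(A-B)x}`, which is nondecreasing when `B ≤ A`. -/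
theorem expPart_deriv_pos {A B C x y : ℝ} (hAB : C = 0 ∨ B ≤ A) (hB : 0 < B) (hC : 0 ≤ C)
    (hxy : x ≤ y) (h : 0 < 2 * B * Real.exp (-(B * x)) - C * A * Real.exp (-(A * x))) :
    0 < 2 * B * Real.exp (-(B * y)) - C * A * Real.exp (-(A * y)) := by
  rcases hAB with rfl | hAB
  · simp; positivity
  have e : ∀ z, 2 * B * Real.exp (-(B * z)) - C * A * Real.exp (-(A * z)) =
      Real.exp (-(B * z)) * (2 * B - C * A * Real.exp (-((A - B) * z))) := by
    intro z
    have : Real.exp (-(A * z)) = Real.exp (-(B * z)) * Real.exp (-((A - B) * z)) := by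
      rw [← Real.exp_add]; congr 1; ring
    rw [this]; ring
  rw [e] at h ⊢
  have h1 := (mul_pos_iff_of_pos_left (Real.exp_pos _)).1 h
  refine mul_pos (Real.exp_pos _) (h1.trans_le ?_)
  have hA : 0 ≤ C * A := mul_nonneg hC (hB.le.trans hAB)
  have : Real.exp (-((A - B) * y)) ≤ Real.exp (-((A - B) * x)) := by
    rw [Real.exp_le_exp, neg_le_neg_iff]
    exact mul_le_mul_of_nonneg_left hxy (by linarith)
  nlinarith

end crossing

theorem extremalStopLoss_of_le {t x : ℝ} (h : extremalRate t * x ≤ t) :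
    extremalStopLoss t x - Real.exp (-x) =
      Real.cosh (extremalRate t * x) - x - Real.exp (-x) := by
  rw [extremalStopLoss, if_pos h]

/-- The coefficient of the second exponential in the upper range. -/
def expPartCoeff (t : ℝ) : ℝ := (1 - t) ^ 2 * Real.exp t * Real.exp (t / (1 - t))

/-- Multiplication by `2e^{βx}`, `β` being the rate, leaves one constant and two exponentials, so
that the derivative has only two terms. -/
theorem extremalStopLoss_of_lt {t x : ℝ} (h : t < extremalRate t * x) :
    2 * Real.exp (extremalRate t * x) * (extremalStopLoss t x - Real.exp (-x)) =
      1 + expPartCoeff t * Real.exp (-((extremalRate t / (1 - t) - extremalRate t) * x)) -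
        2 * Real.exp (-((1 - extremalRate t) * x)) := by
  rw [extremalStopLoss, if_neg (not_le.2 h), expPartCoeff]
  have e1 : Real.exp (-((1 - extremalRate t) * x)) =
      Real.exp (extremalRate t * x) * Real.exp (-x) := by rw [← Real.exp_add]; congr 1; ring
  have e2 : Real.exp (t / (1 - t)) *
      Real.exp (-((extremalRate t / (1 - t) - extremalRate t) * x)) =
      Real.exp (extremalRate t * x) * Real.exp (-((extremalRate t * x - t) / (1 - t))) := by
    rw [← Real.exp_add, ← Real.exp_add]; congr 1; ring
  have e3 : Real.exp (extremalRate t * x) * Real.exp (-(extremalRate t * x)) = 1 := by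
    rw [← Real.exp_add]; simp
  linear_combination e3 - (1 - t) ^ 2 * Real.exp t * e2 + 2 * e1

/-- On each branch a positive difference persists; the point is to pass the break point `t/β`. The
function `χ` continues `2e^{βx}` times the first branch with equal value and slope, so positivity
and growth are handed over. -/
theorem extremalStopLoss_sub_exp_pos {t x y : ℝ} (h0 : 0 < t) (h1 : t ≤ 1) (hx : 0 < x)
    (hxy : x < y) (h : 0 < extremalStopLoss t x - Real.exp (-x)) :
    0 < extremalStopLoss t y - Real.exp (-y) := by
  have hβ := extremalRate_pos h1
  have hβ1 := extremalRate_lt_one h0 h1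
  have hsβ := one_sub_le_extremalRate h0.le h1
  have hβe : extremalRate t * (Real.exp t * (2 - t)) = 2 := by
    rw [extremalRate, Real.exp_neg]
    have : 2 - t ≠ 0 := by linarith
    field_simp
  have hlo := fun z => extremalStopLoss_of_le (t := t) (x := z)
  have hhi := fun z => extremalStopLoss_of_lt (t := t) (x := z)
  -- At `t = 1` division by zero gives the exponent a meaningless value, but its coefficient
  -- vanishes.
  have hdeq : expPartCoeff t = 0 ∨ 1 - extremalRate t ≤
      extremalRate t / (1 - t) - extremalRate t := by
    rcases h1.eq_or_lt with h | h
    · left; rw [expPartCoeff, h]; norm_num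
    · right
      have : 1 ≤ extremalRate t / (1 - t) := (one_le_div (by linarith)).2 hsβ
      linarith
  have hC0 : 0 ≤ expPartCoeff t := by unfold expPartCoeff; positivity
  set β := extremalRate t with hβdef
  have hτt : β * (t / β) = t := by field_simp
  have hτ : 0 < t / β := div_pos h0 hβ
  -- matching at the break point
  have e0 : Real.exp (-((1 - β) * (t / β))) = Real.exp t * Real.exp (-(t / β)) := by
    rw [← Real.exp_add]; congr 1; rw [sub_mul, hτt]; ring
  have e1 : expPartCoeff t * Real.exp (-((β / (1 - t) - β) * (t / β))) =
      (1 - t) ^ 2 * Real.exp t ^ 2 := by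
    rw [expPartCoeff, mul_assoc, ← Real.exp_add, sub_mul, hτt,
      show t / (1 - t) + -(β / (1 - t) * (t / β) - t) = t by
        rw [div_mul_eq_mul_div, hτt]; ring]
    ring
  have e2 : Real.exp t * Real.exp (-t) = 1 := by rw [← Real.exp_add]; simp
  have e3 : t / β = t * (Real.exp t * (2 - t)) / 2 := by
    rw [div_eq_iff hβ.ne']; linear_combination (-t / 2) * hβe
  have mval : 1 + expPartCoeff t * Real.exp (-((β / (1 - t) - β) * (t / β))) -
      2 * Real.exp (-((1 - β) * (t / β))) =
      2 * Real.exp t * (Real.cosh (β * (t / β)) - t / β - Real.exp (-(t / β))) := by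
    rw [e1, e0, hτt, Real.cosh_eq, mul_sub, mul_sub, mul_div_assoc', e3]
    linear_combination -e2
  -- The right side is the derivative of `2e^{βx} (cosh(βx) - x - e^{-x})` at the break point.
  have mder : 2 * (1 - β) * Real.exp (-((1 - β) * (t / β))) -
      expPartCoeff t * (β / (1 - t) - β) * Real.exp (-((β / (1 - t) - β) * (t / β))) =
      2 * Real.exp t * ((β * Real.sinh (β * (t / β)) - 1 + Real.exp (-(t / β))) +
        β * (Real.cosh (β * (t / β)) - t / β - Real.exp (-(t / β)))) := by
    have e4 : expPartCoeff t * (β / (1 - t) - β) * Real.exp (-((β / (1 - t) - β) * (t / β))) =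
        β * t * (1 - t) * Real.exp t ^ 2 := by
      rw [mul_right_comm, e1]
      rcases eq_or_ne (1 - t) 0 with h | h
      · rw [h]; simp
      · field_simp; ring
    rw [e4, e0, hτt, Real.cosh_eq, Real.sinh_eq]
    have e5 : β * (t / β) = t := hτt
    linear_combination (-(1 + t) * Real.exp t) * hβe + 2 * Real.exp t * e5
  set χ := fun x => 1 + expPartCoeff t * Real.exp (-((β / (1 - t) - β) * x)) -
    2 * Real.exp (-((1 - β) * x)) with hχ
  have hχd := hasDerivAt_expPart (β / (1 - t) - β) (1 - β) (expPartCoeff t)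
  have hle : ∀ z, z ≤ t / β → β * z ≤ t := fun z hz => by
    rw [← hτt]; gcongr
  have hlt : ∀ z, t / β < z → t < β * z := fun z hz => by
    conv_lhs => rw [← hτt]
    gcongr
  have up : ∀ ξ, t / β ≤ ξ → 0 < 2 * (1 - β) * Real.exp (-((1 - β) * ξ)) -
      expPartCoeff t * (β / (1 - t) - β) * Real.exp (-((β / (1 - t) - β) * ξ)) →
      ∀ w z, ξ ≤ w → w < z → χ w < χ z := by
    intro ξ _ hξ w z hw hz
    exact lt_of_deriv_pos hχd hz fun u hu =>
      expPart_deriv_pos hdeq (by linarith) hC0 (hw.trans hu.le) hξ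
  have fin : ∀ z, t / β < z → 0 < χ z → 0 < extremalStopLoss t z - Real.exp (-z) := by
    intro z hz hpos
    rw [hχ] at hpos
    simp only [← hhi z (hlt z hz)] at hpos
    exact (mul_pos_iff_of_pos_left (by positivity)).1 hpos
  have fin' : ∀ z, t / β < z → 0 < extremalStopLoss t z - Real.exp (-z) → 0 < χ z := by
    intro z hz hpos
    rw [hχ]
    simp only [← hhi z (hlt z hz)]
    positivity
  have start : 0 < Real.cosh (β * (t / β)) - t / β - Real.exp (-(t / β)) → t / β < y →
      0 < extremalStopLoss t y - Real.exp (-y) := by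
    intro hpos hy
    have hd := (coshPart_pos hβ hτ hpos).1
    refine fin y hy (lt_trans ?_ (up (t / β) le_rfl ?_ (t / β) y le_rfl hy))
    · rw [hχ]; simp only [mval]; positivity
    · rw [mder]; positivity
  rcases le_or_gt y (t / β) with hy | hy
  · rw [hlo y (hle y hy)]
    rw [hlo x (hle x (hxy.le.trans hy))] at h
    exact (coshPart_pos hβ hx h).2 y hxy
  rcases le_or_gt x (t / β) with hxτ | hxτ
  · rw [hlo x (hle x hxτ)] at h
    refine start ?_ hy
    rcases hxτ.eq_or_lt with rfl | hxτ
    · exact h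
    · exact (coshPart_pos hβ hx h).2 _ hxτ
  -- If the difference is not yet positive at the break point, `χ` must increase somewhere between
  -- it and `x`, and hence ever after.
  rcases lt_or_ge 0 (Real.cosh (β * (t / β)) - t / β - Real.exp (-(t / β))) with hpos | hneg
  · exact start hpos hy
  · have hχx := fin' x hxτ h
    have hχτ : χ (t / β) ≤ 0 := by
      rw [hχ]; simp only [mval]
      exact mul_nonpos_of_nonneg_of_nonpos (by positivity) hneg
    obtain ⟨ξ, hξ, hξ'⟩ := exists_deriv_pos hχd hxτ (hχτ.trans_lt hχx)
    exact fin y hy (hχx.trans (up ξ hξ.1.le hξ' x y hξ.2.le hxy))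

/-- The rate is below `1`, so the term `e^{-βx}/2` eventually exceeds `e^{-x}`. -/
theorem exists_extremalStopLoss_sub_exp_pos {t : ℝ} (h0 : 0 < t) (h1 : t ≤ 1) :
    ∃ x, 0 < x ∧ 0 < extremalStopLoss t x - Real.exp (-x) := by
  have hβ := extremalRate_pos h1
  have hβ1 := extremalRate_lt_one h0 h1
  have hg : Tendsto (fun x => Real.exp ((1 - extremalRate t) * x)) atTop atTop :=
    Real.tendsto_exp_atTop.comp (tendsto_id.const_mul_atTop (by linarith))
  obtain ⟨x, hx, hx0, hxt⟩ := ((hg.eventually_gt_atTop 2).and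
    ((eventually_gt_atTop 0).and (eventually_gt_atTop (t / extremalRate t)))).exists
  refine ⟨x, hx0, ?_⟩
  rw [extremalStopLoss, if_neg (not_le.2 ((div_lt_iff₀' hβ).1 hxt))]
  have e : Real.exp (-(extremalRate t * x)) = Real.exp ((1 - extremalRate t) * x) * Real.exp (-x) := by
    rw [← Real.exp_add]; congr 1; ring
  have k1 : 0 ≤ (1 - t) ^ 2 * Real.exp t * Real.exp (-((extremalRate t * x - t) / (1 - t))) := by
    positivity
  have k2 := Real.exp_pos (-x)
  rw [e]
  nlinarith

/-- The extremal transforms cross the exponential one from below, once. -/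
theorem exists_crossesAt_exp {t : ℝ} (h0 : 0 < t) (h1 : t ≤ 1) :
    ∃ c, 0 < c ∧ CrossesAt c (extremalStopLoss t) (fun x => Real.exp (-x)) ∧
      ∀ x, c < x → Real.exp (-x) < extremalStopLoss t x := by
  have hβ := extremalRate_pos h1
  set S := {x | 0 < x ∧ 0 < extremalStopLoss t x - Real.exp (-x)} with hS
  have hne : S.Nonempty := exists_extremalStopLoss_sub_exp_pos h0 h1
  -- Positivity propagates to the right, so one nonpositive value at `δ` keeps the positivity set
  -- away from `0`; its infimum is the crossing point.
  obtain ⟨δ, hδ, hδτ, hδn⟩ := exists_coshPart_nonpos hβ (extremalRate_lt_one h0 h1)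
    (div_pos h0 hβ)
  have hlow : ∀ x ∈ S, δ ≤ x := by
    intro x hx
    by_contra! hlt
    have := extremalStopLoss_sub_exp_pos h0 h1 hx.1 hlt hx.2
    rw [extremalStopLoss_of_le (by rwa [mul_comm, ← le_div_iff₀ hβ])] at this
    linarith
  have hbdd : BddBelow S := ⟨δ, hlow⟩
  have hc : δ ≤ sInf S := le_csInf hne hlow
  have hgt : ∀ x, sInf S < x → Real.exp (-x) < extremalStopLoss t x := by
    intro x hx
    obtain ⟨z, hz, hzx⟩ := exists_lt_of_csInf_lt hne hx
    linarith [extremalStopLoss_sub_exp_pos h0 h1 hz.1 hzx hz.2]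
  refine ⟨sInf S, hδ.trans_le hc, ⟨fun x hx hxc => ?_, fun x hx => (hgt x hx).le⟩, hgt⟩
  by_contra! hlt
  exact absurd (csInf_le hbdd (show x ∈ S from ⟨hx, by linarith⟩)) (not_le.2 hxc)

end

section

/-! ### Sign patterns of the polynomials governing the extremal moments -/

/-- The coefficient of the incomplete Gamma factor. -/
def polyB (p s : ℝ) : ℝ := (1 - (p - 1) * s) ^ 2 + p * s ^ 3 * (p - (p + 2) * s + s ^ 2)

/-- The coefficient of the power factor. -/
def polyA (p s : ℝ) : ℝ := 1 - (p - 1) * s - (p - 1) * s ^ 2 + (p + 2) * s ^ 3 - s ^ 4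

/-- The polynomial deciding the monotonicity of the quotient. -/
def polyE (p s : ℝ) : ℝ :=
  1 + (p - 3) * s + (3 * p - 10) * s ^ 2 + s ^ 3 - 3 * (p - 1) * s ^ 4 + p * s ^ 5

variable {p : ℝ}

/-- In fact `E(s)/s³` is nonincreasing on `(0, 1]`: `s³E(r) - r³E(s)` is `s - r` times a bracket
that is affine in `p`, with nonnegative slope and a nonnegative value at `p = 2.94`. -/
theorem polyE_nonneg_of_le (hp : 2.94 ≤ p) {r s : ℝ} (hr : 0 < r) (hrs : r ≤ s) (hs : s ≤ 1)
    (h : 0 ≤ polyE p s) : 0 ≤ polyE p r := by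
  have hs0 : 0 < s := hr.trans_le hrs
  have hm : 0 < r * s := mul_pos hr hs0
  have hm1 : r * s ≤ 1 := by nlinarith
  have key : s ^ 3 * polyE p r - r ^ 3 * polyE p s = (s - r) * ((s ^ 2 + s * r + r ^ 2) +
      (p - 3) * (r * s) * (s + r) + (3 * p - 10) * (r * s) ^ 2 + 3 * (p - 1) * (r * s) ^ 3 -
      p * (r * s) ^ 3 * (s + r)) := by
    unfold polyE; ring
  have hbr : 0 ≤ (s ^ 2 + s * r + r ^ 2) +
      (p - 3) * (r * s) * (s + r) + (3 * p - 10) * (r * s) ^ 2 + 3 * (p - 1) * (r * s) ^ 3 -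
      p * (r * s) ^ 3 * (s + r) := by
    have h1 : 3 * (r * s) ≤ s ^ 2 + s * r + r ^ 2 := by nlinarith [sq_nonneg (s - r)]
    set m := r * s
    have ha : s + r ≤ 2 := by linarith
    have ha0 : 0 ≤ s + r := by linarith
    have h2 : m ^ 2 ≤ m := by nlinarith
    have h3 : m ^ 3 ≤ m := by nlinarith [mul_nonneg hm.le (sub_nonneg.2 h2)]
    have e : (p - 3) * m * (s + r) + (3 * p - 10) * m ^ 2 + 3 * (p - 1) * m ^ 3 -
        p * m ^ 3 * (s + r) = (p - 2.94) * (m * (s + r) + 3 * m ^ 2 + m ^ 3 * (3 - (s + r))) +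
        (-0.06 * (m * (s + r)) - 1.18 * m ^ 2 + m ^ 3 * (5.82 - 2.94 * (s + r))) := by ring
    have k1 : 0 ≤ (p - 2.94) * (m * (s + r) + 3 * m ^ 2 + m ^ 3 * (3 - (s + r))) := by
      refine mul_nonneg (by linarith) ?_
      have : 0 ≤ m ^ 3 * (3 - (s + r)) := mul_nonneg (by positivity) (by linarith)
      positivity
    have k2 : m * (s + r) ≤ m * 2 := by gcongr
    have k3 : m ^ 3 * (-0.06) ≤ m ^ 3 * (5.82 - 2.94 * (s + r)) := by
      gcongr; linarith
    nlinarith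
  have h2 : 0 ≤ r ^ 3 * polyE p s := by positivity
  have h3 : 0 ≤ s ^ 3 * polyE p r := by
    have := mul_nonneg (sub_nonneg.2 hrs) hbr
    linarith
  exact nonneg_of_mul_nonneg_right h3 (by positivity)

theorem polyB_pos_of_le_two_thirds (hp : 2.94 ≤ p) {s : ℝ} (hs0 : 0 < s) (hs : s ≤ 2 / 3) :
    0 < polyB p s := by
  have h : 0 < p - (p + 2) * s + s ^ 2 := by nlinarith
  unfold polyB
  have : 0 < p := by linarith
  positivity

/-- The same device as for `polyE`: `B(s)/s³` is nonincreasing, here only on `[2/3, 1]`. Below `2/3`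
positivity of `B` is immediate. -/
theorem polyB_cube_le (hp : 2.94 ≤ p) {r s : ℝ} (hr : 2 / 3 ≤ r) (hrs : r ≤ s) (hs : s ≤ 1) :
    r ^ 3 * polyB p s ≤ s ^ 3 * polyB p r := by
  have key : s ^ 3 * polyB p r - r ^ 3 * polyB p s = (s - r) * ((s + r - (p - 1) * (r * s)) ^ 2 +
      (r * s) * (p * (p + 2 - (s + r)) * (r * s) ^ 2 - 1)) := by
    unfold polyB; ring
  have hm : 4 / 9 ≤ r * s := by nlinarith
  have h1 : 8 ≤ p * (p + 2 - (s + r)) := by nlinarith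
  have h2 : (4 / 9 : ℝ) ^ 2 ≤ (r * s) ^ 2 := by gcongr
  have h3 : 1 ≤ p * (p + 2 - (s + r)) * (r * s) ^ 2 := by nlinarith
  have h4 : 0 ≤ (r * s) * (p * (p + 2 - (s + r)) * (r * s) ^ 2 - 1) :=
    mul_nonneg (by linarith) (by linarith)
  have h5 := mul_nonneg (sub_nonneg.2 hrs)
    (add_nonneg (sq_nonneg (s + r - (p - 1) * (r * s))) h4)
  linarith

theorem polyB_pos_of_le (hp : 2.94 ≤ p) {r s : ℝ} (hr : 0 < r) (hrs : r ≤ s) (hs : s ≤ 1)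
    (h : 0 < polyB p s) : 0 < polyB p r := by
  rcases le_total r (2 / 3) with hr' | hr'
  · exact polyB_pos_of_le_two_thirds hp hr hr'
  have h1 := polyB_cube_le hp hr' hrs hs
  have h2 : 0 < r ^ 3 * polyB p s := by positivity
  have hs0 : 0 < s := hr.trans_le hrs
  exact pos_of_mul_pos_right (h2.trans_le h1) (by positivity)

/-- An estimate around the corner `p = 4`, `s = 1`, with `d = 4 - p` and `e = 1 - s`. It shows that
`A` cannot be negative where `B ≤ 0`. The expression is quadratic in `d`, and a simplified minorant
has nonpositive discriminant. -/
theorem polyA_add_polyB_nonneg {d e : ℝ} (hd : 0 ≤ d) (he : 0 ≤ e) (he1 : e ≤ 1 / 3) :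
    0 ≤ (1 - e) ^ 2 * polyA (4 - d) (1 - e) + 8 / 25 * polyB (4 - d) (1 - e) := by
  have hz : 0 ≤ 1 / 3 - e := by linarith
  have e2 : 0 ≤ e ^ 2 := by positivity
  have e3 : 0 ≤ e ^ 3 := by positivity
  have key : (1 - e) ^ 2 * polyA (4 - d) (1 - e) + 8 / 25 * polyB (4 - d) (1 - e) =
      0.32 * (1 - e - 2 * e ^ 2 + 3 * e ^ 3 - e ^ 4) * d ^ 2 +
      (0.04 - 2.32 * e + 5.4 * e ^ 2 - 2.04 * e ^ 3 - 2.4 * e ^ 4 + 1.32 * e ^ 5) * d +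
      e * (0.12 + 3.96 * e - 12.2 * e ^ 2 + 10.72 * e ^ 3 - 1.28 * e ^ 4 - e ^ 5) := by
    unfold polyA polyB; ring
  rw [key]
  have a2 : 0.32 * (1 - e - 2 * e ^ 2 + 2.6 * e ^ 3) ≤
      0.32 * (1 - e - 2 * e ^ 2 + 3 * e ^ 3 - e ^ 4) := by
    nlinarith [mul_nonneg e3 hz]
  have a1 : -(e * (2.32 - 5.4 * e + 2.84 * e ^ 2)) ≤
      0.04 - 2.32 * e + 5.4 * e ^ 2 - 2.04 * e ^ 3 - 2.4 * e ^ 4 + 1.32 * e ^ 5 := by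
    nlinarith [mul_nonneg e3 hz, pow_nonneg he 5]
  have a0 : 0.12 + 3.96 * e - 12.2 * e ^ 2 + 10 * e ^ 3 ≤
      0.12 + 3.96 * e - 12.2 * e ^ 2 + 10.72 * e ^ 3 - 1.28 * e ^ 4 - e ^ 5 := by
    nlinarith [mul_nonneg e3 hz, mul_nonneg (mul_nonneg e3 he) hz]
  have hA : 0 < 1 - e - 2 * e ^ 2 + 2.6 * e ^ 3 := by nlinarith
  have disc : 0 ≤ 1.28 * (1 - e - 2 * e ^ 2 + 2.6 * e ^ 3) *
      (0.12 + 3.96 * e - 12.2 * e ^ 2 + 10 * e ^ 3) - e * (2.32 - 5.4 * e + 2.84 * e ^ 2) ^ 2 := by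
    -- The products `e^i (1/3 - e)^(6-i)` are the Bernstein basis of degree six on `[0, 1/3]`, up to
    -- constants; they certify the sign.
    have b0 := pow_nonneg hz 6
    have b1 := mul_nonneg he (pow_nonneg hz 5)
    have b2 := mul_nonneg e2 (pow_nonneg hz 4)
    have b3 := mul_nonneg e3 (pow_nonneg hz 3)
    have b4 := mul_nonneg (pow_nonneg he 4) (pow_nonneg hz 2)
    have b5 := mul_nonneg (pow_nonneg he 5) hz
    have b6 := pow_nonneg he 6
    linarith
  set u := 1 - e - 2 * e ^ 2 + 2.6 * e ^ 3
  set v := 2.32 - 5.4 * e + 2.84 * e ^ 2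
  set w := 0.12 + 3.96 * e - 12.2 * e ^ 2 + 10 * e ^ 3
  have main : 0 ≤ 0.32 * u * d ^ 2 - e * v * d + e * w := by
    have : 0 ≤ 1.28 * u * (0.32 * u * d ^ 2 - e * v * d + e * w) := by
      have e4 : 1.28 * u * (0.32 * u * d ^ 2 - e * v * d + e * w) =
        (0.64 * u * d - e * v) ^ 2 + e * (1.28 * u * w - e * v ^ 2) := by ring
      rw [e4]
      have := mul_nonneg he disc
      positivity
    exact nonneg_of_mul_nonneg_right this (by positivity)
  have m2 := mul_le_mul_of_nonneg_right a2 (sq_nonneg d)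
  have m1 := mul_le_mul_of_nonneg_right a1 hd
  have m0 := mul_le_mul_of_nonneg_left a0 he
  linarith

/-- `B ≤ 0` forces `s ≥ 2/3`, and also `p ≤ 4`, because `B(s)/s³ ≥ B(1) = (p-1)(p-4)`. The corner
estimate then applies. -/
theorem polyA_nonneg_of_polyB_nonpos (hp : 2.94 ≤ p) {s : ℝ} (hs0 : 0 < s) (hs : s ≤ 1)
    (h : polyB p s ≤ 0) : 0 ≤ polyA p s := by
  have hs2 : 2 / 3 ≤ s := by
    by_contra! hlt
    exact absurd (polyB_pos_of_le_two_thirds hp hs0 hlt.le) (not_lt.2 h)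
  have h1 := polyB_cube_le hp hs2 hs le_rfl
  have e1 : polyB p 1 = (p - 1) * (p - 4) := by unfold polyB; ring
  have hp4 : p ≤ 4 := by
    by_contra! hlt
    have : 0 < s ^ 3 * polyB p 1 := by
      rw [e1]
      have : 0 < (p - 1) * (p - 4) := mul_pos (by linarith) (by linarith)
      positivity
    linarith
  have h2 := polyA_add_polyB_nonneg (d := 4 - p) (e := 1 - s) (by linarith) (by linarith)
    (by linarith)
  rw [sub_sub_cancel, sub_sub_cancel] at h2
  have h3 : 0 ≤ s ^ 2 * polyA p s := by linarith
  exact nonneg_of_mul_nonneg_right h3 (by positivity)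

end

section

/-! ### Monotonicity of the extremal moments in the parameter -/

/-- The upper incomplete Gamma function `Γ(p - 1, x)`. -/
def upperGamma (p x : ℝ) : ℝ := ∫ w in Ioi x, w ^ (p - 2) * Real.exp (-w)

variable {p : ℝ}

theorem integrableOn_rpow_mul_exp (hp : 2 ≤ p) :
    IntegrableOn (fun w : ℝ => w ^ (p - 2) * Real.exp (-w)) (Ioi 0) := by
  have := Real.GammaIntegral_convergent (s := p - 1) (by linarith)
  refine this.congr_fun (fun w _ => ?_) measurableSet_Ioi
  beta_reduce
  rw [mul_comm, show p - 1 - 1 = p - 2 by ring]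

theorem continuous_rpow_mul_exp (hp : 2 ≤ p) :
    Continuous fun w : ℝ => w ^ (p - 2) * Real.exp (-w) :=
  (Real.continuous_rpow_const (by linarith)).mul (by fun_prop)

theorem upperGamma_zero (hp : 2 ≤ p) : upperGamma p 0 = Real.Gamma (p - 1) := by
  rw [upperGamma, Real.Gamma_eq_integral (by linarith)]
  refine setIntegral_congr_fun measurableSet_Ioi fun w _ => ?_
  rw [mul_comm, show p - 1 - 1 = p - 2 by ring]

theorem upperGamma_eq_sub (hp : 2 ≤ p) {x : ℝ} (hx : 0 ≤ x) :
    upperGamma p x = upperGamma p 0 - ∫ w in (0 : ℝ)..x, w ^ (p - 2) * Real.exp (-w) := by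
  have h := intervalIntegral.integral_Ioi_sub_Ioi (integrableOn_rpow_mul_exp hp) hx
  rw [upperGamma, upperGamma, ← h]
  ring

theorem upperGamma_pos (hp : 2 ≤ p) {x : ℝ} (hx : 0 ≤ x) : 0 < upperGamma p x := by
  rw [upperGamma, setIntegral_pos_iff_support_of_nonneg_ae]
  · have : Function.support (fun w : ℝ => w ^ (p - 2) * Real.exp (-w)) ∩ Ioi x = Ioi x := by
      refine inter_eq_right.2 fun w hw => ?_
      have : 0 < w := hx.trans_lt hw
      exact (mul_pos (Real.rpow_pos_of_pos this _) (Real.exp_pos _)).ne'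
    rw [this]; simp
  · refine (ae_restrict_iff' measurableSet_Ioi).2 (.of_forall fun w hw => ?_)
    have : 0 < w := hx.trans_lt hw
    exact (mul_pos (Real.rpow_pos_of_pos this _) (Real.exp_pos _)).le
  · exact (integrableOn_rpow_mul_exp hp).mono_set (Ioi_subset_Ioi hx)

theorem hasDerivAt_upperGamma (hp : 2 ≤ p) {x : ℝ} (hx : 0 < x) :
    HasDerivAt (upperGamma p) (-(x ^ (p - 2) * Real.exp (-x))) x := by
  have hc := continuous_rpow_mul_exp hp
  have h := (intervalIntegral.integral_hasDerivAt_right (hc.intervalIntegrable 0 x)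
    hc.stronglyMeasurable.stronglyMeasurableAtFilter hc.continuousAt).const_sub (upperGamma p 0)
  refine h.congr_of_eventuallyEq ?_
  filter_upwards [lt_mem_nhds hx] with y hy
  exact upperGamma_eq_sub hp (le_of_lt hy)

theorem continuousOn_upperGamma (hp : 2 ≤ p) : ContinuousOn (upperGamma p) (Ici 0) := by
  have hc := continuous_rpow_mul_exp hp
  have h : Continuous fun x => upperGamma p 0 - ∫ w in (0 : ℝ)..x, w ^ (p - 2) * Real.exp (-w) :=
    continuous_const.sub (intervalIntegral.continuous_primitive
      (fun a b => hc.intervalIntegrable a b) 0)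
  exact h.continuousOn.congr fun x hx => upperGamma_eq_sub hp hx

theorem tendsto_upperGamma_atTop (hp : 2 ≤ p) : Tendsto (upperGamma p) atTop (𝓝 0) := by
  have h := intervalIntegral_tendsto_integral_Ioi 0 (integrableOn_rpow_mul_exp hp) tendsto_id
  have h2 := h.const_sub (upperGamma p 0)
  rw [show (∫ w in Ioi (0 : ℝ), w ^ (p - 2) * Real.exp (-w)) = upperGamma p 0 from rfl,
    sub_self] at h2
  refine h2.congr' ?_
  filter_upwards [eventually_ge_atTop 0] with x hx
  exact (upperGamma_eq_sub hp hx).symm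

/-- `e ^ x Γ(p - 1, x)` grows at most like `(1 + x) ^ (p - 2)`. -/
theorem exp_mul_upperGamma_le (hp : 2 ≤ p) : ∃ C, ∀ x, 0 ≤ x →
    Real.exp x * upperGamma p x ≤ C * (1 + x) ^ (p - 2) := by
  have hi : IntegrableOn (fun v : ℝ => (1 + v) ^ (p - 2) * Real.exp (-v)) (Ioi 0) := by
    have h1 : IntegrableOn (fun w : ℝ => w ^ (p - 2) * Real.exp (-w)) (Ioi 1) :=
      (integrableOn_rpow_mul_exp hp).mono_set (Ioi_subset_Ioi zero_le_one)
    have h2 : IntegrableOn (fun v : ℝ => (v + 1) ^ (p - 2) * Real.exp (-(v + 1))) (Ioi 0) := by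
      have := ((measurePreserving_add_right volume (1 : ℝ)).integrableOn_comp_preimage
        (MeasurableEquiv.addRight (1 : ℝ)).measurableEmbedding).2 h1
      rwa [preimage_add_const_Ioi, sub_self] at this
    have h3 : IntegrableOn (fun v : ℝ => Real.exp 1 * ((v + 1) ^ (p - 2) * Real.exp (-(v + 1))))
      (Ioi 0) := h2.const_mul _
    refine h3.congr_fun (fun v _ => ?_) measurableSet_Ioi
    beta_reduce
    rw [mul_left_comm, ← Real.exp_add, add_comm 1 v]
    congr 2; ring
  refine ⟨∫ v in Ioi (0 : ℝ), (1 + v) ^ (p - 2) * Real.exp (-v), fun x hx => ?_⟩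
  have e : Real.exp x * upperGamma p x =
      ∫ v in Ioi (0 : ℝ), (v + x) ^ (p - 2) * Real.exp (-v) := by
    have h := (measurePreserving_add_right volume x).setIntegral_preimage_emb
      (MeasurableEquiv.addRight x).measurableEmbedding
      (fun w : ℝ => w ^ (p - 2) * Real.exp (-w)) (Ioi x)
    rw [preimage_add_const_Ioi, sub_self] at h
    rw [upperGamma, ← h, ← integral_const_mul]
    congr 1
    funext v
    rw [mul_left_comm, ← Real.exp_add]
    congr 2; ring
  -- The comparison rests on `v + x ≤ (1 + v)(1 + x)`.
  rw [e, mul_comm, ← integral_const_mul]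
  refine integral_mono_of_nonneg ?_ (hi.const_mul _) ?_
  · refine (ae_restrict_iff' measurableSet_Ioi).2 (.of_forall fun v hv => ?_)
    have : (0 : ℝ) < v := hv
    positivity
  · refine (ae_restrict_iff' measurableSet_Ioi).2 (.of_forall fun v hv => ?_)
    have hv0 : (0 : ℝ) < v := hv
    beta_reduce
    rw [← mul_assoc, ← Real.mul_rpow (by linarith) (by linarith)]
    gcongr ?_ ^ _ * _
    nlinarith

/-- The difference whose sign is that of the second-order variation. -/
def signFun (p x : ℝ) : ℝ :=
  polyB p (1 + x)⁻¹ * upperGamma p x -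
    (1 + x)⁻¹ * polyA p (1 + x)⁻¹ * (x ^ (p - 1) * Real.exp (-x))

/-- Dividing `signFun` by `polyB` isolates the incomplete Gamma function, whose derivative is
elementary. All transcendental factors then come out, and only the sign of `polyE` is left. -/
theorem hasDerivAt_signFun_div (hp : 2 ≤ p) {x : ℝ} (hx : 0 < x) (hB : polyB p (1 + x)⁻¹ ≠ 0) :
    HasDerivAt (fun x => upperGamma p x -
        (1 + x)⁻¹ * polyA p (1 + x)⁻¹ / polyB p (1 + x)⁻¹ * (x ^ (p - 1) * Real.exp (-x)))
      (-(Real.exp (-x) * x ^ (p - 2) * (1 + x)⁻¹ ^ 2 * (1 - (1 + x)⁻¹ ^ 2) *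
        polyE p (1 + x)⁻¹ / polyB p (1 + x)⁻¹ ^ 2)) x := by
  have hx1 : 1 + x ≠ 0 := by linarith
  have hs : HasDerivAt (fun x : ℝ => (1 + x)⁻¹) (-(1 + x)⁻¹ ^ 2) x := by
    have := ((hasDerivAt_id x).const_add 1).inv hx1
    refine this.congr_deriv ?_
    simp only [id]
    field_simp
  have hA : ∀ s : ℝ, HasDerivAt (fun s => s * polyA p s)
      (1 - 2 * (p - 1) * s - 3 * (p - 1) * s ^ 2 + 4 * (p + 2) * s ^ 3 - 5 * s ^ 4) s := by
    intro s
    have h : (fun s => s * polyA p s) = fun s => s - (p - 1) * s ^ 2 - (p - 1) * s ^ 3 +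
        (p + 2) * s ^ 4 - s ^ 5 := by funext s; unfold polyA; ring
    rw [h]
    have := ((((hasDerivAt_id s).sub ((hasDerivAt_pow 2 s).const_mul (p - 1))).sub
      ((hasDerivAt_pow 3 s).const_mul (p - 1))).add ((hasDerivAt_pow 4 s).const_mul (p + 2))).sub
      (hasDerivAt_pow 5 s)
    refine this.congr_deriv ?_
    push_cast; ring
  have hBd : ∀ s : ℝ, HasDerivAt (fun s => polyB p s)
      (2 - 2 * p + 2 * (p - 1) ^ 2 * s + 3 * p ^ 2 * s ^ 2 - 4 * (p ^ 2 + 2 * p) * s ^ 3 +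
        5 * p * s ^ 4) s := by
    intro s
    have h : (fun s => polyB p s) = fun s => 1 + (2 - 2 * p) * s + (p - 1) ^ 2 * s ^ 2 +
        p ^ 2 * s ^ 3 - (p ^ 2 + 2 * p) * s ^ 4 + p * s ^ 5 := by funext s; unfold polyB; ring
    rw [h]
    have := ((((((hasDerivAt_id s).const_mul (2 - 2 * p)).const_add 1).add
      ((hasDerivAt_pow 2 s).const_mul ((p - 1) ^ 2))).add
      ((hasDerivAt_pow 3 s).const_mul (p ^ 2))).sub
      ((hasDerivAt_pow 4 s).const_mul (p ^ 2 + 2 * p))).add ((hasDerivAt_pow 5 s).const_mul p)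
    refine this.congr_deriv ?_
    push_cast; ring
  have h1 := ((hA _).comp x hs).div ((hBd _).comp x hs) hB
  have h2 : HasDerivAt (fun x : ℝ => x ^ (p - 1)) ((p - 1) * x ^ (p - 2)) x := by
    have := Real.hasDerivAt_rpow_const (x := x) (p := p - 1) (.inl hx.ne')
    rwa [show p - 1 - 1 = p - 2 by ring] at this
  have h3 : HasDerivAt (fun x : ℝ => Real.exp (-x)) (Real.exp (-x) * -1) x := (hasDerivAt_neg x).exp
  have h4 := (hasDerivAt_upperGamma hp hx).sub (h1.mul (h2.mul h3))
  refine h4.congr_deriv ?_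
  have hxp : x ^ (p - 1) = x * x ^ (p - 2) := by
    rw [mul_comm, ← Real.rpow_add_one hx.ne']; congr 1; ring
  simp only [Function.comp_apply, Pi.div_apply, Pi.mul_apply, hxp]
  obtain ⟨s, hs'⟩ : ∃ s, s = (1 + x)⁻¹ := ⟨_, rfl⟩
  have hs0 : s ≠ 0 := by rw [hs']; exact inv_ne_zero hx1
  have hxs : x = 1 / s - 1 := by rw [hs']; field_simp; ring
  rw [← hs'] at hB ⊢
  generalize x ^ (p - 2) = T
  generalize Real.exp (-x) = E
  rw [hxs]
  field_simp
  unfold polyB polyA polyE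
  ring

theorem tendsto_signFun_div (hp : 2 ≤ p) :
    Tendsto (fun x => upperGamma p x -
        (1 + x)⁻¹ * polyA p (1 + x)⁻¹ / polyB p (1 + x)⁻¹ * (x ^ (p - 1) * Real.exp (-x)))
      atTop (𝓝 0) := by
  have hs : Tendsto (fun x : ℝ => (1 + x)⁻¹) atTop (𝓝 0) :=
    tendsto_inv_atTop_zero.comp (tendsto_atTop_add_const_left _ 1 tendsto_id)
  have hr : ContinuousAt (fun s => s * polyA p s / polyB p s) 0 := by
    refine ContinuousAt.div ?_ ?_ ?_
    · unfold polyA; fun_prop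
    · unfold polyB; fun_prop
    · simp [polyB]
  have h1 := hr.tendsto.comp hs
  have h2 := tendsto_rpow_mul_exp_neg_mul_atTop_nhds_zero (p - 1) 1 one_pos
  have h3 := (tendsto_upperGamma_atTop hp).sub (h1.mul h2)
  simpa using h3

/-- Positivity at `x` forces `B > 0` there, and hence on `[x, ∞)`, as `s = (1+x)⁻¹` decreases. There
`U = signFun / B` first increases and then decreases to its limit `0`, so it cannot become negative
again. -/
theorem signFun_nonneg_of_pos (hp : 2.94 ≤ p) {x y : ℝ} (hx : 0 < x) (hxy : x < y)
    (h : 0 < signFun p x) : 0 ≤ signFun p y := by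
  have hp2 : 2 ≤ p := by linarith
  have sle : ∀ u v : ℝ, 0 < u → u ≤ v → (1 + v)⁻¹ ≤ (1 + u)⁻¹ := fun u v hu huv => by gcongr
  have s1 : ∀ u : ℝ, 0 < u → (1 + u)⁻¹ ≤ 1 := fun u hu => inv_le_one_of_one_le₀ (by linarith)
  have s0 : ∀ u : ℝ, 0 < u → 0 < (1 + u)⁻¹ := fun u hu => by positivity
  have hBx : 0 < polyB p (1 + x)⁻¹ := by
    by_contra! hneg
    have hA := polyA_nonneg_of_polyB_nonpos hp (s0 x hx) (s1 x hx) hneg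
    have k1 : polyB p (1 + x)⁻¹ * upperGamma p x ≤ 0 :=
      mul_nonpos_of_nonpos_of_nonneg hneg (upperGamma_pos hp2 hx.le).le
    have k2 : 0 ≤ (1 + x)⁻¹ * polyA p (1 + x)⁻¹ * (x ^ (p - 1) * Real.exp (-x)) := by
      have := s0 x hx
      positivity
    unfold signFun at h
    linarith
  have hB : ∀ z, x ≤ z → 0 < polyB p (1 + z)⁻¹ := fun z hz =>
    polyB_pos_of_le hp (s0 z (hx.trans_le hz)) (sle x z hx hz) (s1 x hx) hBx
  set U := fun x => upperGamma p x -
    (1 + x)⁻¹ * polyA p (1 + x)⁻¹ / polyB p (1 + x)⁻¹ * (x ^ (p - 1) * Real.exp (-x)) with hU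
  have hUs : ∀ z, x ≤ z → signFun p z = polyB p (1 + z)⁻¹ * U z := by
    intro z hz
    have := (hB z hz).ne'
    simp only [hU, signFun]
    rw [mul_sub, ← mul_assoc (polyB p (1 + z)⁻¹), mul_div_cancel₀ _ this]
  have hy : 0 < y := hx.trans hxy
  rw [hUs y hxy.le]
  rw [hUs x le_rfl] at h
  have hUx : 0 < U x := (mul_pos_iff_of_pos_left hBx).1 h
  refine mul_nonneg (hB y hxy.le).le ?_
  have hd : ∀ z, x ≤ z → HasDerivAt U _ z := fun z hz =>
    hasDerivAt_signFun_div hp2 (hx.trans_le hz) (hB z hz).ne'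
  have hsgn : ∀ z, x ≤ z → 0 ≤ Real.exp (-z) * z ^ (p - 2) * (1 + z)⁻¹ ^ 2 *
      (1 - (1 + z)⁻¹ ^ 2) := by
    intro z hz
    have hz0 := hx.trans_le hz
    have k1 := s1 z hz0
    have k2 := s0 z hz0
    have : 0 ≤ 1 - (1 + z)⁻¹ ^ 2 := by nlinarith
    positivity
  -- If `E ≥ 0` at `y`, then `U` decreases to `0` on `[y, ∞)`; otherwise `E ≤ 0` on all of `[x, y]`
  -- and `U` increases there.
  rcases le_or_gt 0 (polyE p (1 + y)⁻¹) with hE | hE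
  · have hanti : AntitoneOn U (Ici y) := by
      refine antitoneOn_of_deriv_nonpos (convex_Ici y)
        (fun z hz => (hd z (hxy.le.trans hz)).continuousAt.continuousWithinAt)
        (fun z hz => (hd z (hxy.le.trans (interior_subset hz))).differentiableAt.differentiableWithinAt)
        fun z hz => ?_
      have hz' : y ≤ z := interior_subset hz
      rw [(hd z (hxy.le.trans hz')).deriv, neg_nonpos]
      have := polyE_nonneg_of_le hp (s0 z (hy.trans_le hz')) (sle y z hy hz') (s1 y hy) hE
      exact div_nonneg (mul_nonneg (hsgn z (hxy.le.trans hz')) this) (sq_nonneg _)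
    refine le_of_tendsto (tendsto_signFun_div hp2) ?_
    filter_upwards [eventually_ge_atTop y] with z hz
    exact hanti self_mem_Ici hz hz
  · have hmono : MonotoneOn U (Icc x y) := by
      refine monotoneOn_of_deriv_nonneg (convex_Icc x y)
        (fun z hz => (hd z hz.1).continuousAt.continuousWithinAt)
        (fun z hz => (hd z (interior_subset hz).1).differentiableAt.differentiableWithinAt)
        fun z hz => ?_
      have hz' := interior_subset hz
      rw [(hd z hz'.1).deriv, neg_nonneg]
      have : polyE p (1 + z)⁻¹ ≤ 0 := by
        by_contra! hpos
        have hz0 := hx.trans_le hz'.1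
        exact absurd (polyE_nonneg_of_le hp (s0 y hy) (sle z y hz0 hz'.2) (s1 z hz0) hpos.le)
          (not_le.2 hE)
      exact div_nonpos_of_nonpos_of_nonneg
        (mul_nonpos_of_nonneg_of_nonpos (hsgn z hz'.1) this) (sq_nonneg _)
    exact hUx.le.trans (hmono (left_mem_Icc.2 hxy.le) (right_mem_Icc.2 hxy.le) hxy.le)

end

/-! ### The extremal moment as a function of the parameter `t`. -/

section

/-- The mean of `(t + (1 - t) ℰ) ^ (p - 2)`, in terms of the incomplete Gamma function. -/
def tailFactor (p t : ℝ) : ℝ :=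
  Real.exp (t / (1 - t)) * (1 - t) ^ (p - 2) * upperGamma p (t / (1 - t))

/-- The unnormalised `p`-th absolute moment of the extremal law with parameter `t`. -/
def extremalNumerator (p t : ℝ) : ℝ :=
  Real.Gamma (p + 1) + p * (p - 1) * ((∫ y in (0 : ℝ)..t, y ^ (p - 2) * Real.exp y) +
    (1 - t) ^ 3 * Real.exp t * tailFactor p t) - Real.exp t * (2 - t) * (p - 1) * t ^ p

/-- The normalised `p`-th absolute moment of the extremal law with parameter `t`. -/
def extremalMoment (p t : ℝ) : ℝ :=
  extremalNumerator p t * (Real.exp t * (2 - t)) ^ (p - 1) / 2 ^ p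

/-- The logarithmic derivative of `extremalNumerator`, up to a positive factor. -/
def numeratorSlope (p t : ℝ) : ℝ :=
  p * tailFactor p t * (1 - (p + 1) * (1 - t) + (1 - t) ^ 2) - t ^ (p - 1) * (p + t)

/-- The derivative of `extremalMoment`, up to a positive factor. -/
def momentSlope (p t : ℝ) : ℝ :=
  Real.exp t * (2 - t) * numeratorSlope p t + extremalNumerator p t

variable {p : ℝ}

theorem rpow_sub_one_eq {t : ℝ} (ht : 0 < t) : t ^ (p - 1) = t * t ^ (p - 2) := by
  rw [mul_comm, ← Real.rpow_add_one ht.ne']; congr 1; ring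

theorem rpow_eq_sq_mul {t : ℝ} (ht : 0 < t) : t ^ p = t ^ 2 * t ^ (p - 2) := by
  rw [mul_comm, ← Real.rpow_natCast, ← Real.rpow_add ht]; congr 1; push_cast; ring

theorem hasDerivAt_tailFactor (hp : 2 ≤ p) {t : ℝ} (h0 : 0 < t) (h1 : t < 1) :
    HasDerivAt (tailFactor p)
      ((tailFactor p t - t ^ (p - 2)) / (1 - t) ^ 2 - (p - 2) * tailFactor p t / (1 - t)) t := by
  have hs : 0 < 1 - t := by linarith
  have hx : 0 < t / (1 - t) := div_pos h0 hs
  have d1 : HasDerivAt (fun t : ℝ => 1 - t) (-1) t := (hasDerivAt_id t).const_sub 1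
  have d2 : HasDerivAt (fun t : ℝ => t / (1 - t)) (1 / (1 - t) ^ 2) t := by
    refine ((hasDerivAt_id t).div d1 hs.ne').congr_deriv ?_
    simp
  have d3 := d2.exp
  have d4 : HasDerivAt (fun t : ℝ => (1 - t) ^ (p - 2)) (-1 * (p - 2) * (1 - t) ^ (p - 2 - 1)) t :=
    d1.rpow_const (.inl hs.ne')
  have d5 := (hasDerivAt_upperGamma hp hx).comp t d2
  have d6 := (d3.mul d4).mul d5
  refine d6.congr_deriv ?_
  have e1 : (1 - t) ^ (p - 2 - 1) = (1 - t) ^ (p - 2) / (1 - t) := Real.rpow_sub_one hs.ne' _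
  have e2 : (t / (1 - t)) ^ (p - 2) = t ^ (p - 2) / (1 - t) ^ (p - 2) := Real.div_rpow h0.le hs.le _
  have e3 : Real.exp (-(t / (1 - t))) = (Real.exp (t / (1 - t)))⁻¹ := Real.exp_neg _
  simp only [Pi.mul_apply, Function.comp_apply, e1, e2, e3, tailFactor]
  have n1 : (1 - t) ^ (p - 2) ≠ 0 := (Real.rpow_pos_of_pos hs _).ne'
  have n2 : Real.exp (t / (1 - t)) ≠ 0 := (Real.exp_pos _).ne'
  generalize (1 - t) ^ (p - 2) = R at *
  generalize Real.exp (t / (1 - t)) = E at *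
  field_simp
  ring

theorem hasDerivAt_extremalNumerator (hp : 2 ≤ p) {t : ℝ} (h0 : 0 < t) (h1 : t < 1) :
    HasDerivAt (extremalNumerator p) ((p - 1) * (1 - t) * Real.exp t * numeratorSlope p t) t := by
  have hs : 0 < 1 - t := by linarith
  have hc : Continuous fun y : ℝ => y ^ (p - 2) * Real.exp y :=
    (Real.continuous_rpow_const (by linarith)).mul Real.continuous_exp
  have d0 := intervalIntegral.integral_hasDerivAt_right (hc.intervalIntegrable 0 t)
    hc.stronglyMeasurable.stronglyMeasurableAtFilter hc.continuousAt
  have d1 : HasDerivAt (fun t : ℝ => 1 - t) (-1) t := (hasDerivAt_id t).const_sub 1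
  have d2 : HasDerivAt (fun t : ℝ => 2 - t) (-1) t := (hasDerivAt_id t).const_sub 2
  have d3 := ((d1.pow 3).mul (Real.hasDerivAt_exp t)).mul (hasDerivAt_tailFactor hp h0 h1)
  have d4 : HasDerivAt (fun t : ℝ => t ^ p) (p * t ^ (p - 1)) t :=
    Real.hasDerivAt_rpow_const (.inl h0.ne')
  have d5 := (((Real.hasDerivAt_exp t).mul d2).mul_const (p - 1)).mul d4
  have d6 := (((d0.add d3).const_mul (p * (p - 1))).const_add (Real.Gamma (p + 1))).sub d5
  refine d6.congr_deriv ?_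
  simp only [Pi.mul_apply, Pi.pow_apply, numeratorSlope, rpow_sub_one_eq (p := p) h0]
  rw [rpow_eq_sq_mul (p := p) h0]
  field_simp
  push_cast
  ring

/-- The source of `polyA` and `polyB`: they are the coefficients of `t^(p-1)` and of the incomplete
Gamma factor in the second-order variation. -/
theorem hasDerivAt_momentSlope (hp : 2 ≤ p) {t : ℝ} (h0 : 0 < t) (h1 : t < 1) :
    HasDerivAt (momentSlope p) (Real.exp t * p / (1 - t) ^ 2 *
      (polyB p (1 - t) * tailFactor p t - polyA p (1 - t) * t ^ (p - 1))) t := by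
  have hs : 0 < 1 - t := by linarith
  have d1 : HasDerivAt (fun t : ℝ => 1 - t) (-1) t := (hasDerivAt_id t).const_sub 1
  have d2 : HasDerivAt (fun t : ℝ => 2 - t) (-1) t := (hasDerivAt_id t).const_sub 2
  have d3 := ((d1.const_mul (p + 1)).const_sub 1).add (d1.pow 2)
  have d4 : HasDerivAt (fun t : ℝ => t ^ (p - 1)) ((p - 1) * t ^ (p - 2)) t := by
    have := Real.hasDerivAt_rpow_const (x := t) (p := p - 1) (.inl h0.ne')
    rwa [show p - 1 - 1 = p - 2 by ring] at this
  have d5 := (((hasDerivAt_tailFactor hp h0 h1).const_mul p).mul d3).sub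
    (d4.mul ((hasDerivAt_id t).const_add p))
  have d6 := (((Real.hasDerivAt_exp t).mul d2).mul d5).add (hasDerivAt_extremalNumerator hp h0 h1)
  refine d6.congr_deriv ?_
  simp only [Pi.mul_apply, Pi.pow_apply, Pi.sub_apply, Pi.add_apply, numeratorSlope,
    rpow_sub_one_eq h0, id, polyA, polyB]
  field_simp
  push_cast
  ring

theorem hasDerivAt_extremalMoment (hp : 2 ≤ p) {t : ℝ} (h0 : 0 < t) (h1 : t < 1) :
    HasDerivAt (extremalMoment p) ((Real.exp t * (2 - t)) ^ (p - 2) / 2 ^ p *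
      ((p - 1) * (1 - t) * Real.exp t) * momentSlope p t) t := by
  have h2 : 0 < 2 - t := by linarith
  have hZ : 0 < Real.exp t * (2 - t) := by positivity
  have d2 : HasDerivAt (fun t : ℝ => 2 - t) (-1) t := (hasDerivAt_id t).const_sub 2
  have d3 := ((Real.hasDerivAt_exp t).mul d2).rpow_const (p := p - 1) (.inl hZ.ne')
  have d4 := ((hasDerivAt_extremalNumerator hp h0 h1).mul d3).div_const (2 ^ p)
  refine d4.congr_deriv ?_
  simp only [Pi.mul_apply, momentSlope, show p - 1 - 1 = p - 2 by ring, rpow_sub_one_eq hZ]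
  field_simp
  ring

/-- The substitution `x = t/(1-t)`, for which `(1+x)⁻¹ = 1 - t`. -/
theorem tailFactor_eq_signFun {t : ℝ} (h0 : 0 < t) (h1 : t < 1) :
    polyB p (1 - t) * tailFactor p t - polyA p (1 - t) * t ^ (p - 1) =
      Real.exp (t / (1 - t)) * (1 - t) ^ (p - 2) * signFun p (t / (1 - t)) := by
  have hs : 0 < 1 - t := by linarith
  have e : (1 + t / (1 - t))⁻¹ = 1 - t := by field_simp; simp
  have e2 : (t / (1 - t)) ^ (p - 1) = t ^ (p - 1) / ((1 - t) * (1 - t) ^ (p - 2)) := by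
    rw [Real.div_rpow h0.le hs.le, rpow_sub_one_eq hs]
  have e3 : Real.exp (-(t / (1 - t))) = (Real.exp (t / (1 - t)))⁻¹ := Real.exp_neg _
  have n1 : (1 - t) ^ (p - 2) ≠ 0 := (Real.rpow_pos_of_pos hs _).ne'
  have n2 : Real.exp (t / (1 - t)) ≠ 0 := (Real.exp_pos _).ne'
  rw [signFun, e, e2, e3, tailFactor]
  generalize (1 - t) ^ (p - 2) = R at *
  generalize Real.exp (t / (1 - t)) = E at *
  field_simp

/-- Both contributions are multiples of `Γ(p+1) = p(p-1)Γ(p-1)` and cancel. This zero is where the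
mean value argument of `momentSlope_nonneg_of_pos` starts. -/
theorem momentSlope_zero (hp : 2 ≤ p) : momentSlope p 0 = 0 := by
  have h1 : Real.Gamma (p + 1) = p * (p - 1) * Real.Gamma (p - 1) := by
    rw [Real.Gamma_add_one (by linarith)]
    have := Real.Gamma_add_one (s := p - 1) (by linarith)
    rw [sub_add_cancel] at this
    rw [this]; ring
  have h2 : (0 : ℝ) ^ (p - 1) = 0 := Real.zero_rpow (by linarith)
  have h3 : (0 : ℝ) ^ p = 0 := Real.zero_rpow (by linarith)
  simp only [momentSlope, numeratorSlope, extremalNumerator, tailFactor, h1, h2, h3]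
  simp [upperGamma_zero hp]
  ring

theorem continuousOn_tailFactor (hp : 2 ≤ p) : ContinuousOn (tailFactor p) (Ico 0 1) := by
  have hx : ContinuousOn (fun t : ℝ => t / (1 - t)) (Ico 0 1) :=
    ContinuousOn.div (by fun_prop) (by fun_prop) fun t ht => by linarith [ht.2]
  refine ((Real.continuous_exp.comp_continuousOn hx).mul ?_).mul
    ((continuousOn_upperGamma hp).comp hx fun t ht => div_nonneg ht.1 (by linarith [ht.2]))
  exact ContinuousOn.rpow_const (by fun_prop) fun t ht => .inr (by linarith)

theorem tailFactor_bound (hp : 2 ≤ p) :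
    ∃ C, ∀ t ∈ Ico (0 : ℝ) 1, |tailFactor p t| ≤ C := by
  obtain ⟨C, hC⟩ := exp_mul_upperGamma_le hp
  refine ⟨C, fun t ht => ?_⟩
  have hs : 0 < 1 - t := by linarith [ht.2]
  have hx : 0 ≤ t / (1 - t) := div_nonneg ht.1 hs.le
  have hR : 0 < (1 - t) ^ (p - 2) := Real.rpow_pos_of_pos hs _
  have hg := upperGamma_pos hp hx
  rw [abs_of_nonneg (by unfold tailFactor; positivity), tailFactor]
  have h := mul_le_mul_of_nonneg_right (hC _ hx) hR.le
  have e : (1 + t / (1 - t)) ^ (p - 2) * (1 - t) ^ (p - 2) = 1 := by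
    rw [← Real.mul_rpow (by positivity) hs.le]
    have : (1 + t / (1 - t)) * (1 - t) = 1 := by field_simp; ring
    rw [this, Real.one_rpow]
  rw [mul_assoc C, e, mul_one] at h
  linarith

theorem continuousOn_extremalNumerator (hp : 2 ≤ p) :
    ContinuousOn (extremalNumerator p) (Icc 0 1) := by
  have hc : Continuous fun y : ℝ => y ^ (p - 2) * Real.exp y :=
    (Real.continuous_rpow_const (by linarith)).mul Real.continuous_exp
  have c1 : Continuous fun t => ∫ y in (0 : ℝ)..t, y ^ (p - 2) * Real.exp y :=
    intervalIntegral.continuous_primitive (fun a b => hc.intervalIntegrable a b) 0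
  have c2 : Continuous fun t : ℝ => t ^ p := Real.continuous_rpow_const (by linarith)
  -- At `t = 1` the value of `tailFactor` is an artefact of division by zero; continuity holds
  -- because `tailFactor` is bounded and multiplied by `(1-t)³`.
  have c3 : ContinuousOn (fun t => (1 - t) ^ 3 * Real.exp t * tailFactor p t) (Icc 0 1) := by
    intro t ht
    rcases ht.2.eq_or_lt with rfl | h
    · obtain ⟨C, hC⟩ := tailFactor_bound hp
      rw [ContinuousWithinAt]
      have lim : Tendsto (fun t : ℝ => (1 - t) ^ 3 * Real.exp t * C) (𝓝[Icc 0 1] 1) (𝓝 0) := by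
        have : Continuous fun t : ℝ => (1 - t) ^ 3 * Real.exp t * C := by fun_prop
        simpa using (this.tendsto 1).mono_left nhdsWithin_le_nhds
      have z : (1 - (1 : ℝ)) ^ 3 * Real.exp 1 * tailFactor p 1 = 0 := by norm_num
      rw [z]
      refine squeeze_zero_norm' ?_ lim
      filter_upwards [self_mem_nhdsWithin] with u hu
      have hu1 : 0 ≤ 1 - u := by linarith [hu.2]
      rw [Real.norm_eq_abs, abs_mul, abs_of_nonneg (by positivity : 0 ≤ (1 - u) ^ 3 * Real.exp u)]
      rcases hu.2.eq_or_lt with rfl | h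
      · norm_num
      · exact mul_le_mul_of_nonneg_left (hC u ⟨hu.1, h⟩) (by positivity)
    · have hcont := (continuousOn_tailFactor hp) t ⟨ht.1, h⟩
      have : ContinuousWithinAt (tailFactor p) (Icc 0 1) t := by
        refine hcont.mono_of_mem_nhdsWithin ?_
        filter_upwards [self_mem_nhdsWithin, nhdsWithin_le_nhds (Iio_mem_nhds h)] with u hu hu'
        exact ⟨hu.1, hu'⟩
      exact ContinuousWithinAt.mul (by fun_prop) this
  unfold extremalNumerator
  exact (continuousOn_const.add (continuousOn_const.mul (c1.continuousOn.add c3))).sub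
    ((Continuous.mul (by fun_prop) c2).continuousOn)

/-- A function whose derivative changes sign at most once, from negative to positive, is bounded
by its values at the end points. -/
theorem le_max_of_deriv_pos_imp {f f' : ℝ → ℝ} (hc : ContinuousOn f (Icc 0 1))
    (hf : ∀ t ∈ Ioo (0 : ℝ) 1, HasDerivAt f (f' t) t)
    (h : ∀ u ∈ Ioo (0 : ℝ) 1, ∀ v ∈ Ioo (0 : ℝ) 1, u < v → 0 < f' u → 0 ≤ f' v) {t : ℝ}
    (ht : t ∈ Icc (0 : ℝ) 1) : f t ≤ max (f 0) (f 1) := by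
  by_cases hex : ∃ u ∈ Ioo (0 : ℝ) 1, u < t ∧ 0 < f' u
  · obtain ⟨u, hu, hut, hpos⟩ := hex
    refine le_max_of_le_right ?_
    have hm : MonotoneOn f (Icc t 1) := by
      refine monotoneOn_of_deriv_nonneg (convex_Icc t 1) (hc.mono (Icc_subset_Icc_left ht.1))
        (fun z hz => ?_) fun z hz => ?_
      all_goals
        rw [interior_Icc] at hz
        have hz' : z ∈ Ioo (0 : ℝ) 1 := ⟨ht.1.trans_lt hz.1, hz.2⟩
      · exact (hf z hz').differentiableAt.differentiableWithinAt
      · rw [(hf z hz').deriv]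
        exact h u hu z hz' (hut.trans hz.1) hpos
    exact hm (left_mem_Icc.2 ht.2) (right_mem_Icc.2 ht.2) ht.2
  · push Not at hex
    refine le_max_of_le_left ?_
    have hm : AntitoneOn f (Icc 0 t) := by
      refine antitoneOn_of_deriv_nonpos (convex_Icc 0 t) (hc.mono (Icc_subset_Icc_right ht.2))
        (fun z hz => ?_) fun z hz => ?_
      all_goals
        rw [interior_Icc] at hz
        have hz' : z ∈ Ioo (0 : ℝ) 1 := ⟨hz.1, hz.2.trans_le ht.2⟩
      · exact (hf z hz').differentiableAt.differentiableWithinAt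
      · rw [(hf z hz').deriv]
        exact hex z hz' hz.2
    exact hm (left_mem_Icc.2 ht.1) (right_mem_Icc.2 ht.1) ht.1

/-- Since the slope vanishes at `0`, a positive value at `u` forces a positive derivative at some `ξ
< u`. The sign pattern of `signFun` makes the derivative nonnegative from there on. -/
theorem momentSlope_nonneg_of_pos (hp : 2.94 ≤ p) {u v : ℝ} (hu : u ∈ Ioo (0 : ℝ) 1)
    (hv : v ∈ Ioo (0 : ℝ) 1) (huv : u < v) (h : 0 < momentSlope p u) : 0 ≤ momentSlope p v := by
  have hp2 : 2 ≤ p := by linarith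
  have hc : ContinuousOn (momentSlope p) (Ico 0 1) := by
    unfold momentSlope numeratorSlope
    have c0 : Continuous fun t : ℝ => t ^ (p - 1) := Real.continuous_rpow_const (by linarith)
    have c1 := continuousOn_tailFactor hp2
    have c2 := (continuousOn_extremalNumerator hp2).mono Ico_subset_Icc_self
    refine ContinuousOn.add (ContinuousOn.mul (by fun_prop) (ContinuousOn.sub ?_ ?_)) c2
    · exact (continuousOn_const.mul c1).mul (by fun_prop)
    · exact (c0.mul (by fun_prop)).continuousOn
  have hd : ∀ t ∈ Ioo (0 : ℝ) 1, HasDerivAt (momentSlope p) (Real.exp t * p / (1 - t) ^ 2 *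
      (Real.exp (t / (1 - t)) * (1 - t) ^ (p - 2) * signFun p (t / (1 - t)))) t := by
    intro t ht
    have := hasDerivAt_momentSlope hp2 ht.1 ht.2
    rwa [tailFactor_eq_signFun ht.1 ht.2] at this
  obtain ⟨ξ, hξ, hξ'⟩ := exists_hasDerivAt_eq_slope (momentSlope p) _ hu.1
    (hc.mono fun z hz => ⟨hz.1, hz.2.trans_lt hu.2⟩) fun z hz => hd z ⟨hz.1, hz.2.trans hu.2⟩
  have hξ1 : ξ < 1 := hξ.2.trans hu.2
  rw [momentSlope_zero hp2, sub_zero, sub_zero] at hξ'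
  have fac : ∀ t ∈ Ioo (0 : ℝ) 1, 0 < Real.exp t * p / (1 - t) ^ 2 ∧
      0 < Real.exp (t / (1 - t)) * (1 - t) ^ (p - 2) := by
    intro t ht
    have hs : 0 < 1 - t := by linarith [ht.2]
    have := Real.rpow_pos_of_pos hs (p - 2)
    have hp0 : 0 < p := by linarith
    exact ⟨by positivity, by positivity⟩
  have hsξ : 0 < signFun p (ξ / (1 - ξ)) := by
    have h1 : 0 < momentSlope p u / u := div_pos h hu.1
    rw [← hξ'] at h1
    obtain ⟨f1, f2⟩ := fac ξ ⟨hξ.1, hξ1⟩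
    exact (mul_pos_iff_of_pos_left f2).1 ((mul_pos_iff_of_pos_left f1).1 h1)
  have hm : MonotoneOn (momentSlope p) (Icc u v) := by
    refine monotoneOn_of_deriv_nonneg (convex_Icc u v)
      (hc.mono fun z hz => ⟨hu.1.le.trans hz.1, hz.2.trans_lt hv.2⟩)
      (fun z hz => ?_) fun z hz => ?_
    all_goals
      rw [interior_Icc] at hz
      have hz' : z ∈ Ioo (0 : ℝ) 1 := ⟨hu.1.trans hz.1, hz.2.trans hv.2⟩
    · exact (hd z hz').differentiableAt.differentiableWithinAt
    · rw [(hd z hz').deriv]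
      have hlt : ξ / (1 - ξ) < z / (1 - z) := by
        rw [div_lt_div_iff₀ (by linarith) (by linarith [hz'.2])]
        nlinarith [hξ.2.trans hz.1]
      have := signFun_nonneg_of_pos hp (div_pos hξ.1 (by linarith)) hlt hsξ
      obtain ⟨f1, f2⟩ := fac z hz'
      positivity
  exact h.le.trans (hm (left_mem_Icc.2 huv.le) (right_mem_Icc.2 huv.le) huv.le)

/-- The extremal moments are maximal at one of the two ends of the family. -/
theorem extremalMoment_le_max (hp : 2.94 ≤ p) {t : ℝ} (ht : t ∈ Icc (0 : ℝ) 1) :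
    extremalMoment p t ≤ max (extremalMoment p 0) (extremalMoment p 1) := by
  have hp2 : 2 ≤ p := by linarith
  refine le_max_of_deriv_pos_imp ?_
    (fun t ht => hasDerivAt_extremalMoment hp2 ht.1 ht.2) ?_ ht
  · unfold extremalMoment
    refine ((continuousOn_extremalNumerator hp2).mul ?_).div_const _
    exact ContinuousOn.rpow_const (by fun_prop) fun t _ => .inr (by linarith)
  · intro u hu v hv huv hpos
    have fac : ∀ t ∈ Ioo (0 : ℝ) 1, 0 < (Real.exp t * (2 - t)) ^ (p - 2) / 2 ^ p *
        ((p - 1) * (1 - t) * Real.exp t) := by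
      intro t ht
      have h2 : 0 < 2 - t := by linarith [ht.2]
      have h1 : 0 < 1 - t := by linarith [ht.2]
      have h3 : 0 < p - 1 := by linarith
      positivity
    exact mul_nonneg (fac v hv).le (momentSlope_nonneg_of_pos hp hu hv huv
      ((mul_pos_iff_of_pos_left (fac u hu)).1 hpos))

end

/-! ### Stop-loss moments of the extremal family in closed form. -/

section

variable {p : ℝ}

/-- The substitution `w = v/(1-t)` in the incomplete Gamma integral. For `t = 1` both sides vanish.
-/
theorem integrableOn_and_integral_tailFactor (hp : 2 ≤ p) {t : ℝ} (h0 : 0 ≤ t) (h1 : t ≤ 1) :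
    IntegrableOn (fun v : ℝ => v ^ (p - 2) *
      ((1 - t) ^ 2 * Real.exp t * Real.exp (-((v - t) / (1 - t))))) (Ioi t) ∧
    ∫ v in Ioi t, v ^ (p - 2) * ((1 - t) ^ 2 * Real.exp t * Real.exp (-((v - t) / (1 - t)))) =
      (1 - t) ^ 3 * Real.exp t * tailFactor p t := by
  rcases h1.eq_or_lt with rfl | h1
  · norm_num
  have hs : 0 < 1 - t := by linarith
  set s := 1 - t with hsdef
  have hx : 0 ≤ t / s := div_nonneg h0 hs.le
  have hgi : IntegrableOn (fun w : ℝ => w ^ (p - 2) * Real.exp (-w)) (Ioi (t / s)) :=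
    (integrableOn_rpow_mul_exp hp).mono_set (Ioi_subset_Ioi hx)
  have hpt : EqOn (fun v : ℝ => s ^ (p - 2) * Real.exp (t / s) * (s ^ 2 * Real.exp t) *
      ((s⁻¹ * v) ^ (p - 2) * Real.exp (-(s⁻¹ * v)))) (fun v : ℝ => v ^ (p - 2) *
      (s ^ 2 * Real.exp t * Real.exp (-((v - t) / s)))) (Ioi t) := by
    intro v hv
    have hv0 : 0 ≤ v := h0.trans (le_of_lt hv)
    have e1 : s ^ (p - 2) * (s⁻¹ * v) ^ (p - 2) = v ^ (p - 2) := by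
      rw [← Real.mul_rpow hs.le (by positivity), mul_inv_cancel_left₀ hs.ne']
    have e2 : Real.exp (t / s) * Real.exp (-(s⁻¹ * v)) = Real.exp (-((v - t) / s)) := by
      rw [← Real.exp_add]; congr 1; field_simp; ring
    beta_reduce
    rw [← e1, ← e2]; ring
  have hst : s⁻¹ * t = t / s := by rw [mul_comm, div_eq_mul_inv]
  have i1 : IntegrableOn (fun v : ℝ => (s⁻¹ * v) ^ (p - 2) * Real.exp (-(s⁻¹ * v))) (Ioi t) := by
    refine (integrableOn_Ioi_comp_mul_left_iff (fun w : ℝ => w ^ (p - 2) * Real.exp (-w)) t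
      (inv_pos.2 hs)).2 ?_
    rwa [hst]
  refine ⟨IntegrableOn.congr_fun (Integrable.const_mul i1 _) hpt measurableSet_Ioi, ?_⟩
  rw [← setIntegral_congr_fun measurableSet_Ioi hpt, integral_const_mul,
    integral_comp_mul_left_Ioi (fun w : ℝ => w ^ (p - 2) * Real.exp (-w)) t (inv_pos.2 hs), hst,
    inv_inv, smul_eq_mul, tailFactor, upperGamma]
  ring

/-- The extremal transform in the rescaled variable. -/
def rescaledStopLoss (t v : ℝ) : ℝ :=
  if v ≤ t then Real.cosh v - v * (Real.exp t * (2 - t)) / 2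
  else (Real.exp (-v) + (1 - t) ^ 2 * Real.exp t * Real.exp (-((v - t) / (1 - t)))) / 2

theorem integrableOn_and_integral_rescaled (hp : 2 ≤ p) {t : ℝ} (h0 : 0 ≤ t) (h1 : t ≤ 1) :
    IntegrableOn (fun v : ℝ => v ^ (p - 2) * rescaledStopLoss t v) (Ioi 0) ∧
    p * (p - 1) * ∫ v in Ioi 0, v ^ (p - 2) * rescaledStopLoss t v = extremalNumerator p t / 2 := by
  obtain ⟨j1, j2⟩ := integrableOn_and_integral_tailFactor hp h0 h1
  set Z := Real.exp t * (2 - t) with hZ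
  have hg := integrableOn_rpow_mul_exp hp
  have hg1 := hg.mono_set (Ioi_subset_Ioi h0)
  have hg2 : IntegrableOn (fun w : ℝ => w ^ (p - 2) * Real.exp (-w)) (Ioc 0 t) :=
    hg.mono_set Ioc_subset_Ioi_self
  have hc : Continuous fun y : ℝ => y ^ (p - 2) * Real.exp y :=
    (Real.continuous_rpow_const (by linarith)).mul Real.continuous_exp
  have hl : IntegrableOn (fun y : ℝ => y ^ (p - 2) * Real.exp y) (Ioc 0 t) :=
    (hc.intervalIntegrable 0 t).1
  have hr : IntegrableOn (fun y : ℝ => y ^ (p - 1)) (Ioc 0 t) :=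
    integrableOn_Ioc_rpow (by linarith) t
  have e1 : EqOn (fun v : ℝ => v ^ (p - 2) * rescaledStopLoss t v)
      (fun v => 1 / 2 * (v ^ (p - 2) * Real.exp (-v)) + 1 / 2 * (v ^ (p - 2) * Real.exp v) -
        Z / 2 * v ^ (p - 1)) (Ioc 0 t) := by
    intro v hv
    simp only [rescaledStopLoss, if_pos hv.2, Real.cosh_eq, rpow_sub_one_eq hv.1, ← hZ]
    ring
  have e2 : EqOn (fun v : ℝ => v ^ (p - 2) * rescaledStopLoss t v)
      (fun v => 1 / 2 * (v ^ (p - 2) * Real.exp (-v)) + 1 / 2 * (v ^ (p - 2) *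
        ((1 - t) ^ 2 * Real.exp t * Real.exp (-((v - t) / (1 - t)))))) (Ioi t) := by
    intro v hv
    simp only [rescaledStopLoss, if_neg (not_le.2 (mem_Ioi.1 hv))]
    ring
  have k1 := Integrable.const_mul hg2 (1 / 2)
  have k2 := Integrable.const_mul hl (1 / 2)
  have k3 := Integrable.const_mul hr (Z / 2)
  have k4 := Integrable.const_mul hg1 (1 / 2)
  have k5 := Integrable.const_mul j1 (1 / 2)
  have f1 : IntegrableOn (fun v : ℝ => v ^ (p - 2) * rescaledStopLoss t v) (Ioc 0 t) :=
    IntegrableOn.congr_fun ((k1.add k2).sub k3) e1.symm measurableSet_Ioc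
  have f2 : IntegrableOn (fun v : ℝ => v ^ (p - 2) * rescaledStopLoss t v) (Ioi t) :=
    IntegrableOn.congr_fun (k4.add k5) e2.symm measurableSet_Ioi
  have hu : Ioc 0 t ∪ Ioi t = Ioi 0 := Ioc_union_Ioi_eq_Ioi h0
  have hd : Disjoint (Ioc 0 t) (Ioi t) := Set.disjoint_left.2 fun z hz hz' => not_lt.2 hz.2 hz'
  have hgam : (∫ v in Ioc 0 t, v ^ (p - 2) * Real.exp (-v)) +
      ∫ v in Ioi t, v ^ (p - 2) * Real.exp (-v) = Real.Gamma (p - 1) := by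
    rw [← setIntegral_union hd measurableSet_Ioi hg2 hg1, hu, ← upperGamma_zero hp, upperGamma]
  have hG : Real.Gamma (p + 1) = p * (p - 1) * Real.Gamma (p - 1) := by
    rw [Real.Gamma_add_one (by linarith)]
    have := Real.Gamma_add_one (s := p - 1) (by linarith)
    rw [sub_add_cancel] at this
    rw [this]; ring
  refine ⟨by rw [← hu]; exact f1.union f2, ?_⟩
  rw [← hu, setIntegral_union hd measurableSet_Ioi f1 f2,
    setIntegral_congr_fun measurableSet_Ioc e1, setIntegral_congr_fun measurableSet_Ioi e2,
    integral_sub (f := fun v : ℝ => 1 / 2 * (v ^ (p - 2) * Real.exp (-v)) +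
      1 / 2 * (v ^ (p - 2) * Real.exp v)) (k1.add k2) k3, integral_add k1 k2, integral_add k4 k5,
    integral_const_mul, integral_const_mul, integral_const_mul, integral_const_mul,
    integral_const_mul, j2, integral_Ioc_rpow (by linarith) h0, extremalNumerator, hG, ← hgam,
    intervalIntegral.integral_of_le h0, ← hZ, sub_add_cancel]
  have : p ≠ 0 := by linarith
  field_simp
  ring

theorem extremalRate_mul_eq {t : ℝ} (h1 : t ≤ 1) :
    extremalRate t * (Real.exp t * (2 - t)) = 2 := by
  rw [extremalRate, Real.exp_neg]
  have : 2 - t ≠ 0 := by linarith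
  field_simp

theorem extremalStopLoss_eq_rescaled {t : ℝ} (h1 : t ≤ 1) (x : ℝ) :
    extremalStopLoss t x = rescaledStopLoss t (extremalRate t * x) := by
  rw [extremalStopLoss, rescaledStopLoss]
  have : x = extremalRate t * x * (Real.exp t * (2 - t)) / 2 := by
    linear_combination (-x / 2) * extremalRate_mul_eq h1
  split_ifs
  · rw [← this]
  · rfl

/-- The rescaling `v = βx` contributes `β^(1-p)`, and `β = 2/(e^t (2-t))` explains the normalising
power in `extremalMoment`. -/
theorem stopLossMoment_extremal (hp : 2 ≤ p) {t : ℝ} (h0 : 0 ≤ t) (h1 : t ≤ 1) :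
    stopLossMoment p (extremalStopLoss t) = ENNReal.ofReal (extremalMoment p t) := by
  obtain ⟨i1, i2⟩ := integrableOn_and_integral_rescaled hp h0 h1
  have hβ := extremalRate_pos h1
  have hβZ := extremalRate_mul_eq h1
  have hZ : 0 < Real.exp t * (2 - t) := mul_pos (Real.exp_pos t) (by linarith)
  set β := extremalRate t with hβd
  have hpt : EqOn (fun x : ℝ => β ^ (2 - p) * ((β * x) ^ (p - 2) * rescaledStopLoss t (β * x)))
      (fun x : ℝ => x ^ (p - 2) * extremalStopLoss t x) (Ioi 0) := by
    intro x hx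
    beta_reduce
    rw [extremalStopLoss_eq_rescaled h1, ← hβd, Real.mul_rpow hβ.le (le_of_lt hx), ← mul_assoc,
      ← mul_assoc, ← Real.rpow_add hβ]
    simp
  have hi : IntegrableOn (fun x : ℝ => (β * x) ^ (p - 2) * rescaledStopLoss t (β * x)) (Ioi 0) := by
    refine (integrableOn_Ioi_comp_mul_left_iff
      (fun v : ℝ => v ^ (p - 2) * rescaledStopLoss t v) 0 hβ).2 ?_
    rwa [mul_zero]
  have hi2 : IntegrableOn (fun x : ℝ => x ^ (p - 2) * extremalStopLoss t x) (Ioi 0) :=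
    IntegrableOn.congr_fun (Integrable.const_mul hi _) hpt measurableSet_Ioi
  have hnn : ∀ᵐ x ∂(volume.restrict (Ioi (0 : ℝ))), 0 ≤ x ^ (p - 2) * extremalStopLoss t x := by
    refine (ae_restrict_iff' measurableSet_Ioi).2 (.of_forall fun x hx => ?_)
    exact mul_nonneg (Real.rpow_nonneg (le_of_lt hx) _) ((isStopLoss_extremal h0 h1).nonneg x hx)
  rw [stopLossMoment, stopLossIntegral]
  simp only [stopLossKernel, if_pos (by linarith : 1 < p)]
  rw [← ofReal_integral_eq_lintegral_ofReal hi2 hnn, ← ENNReal.ofReal_mul (abs_nonneg _),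
    ← setIntegral_congr_fun measurableSet_Ioi hpt, integral_const_mul,
    integral_comp_mul_left_Ioi (fun v : ℝ => v ^ (p - 2) * rescaledStopLoss t v) 0 hβ, mul_zero,
    smul_eq_mul, abs_of_nonneg (by nlinarith)]
  congr 1
  have e1 : β = 2 / (Real.exp t * (2 - t)) := by rw [eq_div_iff hZ.ne', hβZ]
  have e2 : β ^ (2 - p) * β⁻¹ = (Real.exp t * (2 - t)) ^ (p - 1) / 2 ^ p * 2 := by
    rw [← Real.rpow_neg_one β, ← Real.rpow_add hβ, e1, show 2 - p + -1 = -(p - 1) by ring,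
      Real.rpow_neg (by positivity), Real.div_rpow zero_le_two hZ.le, inv_div,
      Real.rpow_sub_one two_ne_zero]
    field_simp
  rw [extremalMoment]
  linear_combination (p * (p - 1) * ∫ v in Ioi 0, v ^ (p - 2) * rescaledStopLoss t v) * e2 +
    ((Real.exp t * (2 - t)) ^ (p - 1) / 2 ^ p * 2) * i2

theorem stopLossMoment_extremal_le_max (hp : 2.94 ≤ p) {t : ℝ} (ht : t ∈ Icc (0 : ℝ) 1) :
    stopLossMoment p (extremalStopLoss t) ≤
      max (stopLossMoment p fun x => Real.exp (-x)) (stopLossMoment p (extremalStopLoss 1)) := by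
  have hp2 : 2 ≤ p := by linarith
  have e : (stopLossMoment p fun x => Real.exp (-x)) = stopLossMoment p (extremalStopLoss 0) :=
    le_antisymm
      (stopLossMoment_mono (.inr (by linarith)) fun x hx => (extremalStopLoss_zero hx).ge)
      (stopLossMoment_mono (.inr (by linarith)) fun x hx => (extremalStopLoss_zero hx).le)
  rw [e, stopLossMoment_extremal hp2 ht.1 ht.2, stopLossMoment_extremal hp2 le_rfl zero_le_one,
    stopLossMoment_extremal hp2 zero_le_one le_rfl, ← ENNReal.ofReal_max]
  exact ENNReal.ofReal_le_ofReal (extremalMoment_le_max hp ht)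

end

/-! ### The double-exponential and the centred exponential laws. -/

section

theorem nullSingletonClass_map {μ : Measure ℝ} [NullSingletonClass μ] {f : ℝ → ℝ}
    (hf : Measurable f) (hinj : Function.Injective f) : NullSingletonClass (μ.map f) where
  measure_singleton x := by
    rw [Measure.map_apply hf (measurableSet_singleton x)]
    exact (subsingleton_singleton.preimage hinj).measure_zero μ

theorem expMeasure_one : expMeasure 1 =
    (volume.restrict (Ioi (0 : ℝ))).withDensity fun x => ENNReal.ofReal (Real.exp (-x)) := by
  rw [Measure.restrict_congr_set Ioi_ae_eq_Ici, ← withDensity_indicator measurableSet_Ici,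
    expMeasure, gammaMeasure]
  congr 1
  funext x
  change exponentialPDF 1 x = _
  rw [exponentialPDF_eq, indicator_apply]
  by_cases hx : 0 ≤ x <;> simp [hx]

instance : IsProbabilityMeasure (expMeasure 1) := isProbabilityMeasure_expMeasure one_pos

instance : NullSingletonClass (expMeasure 1) := by rw [expMeasure_one]; infer_instance

theorem integral_expMeasure_one (f : ℝ → ℝ) :
    ∫ y, f y ∂expMeasure 1 = ∫ y in Ioi 0, Real.exp (-y) * f y := by
  rw [expMeasure_one, integral_withDensity_eq_integral_toReal_smul (by fun_prop) (by simp)]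
  simp [Real.exp_nonneg]

theorem integrable_expMeasure_one_iff {f : ℝ → ℝ} :
    Integrable f (expMeasure 1) ↔ IntegrableOn (fun y => Real.exp (-y) * f y) (Ioi 0) := by
  rw [expMeasure_one, integrable_withDensity_iff_integrable_smul' (by fun_prop) (by simp)]
  simp [Real.exp_nonneg, IntegrableOn]

theorem integrableOn_and_integral_sub_mul_exp (b : ℝ) :
    IntegrableOn (fun y : ℝ => Real.exp (-y) * (y - b)) (Ioi b) ∧
      ∫ y in Ioi b, Real.exp (-y) * (y - b) = Real.exp (-b) := by
  -- An explicit primitive vanishing at infinity.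
  have hd : ∀ y ∈ Ici b, HasDerivAt (fun y : ℝ => -(Real.exp (-y) * (y - b + 1)))
      (Real.exp (-y) * (y - b)) y := by
    intro y _
    have h1 : HasDerivAt (fun y : ℝ => Real.exp (-y)) (Real.exp (-y) * -1) y :=
      (hasDerivAt_neg y).exp
    have h2 : HasDerivAt (fun y : ℝ => y - b + 1) 1 y :=
      ((hasDerivAt_id y).sub_const b).add_const 1
    convert! (h1.mul h2).neg using 1
    ring
  have hl : Tendsto (fun y : ℝ => -(Real.exp (-y) * (y - b + 1))) atTop (𝓝 0) := by
    have h1 : Tendsto (fun y : ℝ => y * Real.exp (-y)) atTop (𝓝 0) := by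
      simpa using Real.tendsto_pow_mul_exp_neg_atTop_nhds_zero 1
    have h2 := (h1.add (Real.tendsto_exp_neg_atTop_nhds_zero.const_mul (1 - b))).neg
    simp only [mul_zero, add_zero, neg_zero] at h2
    refine h2.congr fun y => ?_
    ring
  have hi := integrableOn_Ioi_deriv_of_nonneg' hd
    (fun y hy => mul_nonneg (Real.exp_nonneg _) (sub_nonneg.2 (le_of_lt hy))) hl
  refine ⟨hi, ?_⟩
  rw [integral_Ioi_of_hasDerivAt_of_tendsto' hd hi hl]
  simp

theorem integrable_id_expMeasure_one : Integrable (fun y => y) (expMeasure 1) := by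
  rw [integrable_expMeasure_one_iff]
  simpa using (integrableOn_and_integral_sub_mul_exp 0).1

theorem integral_id_expMeasure_one : ∫ y, y ∂expMeasure 1 = 1 := by
  rw [integral_expMeasure_one]
  simpa using (integrableOn_and_integral_sub_mul_exp 0).2

theorem upperStopLoss_expMeasure_one {b : ℝ} (hb : 0 ≤ b) :
    upperStopLoss (expMeasure 1) b = Real.exp (-b) := by
  have h : ∀ y ∈ Ioi 0 \ Ioi b, Real.exp (-y) * max (y - b) 0 = 0 := by
    intro y hy
    rw [max_eq_right, mul_zero]
    simpa using hy.2
  rw [upperStopLoss, integral_expMeasure_one, ← (integrableOn_and_integral_sub_mul_exp b).2,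
    setIntegral_eq_of_subset_of_forall_sdiff_eq_zero measurableSet_Ioi (Ioi_subset_Ioi hb) h]
  refine setIntegral_congr_fun measurableSet_Ioi fun y hy => ?_
  rw [max_eq_left (sub_nonneg.2 (le_of_lt hy))]

theorem lintegral_comp_abs {f : ℝ → ℝ≥0∞} (hf : Measurable f) :
    ∫⁻ x, f |x| = 2 * ∫⁻ x in Ioi 0, f x := by
  have h1 : ∫⁻ x in Ioi 0, f |x| = ∫⁻ x in Ioi 0, f x :=
    setLIntegral_congr_fun measurableSet_Ioi fun x hx => by rw [abs_of_pos hx]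
  have h2 : ∫⁻ x in (Ioi (0 : ℝ))ᶜ, f |x| = ∫⁻ x in Ioi 0, f x := by
    rw [compl_Ioi, ← setLIntegral_congr Iio_ae_eq_Iic,
      ← (Measure.measurePreserving_neg (volume : Measure ℝ)).setLIntegral_comp_preimage
        measurableSet_Ioi hf, neg_preimage, neg_Ioi, neg_zero]
    exact setLIntegral_congr_fun measurableSet_Iio fun x hx => by rw [abs_of_neg hx]
  rw [← lintegral_add_compl _ (measurableSet_Ioi (a := (0 : ℝ))), h1, h2, two_mul]

/-- It reduces the even functionals of `D` needed later to the exponential law; in particular its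
stop-loss transform is `e^{-x}`. -/
theorem map_abs_doubleExp : doubleExp.map (fun x => |x|) = expMeasure 1 := by
  ext s hs
  have hm : Measurable (fun x : ℝ => |x|) := by fun_prop
  rw [Measure.map_apply hm hs, doubleExp, withDensity_apply _ (hm hs), ← lintegral_indicator (hm hs),
    expMeasure_one, withDensity_apply _ hs, ← lintegral_indicator hs]
  have h := lintegral_comp_abs (f := s.indicator fun x => ENNReal.ofReal (Real.exp (-x) / 2))
    (Measurable.indicator (by fun_prop) hs)
  have e : (fun x : ℝ => s.indicator (fun x => ENNReal.ofReal (Real.exp (-x) / 2)) |x|) =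
      ((fun x : ℝ => |x|) ⁻¹' s).indicator fun x => ENNReal.ofReal (Real.exp (-|x|) / 2) := by
    funext x
    by_cases hx : |x| ∈ s <;> simp [hx]
  rw [e] at h
  rw [h, ← lintegral_const_mul _ (Measurable.indicator (by fun_prop) hs)]
  refine lintegral_congr fun x => ?_
  by_cases hx : x ∈ s
  · rw [indicator_of_mem hx, indicator_of_mem hx, ← ENNReal.ofReal_ofNat,
      ← ENNReal.ofReal_mul (by norm_num)]
    congr 1; ring
  · simp [hx]

instance : IsProbabilityMeasure doubleExp := by
  refine ⟨?_⟩
  have h : (doubleExp.map fun x => |x|) univ = 1 := by rw [map_abs_doubleExp]; exact measure_univ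
  rwa [Measure.map_apply (by fun_prop) MeasurableSet.univ, preimage_univ] at h

instance : NullSingletonClass doubleExp := by rw [doubleExp]; infer_instance

theorem integrable_id_doubleExp : Integrable (fun y => y) doubleExp := by
  have h := integrable_id_expMeasure_one
  rw [← map_abs_doubleExp, integrable_map_measure (by fun_prop) (by fun_prop)] at h
  exact (integrable_norm_iff (f := fun y : ℝ => y) (by fun_prop)).1 h

theorem integral_abs_doubleExp : ∫ y, |y| ∂doubleExp = 1 := by
  rw [← integral_id_expMeasure_one, ← map_abs_doubleExp, integral_map (by fun_prop) (by fun_prop)]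

theorem map_neg_withDensity {f : ℝ → ℝ≥0∞} (hf : Measurable f) :
    (volume.withDensity f).map Neg.neg = volume.withDensity fun x => f (-x) := by
  ext s hs
  have h := (Measure.measurePreserving_neg (volume : Measure ℝ)).setLIntegral_comp_preimage hs
    (hf.comp measurable_neg)
  simp only [Function.comp_apply, neg_neg] at h
  rw [Measure.map_apply measurable_neg hs, withDensity_apply _ (measurable_neg hs),
    withDensity_apply _ hs, h]

theorem map_neg_doubleExp : doubleExp.map Neg.neg = doubleExp := by
  rw [doubleExp, map_neg_withDensity (by fun_prop)]
  simp only [abs_neg]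

theorem integral_id_doubleExp : ∫ y, y ∂doubleExp = 0 := by
  have h : ∫ y, y ∂doubleExp = ∫ y, -y ∂doubleExp := by
    conv_lhs => rw [← map_neg_doubleExp, integral_map (by fun_prop) (by fun_prop)]
  rw [integral_neg] at h
  linarith

theorem stopLoss_doubleExp {x : ℝ} (hx : 0 ≤ x) : stopLoss doubleExp x = Real.exp (-x) := by
  rw [← upperStopLoss_expMeasure_one hx, upperStopLoss, ← map_abs_doubleExp,
    integral_map (by fun_prop) (by fun_prop), stopLoss]

theorem isLogConcave_doubleExp : IsLogConcave (fun x : ℝ => x) doubleExp := by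
  refine ⟨fun x => ((|x| + Real.log 2 : ℝ) : EReal), ⟨fun x => EReal.coe_ne_bot _, ?_⟩, ?_⟩
  · intro x y a b ha hb hab
    norm_cast
    have h : |a * x + b * y| ≤ a * |x| + b * |y| := by
      refine (abs_add_le _ _).trans_eq ?_
      rw [abs_mul, abs_mul, abs_of_pos ha, abs_of_pos hb]
    calc |a * x + b * y| + Real.log 2 ≤ a * |x| + b * |y| + (a + b) * Real.log 2 := by
          rw [hab]; linarith
      _ = _ := by ring
  · have e : doubleExp =
        volume.withDensity fun x : ℝ => EReal.exp (-((|x| + Real.log 2 : ℝ) : EReal)) := by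
      rw [doubleExp]
      congr 1
      funext x
      rw [← EReal.coe_neg, EReal.exp_coe, neg_add, Real.exp_add, Real.exp_neg (Real.log 2),
        Real.exp_log two_pos, div_eq_mul_inv]
    rw [← e]
    exact HasLaw.id

/-- The potential of the centred standard exponential law. -/
def centredExpPotential (x : ℝ) : EReal := if 0 < x + 1 then ((x + 1 : ℝ) : EReal) else ⊤

theorem isConvexPotential_centredExpPotential : IsConvexPotential centredExpPotential where
  ne_bot x := by
    rw [centredExpPotential]
    split_ifs
    exacts [EReal.coe_ne_bot _, top_ne_bot]
  convex x y a b ha hb hab := by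
    have nb : ∀ {c z : ℝ}, 0 < c → (c : EReal) * centredExpPotential z ≠ ⊥ := by
      intro c z hc
      rw [centredExpPotential]
      split_ifs
      · rw [← EReal.coe_mul]; exact EReal.coe_ne_bot _
      · rw [EReal.mul_top_of_pos (by exact_mod_cast hc)]; exact top_ne_bot
    by_cases hx : 0 < x + 1
    · by_cases hy : 0 < y + 1
      · have h : 0 < a * x + b * y + 1 := by
          have := mul_pos ha hx; have := mul_pos hb hy; nlinarith
        rw [centredExpPotential, centredExpPotential, centredExpPotential, if_pos hx, if_pos hy,
          if_pos h]
        norm_cast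
        nlinarith
      · have : centredExpPotential y = ⊤ := if_neg hy
        rw [this, EReal.mul_top_of_pos (by exact_mod_cast hb), EReal.add_top_of_ne_bot (nb ha)]
        exact le_top
    · have : centredExpPotential x = ⊤ := if_neg hx
      rw [this, EReal.mul_top_of_pos (by exact_mod_cast ha), EReal.top_add_of_ne_bot (nb hb)]
      exact le_top

theorem isLogConcave_sub_one_expMeasure : IsLogConcave (fun x : ℝ => x - 1) (expMeasure 1) := by
  refine ⟨centredExpPotential, isConvexPotential_centredExpPotential, by fun_prop, ?_⟩
  ext s hs
  have hm : Measurable fun x : ℝ => x - 1 := by fun_prop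
  have hg : Measurable fun x => EReal.exp (-centredExpPotential x) :=
    EReal.measurable_exp.comp isConvexPotential_centredExpPotential.measurable.neg
  rw [Measure.map_apply hm hs, withDensity_apply _ hs,
    ← (measurePreserving_sub_right volume (1 : ℝ)).setLIntegral_comp_preimage hs hg,
    expMeasure_one, ← withDensity_indicator measurableSet_Ioi, withDensity_apply _ (hm hs)]
  refine lintegral_congr fun x => ?_
  rw [centredExpPotential, sub_add_cancel, indicator_apply]
  by_cases hx : 0 < x
  · rw [if_pos hx, if_pos (mem_Ioi.2 hx), ← EReal.coe_neg, EReal.exp_coe]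
  · simp [hx]

theorem hasMeanZero_sub_one_expMeasure : HasMeanZero (fun x : ℝ => x - 1) (expMeasure 1) := by
  refine ⟨integrable_id_expMeasure_one.sub (integrable_const 1), ?_⟩
  rw [integral_sub integrable_id_expMeasure_one (integrable_const 1), integral_id_expMeasure_one]
  simp

/-- The law of the centred standard exponential variable, normalised by `𝔼 |Y| = 1`. -/
def oneSidedLaw : Measure ℝ := (expMeasure 1).map fun y => Real.exp 1 / 2 * (y - 1)

instance : IsProbabilityMeasure oneSidedLaw := Measure.isProbabilityMeasure_map (by fun_prop)

instance : NullSingletonClass oneSidedLaw :=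
  nullSingletonClass_map (by fun_prop) fun x y h => by
    have h0 : Real.exp 1 / 2 ≠ 0 := by positivity
    simpa [h0] using h

theorem integrable_id_oneSidedLaw : Integrable (fun y => y) oneSidedLaw := by
  rw [oneSidedLaw, integrable_map_measure (by fun_prop) (by fun_prop)]
  exact hasMeanZero_sub_one_expMeasure.1.const_mul _

theorem integral_id_oneSidedLaw : ∫ y, y ∂oneSidedLaw = 0 := by
  rw [oneSidedLaw, integral_map (by fun_prop) (by fun_prop), integral_const_mul,
    hasMeanZero_sub_one_expMeasure.2, mul_zero]

theorem upperStopLoss_oneSidedLaw (x : ℝ) : upperStopLoss oneSidedLaw x =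
    Real.exp 1 / 2 * upperStopLoss (expMeasure 1) (1 + x / (Real.exp 1 / 2)) := by
  have h0 : 0 < Real.exp 1 / 2 := by positivity
  rw [upperStopLoss, oneSidedLaw, integral_map (by fun_prop) (by fun_prop), upperStopLoss,
    ← integral_const_mul]
  congr 1
  funext y
  rw [mul_max_of_nonneg _ _ h0.le, mul_zero]
  congr 1
  field_simp
  ring

theorem upperStopLoss_of_nonpos_expMeasure {b : ℝ} (hb : b ≤ 0) :
    upperStopLoss (expMeasure 1) b = 1 - b := by
  have h : ∀ᵐ y ∂expMeasure 1, max (y - b) 0 = y - b := by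
    rw [expMeasure_one]
    refine (withDensity_absolutelyContinuous _ _).ae_le ?_
    filter_upwards [ae_restrict_mem measurableSet_Ioi] with y hy
    rw [max_eq_left]
    have : 0 < y := hy
    linarith
  rw [upperStopLoss, integral_congr_ae h, integral_sub integrable_id_expMeasure_one
    (integrable_const b), integral_id_expMeasure_one]
  simp

/-- This identifies the end `t = 1` of the family. At `x = 0` it also gives `𝔼|Y| = 1`, so that
`e/2` is the right normalisation. -/
theorem stopLoss_oneSidedLaw {x : ℝ} (hx : 0 ≤ x) :
    stopLoss oneSidedLaw x = extremalStopLoss 1 x := by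
  have hr : extremalRate 1 * x = x / (Real.exp 1 / 2) := by
    rw [extremalRate, Real.exp_neg]; field_simp; ring
  have h0 : 0 < Real.exp 1 / 2 := by positivity
  rw [stopLoss_eq_add integrable_id_oneSidedLaw hx,
    upperStopLoss_map_neg integrable_id_oneSidedLaw integral_id_oneSidedLaw,
    upperStopLoss_oneSidedLaw, upperStopLoss_oneSidedLaw, extremalStopLoss, hr, neg_div]
  set a := x / (Real.exp 1 / 2) with ha
  have hxa : x = Real.exp 1 / 2 * a := by rw [ha]; field_simp
  have ha0 : 0 ≤ a := by positivity
  have e1 : Real.exp 1 / 2 * Real.exp (-(1 + a)) = Real.exp (-a) / 2 := by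
    rw [neg_add, Real.exp_add, Real.exp_neg 1]; field_simp
  have e2 : Real.exp 1 / 2 * Real.exp (-(1 + -a)) = Real.exp a / 2 := by
    rw [neg_add, neg_neg, Real.exp_add, Real.exp_neg 1]; field_simp
  rw [upperStopLoss_expMeasure_one (by linarith), e1]
  split_ifs with h
  · rw [upperStopLoss_expMeasure_one (by linarith), e2, Real.cosh_eq]; ring
  · rw [upperStopLoss_of_nonpos_expMeasure (by linarith)]
    simp only [sub_self]
    rw [hxa]; ring

theorem integral_abs_oneSidedLaw : ∫ y, |y| ∂oneSidedLaw = 1 := by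
  have h := stopLoss_oneSidedLaw le_rfl
  simpa [stopLoss, extremalStopLoss] using h

theorem stopLossMoment_extremal_one {p : ℝ} (hp0 : p ≠ 0) (hp1 : p ≠ 1) :
    stopLossMoment p (extremalStopLoss 1) =
      ∫⁻ y, ‖Real.exp 1 / 2 * (y - 1)‖ₑ ^ p ∂expMeasure 1 := by
  have h := lintegral_enorm_rpow_eq_stopLossMoment integrable_id_oneSidedLaw
    integral_abs_oneSidedLaw hp0 hp1
  rw [oneSidedLaw, lintegral_map (by fun_prop) (by fun_prop), ← oneSidedLaw] at h
  rw [h, stopLossMoment, stopLossMoment, stopLossIntegral, stopLossIntegral]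
  congr 1
  exact setLIntegral_congr_fun measurableSet_Ioi fun x hx => by
    rw [stopLoss_oneSidedLaw (le_of_lt hx)]

theorem lintegral_enorm_rpow_doubleExp {p : ℝ} (hp : -1 < p) :
    ∫⁻ y, ‖y‖ₑ ^ p ∂doubleExp = ENNReal.ofReal (Real.Gamma (p + 1)) := by
  have h1 : ∫⁻ y, ‖y‖ₑ ^ p ∂doubleExp = ∫⁻ y, ‖y‖ₑ ^ p ∂expMeasure 1 := by
    rw [← map_abs_doubleExp, lintegral_map (by fun_prop) (by fun_prop)]
    simp
  have h2 : IntegrableOn (fun x : ℝ => Real.exp (-x) * x ^ (p + 1 - 1)) (Ioi 0) :=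
    Real.GammaIntegral_convergent (by linarith)
  rw [h1, expMeasure_one, lintegral_withDensity_eq_lintegral_mul _ (by fun_prop) (by fun_prop),
    Real.Gamma_eq_integral (by linarith), ofReal_integral_eq_lintegral_ofReal h2]
  · refine setLIntegral_congr_fun measurableSet_Ioi fun x hx => ?_
    have hx : 0 < x := hx
    simp only [Pi.mul_apply]
    rw [Real.enorm_eq_ofReal hx.le, ENNReal.ofReal_rpow_of_pos hx,
      ← ENNReal.ofReal_mul (Real.exp_nonneg _), add_sub_cancel_right]
  · filter_upwards [ae_restrict_mem measurableSet_Ioi] with x hx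
    have hx : 0 < x := hx
    simp only [Pi.zero_apply]
    positivity

/-- The moment formula is read backwards for an actual law with transform `e^{-x}`, which avoids
computing the kernel integrals for each range of `p`. -/
theorem stopLossMoment_exp {p : ℝ} (hp : -1 < p) (hp0 : p ≠ 0) (hp1 : p ≠ 1) :
    stopLossMoment p (fun x => Real.exp (-x)) = ENNReal.ofReal (Real.Gamma (p + 1)) := by
  rw [← lintegral_enorm_rpow_doubleExp hp, lintegral_enorm_rpow_eq_stopLossMoment
    integrable_id_doubleExp integral_abs_doubleExp hp0 hp1, stopLossMoment, stopLossMoment,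
    stopLossIntegral, stopLossIntegral]
  congr 1
  exact setLIntegral_congr_fun measurableSet_Ioi fun x hx => by
    rw [stopLoss_doubleExp (le_of_lt hx)]

end

/-! ### Rational bounds for the Gamma function. -/

/-- The product of `q * (a + k) + r` over `k < 2 ^ m`, by binary splitting. -/
def blockProd (q r : ℕ) : ℕ → ℕ → ℕ
  | 0, a => q * a + r
  | m + 1, a => blockProd q r m a * blockProd q r m (a + 2 ^ m)

theorem blockProd_eq_prod (q r m a : ℕ) :
    blockProd q r m a = ∏ k ∈ Finset.range (2 ^ m), (q * (a + k) + r) := by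
  induction m generalizing a with
  | zero => simp [blockProd]
  | succ m ih =>
    rw [blockProd, ih, ih, pow_succ, mul_two, Finset.prod_range_add]
    simp only [add_assoc]

theorem blockProd_pos (q : ℕ) {r : ℕ} (hr : 0 < r) (m a : ℕ) : 0 < blockProd q r m a := by
  rw [blockProd_eq_prod]
  exact Finset.prod_pos fun k _ => by positivity

theorem Gamma_add_nat {x : ℝ} (hx : 0 < x) (n : ℕ) :
    Real.Gamma (x + n) = Real.Gamma x * ∏ k ∈ Finset.range n, (x + k) := by
  induction n with
  | zero => simp
  | succ n ih =>
    rw [Nat.cast_succ, ← add_assoc, Real.Gamma_add_one (by positivity), ih, Finset.prod_range_succ]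
    ring

/-- `Γ(x) (x)_N` for `x = r / q` and `N = 2 ^ m`, with the rising factorial cleared of
denominators. -/
theorem Gamma_add_two_pow {q r : ℕ} (hq : 0 < q) (hr : 0 < r) (m : ℕ) :
    Real.Gamma (r / q + (2 ^ m : ℕ)) * q ^ 2 ^ m =
      Real.Gamma (r / q) * (blockProd q r m 0 : ℝ) := by
  rw [Gamma_add_nat (by positivity), blockProd_eq_prod, mul_assoc]
  congr 1
  have h : (q : ℝ) ^ 2 ^ m = ∏ _k ∈ Finset.range (2 ^ m), (q : ℝ) := by simp
  rw [h, ← Finset.prod_mul_distrib]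
  push_cast
  refine Finset.prod_congr rfl fun k _ => ?_
  have : (q : ℝ) ≠ 0 := by positivity
  field_simp
  ring

theorem factorial_two_pow (q m : ℕ) :
    ((2 ^ m).factorial : ℝ) * q ^ 2 ^ m = (blockProd q q m 0 : ℝ) := by
  rw [blockProd_eq_prod, ← Finset.prod_range_add_one_eq_factorial]
  have h : (q : ℝ) ^ 2 ^ m = ∏ _k ∈ Finset.range (2 ^ m), (q : ℝ) := by simp
  rw [h]
  push_cast
  rw [← Finset.prod_mul_distrib]
  refine Finset.prod_congr rfl fun k _ => ?_
  ring

/-- Log-convexity of `Γ` between `n` and `n + 1`. -/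
theorem Gamma_nat_add_le {n : ℕ} (hn : 0 < n) {x : ℝ} (h0 : 0 < x) (h1 : x < 1) :
    Real.Gamma (x + n) ≤ n.factorial * (n : ℝ) ^ (x - 1) := by
  have hn' : (0 : ℝ) < n := by exact_mod_cast hn
  have h := Real.Gamma_mul_add_mul_le_rpow_Gamma_mul_rpow_Gamma (s := n) (t := n + 1) (a := 1 - x)
    (b := x) hn' (by positivity) (by linarith) h0 (by ring)
  have hg := Real.Gamma_pos_of_pos hn'
  have e : (n.factorial : ℝ) = n * Real.Gamma n := by
    rw [← Real.Gamma_add_one hn'.ne', Real.Gamma_nat_eq_factorial]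
  rw [show (1 - x) * n + x * (n + 1) = x + n by ring, Real.Gamma_add_one hn'.ne',
    Real.mul_rpow hn'.le hg.le, mul_left_comm, ← Real.rpow_add hg, sub_add_cancel,
    Real.rpow_one] at h
  rw [e, Real.rpow_sub_one hn'.ne']
  refine h.trans_eq ?_
  field_simp

/-- Log-convexity between `x + n` and `x + n + 1`, with `n + 1` as the intermediate point. -/
theorem le_Gamma_nat_add {n : ℕ} (hn : 0 < n) {x : ℝ} (h0 : 0 < x) (h1 : x < 1) :
    n.factorial * (x + n) ^ (x - 1) ≤ Real.Gamma (x + n) := by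
  have hn' : (0 : ℝ) < n := by exact_mod_cast hn
  have hxn : 0 < x + n := by positivity
  have h := Real.Gamma_mul_add_mul_le_rpow_Gamma_mul_rpow_Gamma (s := x + n) (t := x + n + 1)
    (a := x) (b := 1 - x) hxn (by positivity) h0 (by linarith) (by ring)
  have hg := Real.Gamma_pos_of_pos hxn
  rw [show x * (x + n) + (1 - x) * (x + n + 1) = n + 1 by ring, Real.Gamma_nat_eq_factorial,
    Real.Gamma_add_one hxn.ne', Real.mul_rpow hxn.le hg.le, mul_left_comm, ← Real.rpow_add hg,
    add_sub_cancel, Real.rpow_one] at h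
  calc (n.factorial : ℝ) * (x + n) ^ (x - 1)
      ≤ (x + n) ^ (1 - x) * Real.Gamma (x + n) * (x + n) ^ (x - 1) := by gcongr
    _ = (x + n) ^ (1 - x + (x - 1)) * Real.Gamma (x + n) := by rw [Real.rpow_add hxn]; ring
    _ = Real.Gamma (x + n) := by simp

theorem Gamma_add_three {x : ℝ} (hx : 0 < x) :
    Real.Gamma (x + 3) = x * (x + 1) * (x + 2) * Real.Gamma x := by
  have h := Gamma_add_nat hx 3
  norm_num [Finset.prod_range_succ] at h
  rw [h]; ring

/-- With `N = 2^m` and `x = r/q`, the hypothesis states `N!/(x)_N ≤ A/B` with denominators cleared,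
`(x)_N` being the rising factorial. Then `Γ(x) ≤ (A/B) N^(x-1)`, and `N` a power of two leaves only
`log 2` to be estimated. -/
theorem Gamma_add_three_le {q r m A B : ℕ} (hr : 0 < r) (hrq : r < q) (hB : 0 < B)
    (h : blockProd q q m 0 * B ≤ A * blockProd q r m 0) :
    Real.Gamma (r / q + 3) ≤ r / q * (r / q + 1) * (r / q + 2) * (A / B) *
      Real.exp (-(m * (1 - r / q) * Real.log 2)) := by
  have hq : 0 < q := hr.trans hrq
  have hq' : (0 : ℝ) < q := by exact_mod_cast hq
  have hr' : (0 : ℝ) < r := by exact_mod_cast hr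
  have hB' : (0 : ℝ) < B := by exact_mod_cast hB
  have hx1 : (r : ℝ) / q < 1 := by rw [div_lt_one hq']; exact_mod_cast hrq
  have hx0 : (0 : ℝ) < r / q := by positivity
  have h1 := Gamma_nat_add_le (n := 2 ^ m) (by positivity) hx0 hx1
  have h2 := Gamma_add_two_pow hq hr m
  have h3 := factorial_two_pow q m
  have h4 : (blockProd q q m 0 : ℝ) * B ≤ A * blockProd q r m 0 := by exact_mod_cast h
  have h5 : (((2 ^ m : ℕ) : ℝ)) ^ ((r : ℝ) / q - 1) =
      Real.exp (-(m * (1 - r / q) * Real.log 2)) := by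
    rw [Real.rpow_def_of_pos (by positivity)]
    push_cast
    rw [Real.log_pow]
    congr 1; ring
  rw [h5] at h1
  set E := Real.exp (-(m * (1 - r / q) * Real.log 2)) with hE
  have hE0 : 0 < E := Real.exp_pos _
  have hb : (0 : ℝ) < blockProd q r m 0 := by
    exact_mod_cast blockProd_pos q hr m 0
  rw [Gamma_add_three hx0, mul_assoc ((r : ℝ) / q * (r / q + 1) * (r / q + 2))]
  refine mul_le_mul_of_nonneg_left ?_ (by positivity)
  have h6 : Real.Gamma (r / q) * (blockProd q r m 0 : ℝ) ≤
      A / B * E * (blockProd q r m 0 : ℝ) := by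
    rw [← h2]
    calc Real.Gamma (r / q + (2 ^ m : ℕ)) * q ^ 2 ^ m
        ≤ ((2 ^ m).factorial * E) * q ^ 2 ^ m := by gcongr
      _ = blockProd q q m 0 * B / B * E := by rw [← h3]; field_simp
      _ ≤ A * blockProd q r m 0 / B * E := by gcongr
      _ = _ := by ring
  exact le_of_mul_le_mul_right h6 hb

theorem le_Gamma_add_three {q r m A B : ℕ} (hr : 0 < r) (hrq : r < q) (hB : 0 < B)
    (h : A * blockProd q r m 0 ≤ blockProd q q m 0 * B) :
    r / q * (r / q + 1) * (r / q + 2) * (A / B) *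
      Real.exp (-((1 - r / q) * (m * Real.log 2 + 1 / 2 ^ m))) ≤ Real.Gamma (r / q + 3) := by
  have hq : 0 < q := hr.trans hrq
  have hq' : (0 : ℝ) < q := by exact_mod_cast hq
  have hr' : (0 : ℝ) < r := by exact_mod_cast hr
  have hB' : (0 : ℝ) < B := by exact_mod_cast hB
  have hx1 : (r : ℝ) / q < 1 := by rw [div_lt_one hq']; exact_mod_cast hrq
  have hx0 : (0 : ℝ) < r / q := by positivity
  have h1 := le_Gamma_nat_add (n := 2 ^ m) (by positivity) hx0 hx1
  have h2 := Gamma_add_two_pow hq hr m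
  have h3 := factorial_two_pow q m
  have h4 : (A : ℝ) * blockProd q r m 0 ≤ blockProd q q m 0 * B := by exact_mod_cast h
  have h5 : Real.exp (-((1 - r / q) * (m * Real.log 2 + 1 / 2 ^ m))) ≤
      ((r : ℝ) / q + (2 ^ m : ℕ)) ^ ((r : ℝ) / q - 1) := by
    rw [Real.rpow_def_of_pos (by positivity), Real.exp_le_exp]
    -- As `x < 1`, one has `x + N ≤ N(1 + 1/N)`, so replacing `x + N` by `N` costs at most `1/N` in
    -- the logarithm.
    have e1 : (r : ℝ) / q + (2 ^ m : ℕ) ≤ 2 ^ m * (1 + 1 / 2 ^ m) := by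
      push_cast
      rw [mul_add, mul_one_div_cancel (by positivity)]
      linarith
    have e2 : Real.log (r / q + (2 ^ m : ℕ)) ≤ m * Real.log 2 + 1 / 2 ^ m := by
      refine (Real.log_le_log (by positivity) e1).trans ?_
      rw [Real.log_mul (by positivity) (by positivity), Real.log_pow]
      have := Real.log_le_sub_one_of_pos (show (0 : ℝ) < 1 + 1 / 2 ^ m by positivity)
      linarith
    nlinarith
  set E := Real.exp (-((1 - r / q) * (m * Real.log 2 + 1 / 2 ^ m))) with hE
  have hE0 : 0 < E := Real.exp_pos _
  have hb : (0 : ℝ) < blockProd q r m 0 := by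
    exact_mod_cast blockProd_pos q hr m 0
  rw [Gamma_add_three hx0, mul_assoc ((r : ℝ) / q * (r / q + 1) * (r / q + 2))]
  refine mul_le_mul_of_nonneg_left ?_ (by positivity)
  have h6 : A / B * E * (blockProd q r m 0 : ℝ) ≤
      Real.Gamma (r / q) * (blockProd q r m 0 : ℝ) := by
    rw [← h2]
    calc A / B * E * (blockProd q r m 0 : ℝ) = A * blockProd q r m 0 / B * E := by ring
      _ ≤ blockProd q q m 0 * B / B * E := by gcongr
      _ = ((2 ^ m).factorial * E) * q ^ 2 ^ m := by rw [← h3]; field_simp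
      _ ≤ Real.Gamma (r / q + (2 ^ m : ℕ)) * q ^ 2 ^ m := by
        gcongr
        exact le_trans (by gcongr) h1
  exact le_of_mul_le_mul_right h6 hb

/-! ### The moment of the one-sided law and the location of the transition. -/

/-- `∫₀¹ y ^ p e ^ y dy`. -/
def unitExpMoment (p : ℝ) : ℝ := ∫ y in (0 : ℝ)..1, y ^ p * Real.exp y

theorem continuousOn_unitExpMoment : ContinuousOn unitExpMoment (Ioi 0) := by
  intro p hp
  have hp : 0 < p := hp
  refine ContinuousAt.continuousWithinAt ?_
  refine intervalIntegral.continuousAt_of_dominated_interval (bound := fun _ => Real.exp 1) ?_ ?_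
    (by simp) ?_
  · exact .of_forall fun q => Measurable.aestronglyMeasurable (by fun_prop)
  · filter_upwards [lt_mem_nhds hp] with q hq
    refine .of_forall fun y hy => ?_
    rw [uIoc_of_le zero_le_one] at hy
    rw [Real.norm_of_nonneg (mul_nonneg (Real.rpow_nonneg hy.1.le _) (Real.exp_nonneg _))]
    calc y ^ q * Real.exp y ≤ 1 * Real.exp 1 := by
          gcongr
          · exact Real.rpow_le_one hy.1.le hy.2 hq.le
          · exact hy.2
      _ = _ := one_mul _
  · refine .of_forall fun y hy => ?_
    rw [uIoc_of_le zero_le_one] at hy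
    exact (Real.continuousAt_const_rpow hy.1.ne').mul continuousAt_const

theorem integral_rpow_mul_sum {p : ℝ} (hp : 0 < p) (n : ℕ) (c : ℕ → ℝ) :
    ∫ y in (0 : ℝ)..1, y ^ p * ∑ k ∈ Finset.range n, c k * y ^ k =
      ∑ k ∈ Finset.range n, c k / (p + k + 1) := by
  have e : ∀ y ∈ uIcc (0 : ℝ) 1, y ^ p * ∑ k ∈ Finset.range n, c k * y ^ k =
      ∑ k ∈ Finset.range n, c k * y ^ (p + k) := by
    intro y hy
    rw [uIcc_of_le zero_le_one] at hy
    rw [Finset.mul_sum]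
    refine Finset.sum_congr rfl fun k _ => ?_
    rw [Real.rpow_add_natCast' hy.1 (by positivity)]
    ring
  rw [intervalIntegral.integral_congr e, intervalIntegral.integral_finsetSum]
  · refine Finset.sum_congr rfl fun k _ => ?_
    have hk : (0 : ℝ) ≤ k := Nat.cast_nonneg k
    rw [intervalIntegral.integral_const_mul, integral_rpow (.inl (by linarith)), Real.one_rpow,
      Real.zero_rpow (by linarith), sub_zero, mul_one_div]
  · intro k _
    have hk : (0 : ℝ) ≤ k := Nat.cast_nonneg k
    exact (intervalIntegral.intervalIntegrable_rpow' (by linarith)).const_mul _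

theorem continuous_rpow_mul {p : ℝ} (hp : 0 < p) {f : ℝ → ℝ} (hf : Continuous f) :
    Continuous fun y : ℝ => y ^ p * f y :=
  (Real.continuous_rpow_const hp.le).mul hf

theorem sum_le_unitExpMoment {p : ℝ} (hp : 0 < p) (n : ℕ) :
    ∑ k ∈ Finset.range n, (1 / (k.factorial : ℝ)) / (p + k + 1) ≤ unitExpMoment p := by
  rw [← integral_rpow_mul_sum hp, unitExpMoment]
  refine intervalIntegral.integral_mono_on zero_le_one
    ((continuous_rpow_mul hp (by fun_prop)).intervalIntegrable _ _)
    ((continuous_rpow_mul hp (by fun_prop)).intervalIntegrable _ _) fun y hy => ?_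
  refine mul_le_mul_of_nonneg_left ?_ (Real.rpow_nonneg hy.1 _)
  refine le_trans (le_of_eq ?_) (Real.sum_le_exp_of_nonneg hy.1 n)
  exact Finset.sum_congr rfl fun k _ => by ring

/-- The Taylor polynomial of `e^y` on `[0, 1]` with its remainder carried as one more coefficient,
so that a single termwise integration suffices. -/
theorem unitExpMoment_le {p : ℝ} (hp : 0 < p) {n : ℕ} (hn : 0 < n) :
    unitExpMoment p ≤ ∑ k ∈ Finset.range n, (1 / (k.factorial : ℝ)) / (p + k + 1) +
      (n + 1) / (n.factorial * n) / (p + n + 1) := by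
  set c : ℕ → ℝ := fun k => if k < n then 1 / k.factorial else (n + 1) / (n.factorial * n) with hc
  have h1 : ∑ k ∈ Finset.range (n + 1), c k / (p + k + 1) =
      ∑ k ∈ Finset.range n, (1 / (k.factorial : ℝ)) / (p + k + 1) +
      (n + 1) / (n.factorial * n) / (p + n + 1) := by
    rw [Finset.sum_range_succ]
    congr 1
    · exact Finset.sum_congr rfl fun k hk => by rw [hc]; simp [Finset.mem_range.1 hk]
    · simp [hc]
  rw [← h1, ← integral_rpow_mul_sum hp, unitExpMoment]
  refine intervalIntegral.integral_mono_on zero_le_one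
    ((continuous_rpow_mul hp (by fun_prop)).intervalIntegrable _ _)
    ((continuous_rpow_mul hp (by fun_prop)).intervalIntegrable _ _) fun y hy => ?_
  refine mul_le_mul_of_nonneg_left ?_ (Real.rpow_nonneg hy.1 _)
  refine (Real.exp_bound' hy.1 hy.2 hn).trans (le_of_eq ?_)
  rw [Finset.sum_range_succ]
  congr 1
  · exact Finset.sum_congr rfl fun k hk => by rw [hc]; simp [Finset.mem_range.1 hk]; ring
  · simp [hc]; ring

/-- Two integrations by parts raise the exponent from `p - 2` to `p`, and the boundary terms cancel
against the last term of `extremalNumerator`. -/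
theorem extremalMoment_one {p : ℝ} (hp : 2 ≤ p) : extremalMoment p 1 =
    (Real.Gamma (p + 1) + unitExpMoment p) * Real.exp (p * (1 - Real.log 2) - 1) := by
  have parts : ∀ q : ℝ, 1 ≤ q → q * ∫ y in (0 : ℝ)..1, y ^ (q - 1) * Real.exp y =
      Real.exp 1 - ∫ y in (0 : ℝ)..1, y ^ q * Real.exp y := by
    intro q hq
    have hd : ∀ y ∈ uIcc (0 : ℝ) 1, HasDerivAt (fun y : ℝ => y ^ q) (q * y ^ (q - 1)) y :=
      fun y _ => Real.hasDerivAt_rpow_const (.inr hq)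
    have hc : Continuous fun y : ℝ => q * y ^ (q - 1) :=
      (Real.continuous_rpow_const (by linarith)).const_mul q
    have h := intervalIntegral.integral_mul_deriv_eq_deriv_mul hd
      (fun y _ => Real.hasDerivAt_exp y) (hc.intervalIntegrable _ _)
      (Real.continuous_exp.intervalIntegrable _ _)
    rw [Real.one_rpow, Real.zero_rpow (by linarith)] at h
    simp only [mul_assoc] at h
    rw [intervalIntegral.integral_const_mul] at h
    linarith
  have h1 := parts p (by linarith)
  have h2 := parts (p - 1) (by linarith)
  rw [show p - 1 - 1 = p - 2 by ring] at h2
  have h3 : extremalNumerator p 1 = Real.Gamma (p + 1) + unitExpMoment p := by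
    rw [extremalNumerator, unitExpMoment, Real.one_rpow]
    linear_combination p * h2 - h1
  have h4 : Real.exp (p * (1 - Real.log 2) - 1) = Real.exp 1 ^ (p - 1) / 2 ^ p := by
    rw [← Real.exp_mul, Real.rpow_def_of_pos two_pos, ← Real.exp_sub]
    congr 1; ring
  rw [extremalMoment, h3, h4]
  norm_num
  ring

/-- The sign is moved to a bracket in which `Γ(p+1)` has a small coefficient, about `0.1` near the
transition, so moderate accuracy for `Γ` is enough. -/
theorem extremalMoment_one_sub {p : ℝ} (hp : 2 ≤ p) : extremalMoment p 1 - Real.Gamma (p + 1) =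
    Real.exp (p * (1 - Real.log 2) - 1) * (unitExpMoment p -
      Real.Gamma (p + 1) * (Real.exp (1 - p * (1 - Real.log 2)) - 1)) := by
  have h : Real.exp (p * (1 - Real.log 2) - 1) * Real.exp (1 - p * (1 - Real.log 2)) = 1 := by
    rw [← Real.exp_add]; simp
  rw [extremalMoment_one hp]
  linear_combination Real.Gamma (p + 1) * h

theorem Gamma_right_endpoint_le : Real.Gamma (2.9415 + 1) ≤ 5.577787 := by
  -- The decimal `1.556101` bounds `N!/(x)_N` from above for `x = 0.9415`, `N = 2^10`, as an
  -- inequality between integers.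
  have hb : blockProd 10000 10000 10 0 * 1000000 ≤ 1556101 * blockProd 10000 9415 10 0 := by
    decide +kernel
  have h := Gamma_add_three_le (q := 10000) (r := 9415) (m := 10) (by norm_num) (by norm_num)
    (by norm_num) hb
  have h1 : Real.exp (-(10 * (1 - 9415 / 10000) * Real.log 2)) ≤ 0.6666494 := by
    have hs := Real.sum_le_exp_of_nonneg (x := 0.405491100) (by norm_num) 8
    have hle : (0.405491100 : ℝ) ≤ 10 * (1 - 9415 / 10000) * Real.log 2 := by
      have := Real.log_two_gt_d9
      norm_num at this ⊢
      linarith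
    have hm := Real.exp_le_exp.2 hle
    rw [Real.exp_neg, inv_le_comm₀ (Real.exp_pos _) (by norm_num)]
    refine le_trans ?_ (hs.trans hm)
    norm_num [Finset.sum_range_succ, Nat.factorial]
  push_cast at h
  rw [show (2.9415 : ℝ) + 1 = 9415 / 10000 + 3 by norm_num]
  refine h.trans ?_
  refine (mul_le_mul_of_nonneg_left h1 (by norm_num)).trans ?_
  norm_num

theorem le_Gamma_left_endpoint : 5.57676 ≤ Real.Gamma (2.9414 + 1) := by
  have hb : 1557285 * blockProd 10000 9414 10 0 ≤ blockProd 10000 10000 10 0 * 1000000 := by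
    decide +kernel
  have h := le_Gamma_add_three (q := 10000) (r := 9414) (m := 10) (by norm_num) (by norm_num)
    (by norm_num) hb
  have h1 : 0.666149 ≤ Real.exp (-((1 - 9414 / 10000) * (10 * Real.log 2 + 1 / 2 ^ 10))) := by
    have hle : (1 - 9414 / 10000) * (10 * Real.log 2 + 1 / 2 ^ 10) ≤ (0.406241476 : ℝ) := by
      have := Real.log_two_lt_d9
      norm_num at this ⊢
      linarith
    have hs := Real.exp_bound' (x := 0.406241476) (by norm_num) (by norm_num) (n := 8) (by norm_num)
    have hm := (Real.exp_le_exp.2 hle).trans hs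
    rw [Real.exp_neg, le_inv_comm₀ (by norm_num) (Real.exp_pos _)]
    refine hm.trans ?_
    norm_num [Finset.sum_range_succ, Nat.factorial]
  push_cast at h
  rw [show (2.9414 : ℝ) + 1 = 9414 / 10000 + 3 by norm_num]
  refine le_trans ?_ h
  refine le_trans ?_ (mul_le_mul_of_nonneg_left h1 (by norm_num))
  norm_num

theorem Gamma_lt_extremalMoment_one : Real.Gamma (2.9415 + 1) < extremalMoment 2.9415 1 := by
  rw [← sub_pos, extremalMoment_one_sub (by norm_num)]
  refine mul_pos (Real.exp_pos _) (sub_pos.2 ?_)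
  have h1 : Real.exp (1 - 2.9415 * (1 - Real.log 2)) ≤ 1.1022929 := by
    have hle : (1 - 2.9415 * (1 - Real.log 2) : ℝ) ≤ 0.097392433 := by
      have := Real.log_two_lt_d9
      norm_num at this ⊢
      linarith
    refine (Real.exp_le_exp.2 hle).trans ((Real.exp_bound' (x := 0.097392433) (by norm_num)
      (by norm_num) (n := 6) (by norm_num)).trans ?_)
    norm_num [Finset.sum_range_succ, Nat.factorial]
  have h2 := sum_le_unitExpMoment (p := 2.9415) (by norm_num) 8
  refine lt_of_lt_of_le ?_ h2
  have h3 : Real.Gamma (2.9415 + 1) * (Real.exp (1 - 2.9415 * (1 - Real.log 2)) - 1) ≤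
      5.577787 * 0.1022929 :=
    (mul_le_mul_of_nonneg_left (by linarith) (Real.Gamma_nonneg_of_nonneg (by norm_num))).trans
      (mul_le_mul_of_nonneg_right Gamma_right_endpoint_le (by norm_num))
  refine h3.trans_lt ?_
  norm_num [Finset.sum_range_succ, Nat.factorial]

theorem extremalMoment_one_lt_Gamma : extremalMoment 2.9414 1 < Real.Gamma (2.9414 + 1) := by
  rw [← sub_neg, extremalMoment_one_sub (by norm_num)]
  refine mul_neg_of_pos_of_neg (Real.exp_pos _) (sub_neg.2 ?_)
  have h1 : 1.1023266 ≤ Real.exp (1 - 2.9414 * (1 - Real.log 2)) := by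
    have hle : 0.097423115 ≤ (1 - 2.9414 * (1 - Real.log 2) : ℝ) := by
      have := Real.log_two_gt_d9
      norm_num at this ⊢
      linarith
    refine le_trans ?_ ((Real.sum_le_exp_of_nonneg (x := 0.097423115) (by norm_num) 6).trans
      (Real.exp_le_exp.2 hle))
    norm_num [Finset.sum_range_succ, Nat.factorial]
  have h2 := unitExpMoment_le (p := 2.9414) (by norm_num) (n := 6) (by norm_num)
  refine lt_of_le_of_lt h2 ?_
  have h3 : 5.57676 * 0.1023266 ≤
      Real.Gamma (2.9414 + 1) * (Real.exp (1 - 2.9414 * (1 - Real.log 2)) - 1) :=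
    mul_le_mul le_Gamma_left_endpoint (by linarith) (by norm_num)
      (Real.Gamma_nonneg_of_nonneg (by norm_num))
  refine lt_of_lt_of_le ?_ h3
  norm_num [Finset.sum_range_succ, Nat.factorial]

theorem exists_extremalMoment_one_eq_Gamma : ∃ p : ℝ, 2.9414 < p ∧ p < 2.9415 ∧
    extremalMoment p 1 = Real.Gamma (p + 1) := by
  have hc : ContinuousOn (fun p => (Real.Gamma (p + 1) + unitExpMoment p) *
      Real.exp (p * (1 - Real.log 2) - 1) - Real.Gamma (p + 1)) (Icc 2.9414 2.9415) := by
    have h1 : ContinuousOn (fun p : ℝ => Real.Gamma (p + 1)) (Icc 2.9414 2.9415) := by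
      intro p hp
      have hp : 0 < p + 1 := by linarith [hp.1]
      have h := (Real.differentiableAt_Gamma fun m => by
        have : (0 : ℝ) ≤ m := Nat.cast_nonneg m
        linarith).continuousAt (x := p + 1)
      exact (ContinuousAt.comp (f := fun p : ℝ => p + 1) h (by fun_prop)).continuousWithinAt
    have h2 : ContinuousOn unitExpMoment (Icc 2.9414 2.9415) :=
      continuousOn_unitExpMoment.mono fun p hp => by
        have := hp.1
        simp only [mem_Ioi]; linarith
    exact ((h1.add h2).mul (by fun_prop)).sub h1
  have hv := intermediate_value_Ioo (show (2.9414 : ℝ) ≤ 2.9415 by norm_num) hc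
  have hl := extremalMoment_one_lt_Gamma
  have hr := Gamma_lt_extremalMoment_one
  rw [extremalMoment_one (by norm_num)] at hl hr
  obtain ⟨p, hp, h0⟩ := hv ⟨sub_neg.2 hl, sub_pos.2 hr⟩
  refine ⟨p, hp.1, hp.2, ?_⟩
  rw [extremalMoment_one (by linarith [hp.1])]
  exact sub_eq_zero.1 h0

/-! ### Moment norms of random variables, including the exponent zero. -/

section

theorem TailLogConcave.map_const_mul {μ : Measure ℝ} (h : TailLogConcave μ) {c : ℝ} (hc : 0 < c) :
    TailLogConcave (μ.map (c * ·)) := by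
  have e : ∀ x : ℝ, (μ.map (c * ·)).real (Ioi x) = μ.real (Ioi (x / c)) := by
    intro x
    rw [map_measureReal_apply (by fun_prop) measurableSet_Ioi]
    congr 1
    ext y
    simp only [mem_preimage, mem_Ioi]
    rw [div_lt_iff₀' hc]
  intro x y d hxy hd
  rw [e, e, e, e, add_div, add_div]
  exact h _ _ _ (by gcongr) (by positivity)

theorem ennreal_mul_rpow {x : ℝ≥0∞} (h0 : x ≠ 0) (ht : x ≠ ⊤) (y : ℝ≥0∞) (z : ℝ) :
    (x * y) ^ z = x ^ z * y ^ z := by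
  simp [ENNReal.mul_rpow_eq_ite, h0, ht]

theorem ennreal_rpow_le_rpow_of_nonpos {x y : ℝ≥0∞} (h : x ≤ y) {z : ℝ} (hz : z ≤ 0) :
    y ^ z ≤ x ^ z := by
  rw [← neg_neg z, ENNReal.rpow_neg, ENNReal.rpow_neg x, ENNReal.inv_le_inv]
  exact ENNReal.rpow_le_rpow h (neg_nonneg.2 hz)

section

variable {Ω : Type*} [MeasurableSpace Ω] {P : Measure Ω} {X : Ω → ℝ}

theorem lintegral_enorm_const_mul_rpow {c : ℝ} (hc : 0 < c) (p : ℝ) :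
    ∫⁻ ω, ‖c * X ω‖ₑ ^ p ∂P = ENNReal.ofReal c ^ p * ∫⁻ ω, ‖X ω‖ₑ ^ p ∂P := by
  have hc0 : ENNReal.ofReal c ≠ 0 := (ENNReal.ofReal_pos.2 hc).ne'
  rw [← lintegral_const_mul' _ _ (ENNReal.rpow_ne_top_of_ne_zero hc0 ENNReal.ofReal_ne_top)]
  refine lintegral_congr fun ω => ?_
  rw [enorm_mul, Real.enorm_eq_ofReal hc.le,
    ennreal_mul_rpow hc0 ENNReal.ofReal_ne_top]

theorem momentNorm_const_mul {c : ℝ} (hc : 0 < c) {p : ℝ} (hp : p ≠ 0) :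
    momentNorm (fun ω => c * X ω) p P = ENNReal.ofReal c * momentNorm X p P := by
  have hc0 : ENNReal.ofReal c ≠ 0 := (ENNReal.ofReal_pos.2 hc).ne'
  rw [momentNorm, momentNorm, if_neg hp, if_neg hp, lintegral_enorm_const_mul_rpow hc,
    ennreal_mul_rpow (ENNReal.rpow_pos hc0.bot_lt ENNReal.ofReal_ne_top).ne'
    (ENNReal.rpow_ne_top_of_ne_zero hc0 ENNReal.ofReal_ne_top), ← ENNReal.rpow_mul,
    mul_one_div_cancel hp, ENNReal.rpow_one]

theorem momentNorm_one (hX : Integrable X P) :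
    momentNorm X 1 P = ENNReal.ofReal (∫ ω, |X ω| ∂P) := by
  rw [momentNorm, if_neg one_ne_zero]
  simp only [ENNReal.rpow_one, one_div, inv_one]
  exact (ofReal_integral_norm_eq_lintegral_enorm hX).symm

theorem IsLogConcave.ae_ne_zero (hX : IsLogConcave X P) : ∀ᵐ ω ∂P, X ω ≠ 0 := by
  obtain ⟨φ, -, hlaw⟩ := hX
  rw [hlaw.ae_iff (p := fun x => x ≠ 0) (by fun_prop)]
  exact ae_iff.2 (by simp)

/-- The stop-loss bound applied to the law of `X / 𝔼|X|`. The same `t` and `π` serve for all `p`;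
`𝔼|X| > 0` because a law with a density does not charge `0`. -/
theorem exists_lintegral_enorm_rpow_eq [IsProbabilityMeasure P] (hX : IsLogConcave X P)
    (hm : HasMeanZero X P) : 0 < ∫ ω, |X ω| ∂P ∧ ∃ t ∈ Icc (0 : ℝ) 1, ∃ π : ℝ → ℝ,
      (∀ x, 0 < x → π x ≤ extremalStopLoss t x) ∧ ∀ p, p ≠ 0 → p ≠ 1 →
        ∫⁻ ω, ‖X ω‖ₑ ^ p ∂P = ENNReal.ofReal (∫ ω, |X ω| ∂P) ^ p * stopLossMoment p π := by
  have hm0 : 0 < ∫ ω, |X ω| ∂P := by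
    refine (integral_nonneg fun ω => abs_nonneg _).lt_of_ne' fun h => ?_
    rw [integral_eq_zero_iff_of_nonneg (fun ω => abs_nonneg _) hm.1.abs] at h
    have : ∀ᵐ ω ∂P, False := by
      filter_upwards [h, hX.ae_ne_zero] with ω h1 h2
      exact h2 (abs_eq_zero.1 h1)
    simp [IsProbabilityMeasure.ne_zero P] at this
  refine ⟨hm0, ?_⟩
  set m := ∫ ω, |X ω| ∂P with hmdef
  obtain ⟨φ, hφ, hlaw⟩ := hX
  set μ : Measure ℝ := volume.withDensity fun x => EReal.exp (-φ x) with hμ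
  have hprob : IsProbabilityMeasure μ := hlaw.isProbabilityMeasure_iff.1 inferInstance
  have hdens : Measurable fun x => EReal.exp (-φ x) := EReal.measurable_exp.comp hφ.measurable.neg
  have hneg : μ.map Neg.neg = volume.withDensity fun x => EReal.exp (-φ (-x)) :=
    map_neg_withDensity hdens
  have hprob' : IsProbabilityMeasure (μ.map Neg.neg) :=
    Measure.isProbabilityMeasure_map (by fun_prop)
  have hr : TailLogConcave μ := hφ.tailLogConcave
  have hl : TailLogConcave (μ.map Neg.neg) := by
    rw [hneg] at hprob' ⊢
    exact hφ.comp_neg.tailLogConcave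
  have hc : 0 < m⁻¹ := inv_pos.2 hm0
  have hYlaw : HasLaw (fun ω => m⁻¹ * X ω) (μ.map (m⁻¹ * ·)) P :=
    ⟨hlaw.aemeasurable.const_mul _, by
      rw [← hlaw.map_eq, AEMeasurable.map_map_of_aemeasurable (by fun_prop) hlaw.aemeasurable]
      rfl⟩
  have hprobY : IsProbabilityMeasure (μ.map (m⁻¹ * ·)) :=
    Measure.isProbabilityMeasure_map (by fun_prop)
  have hatomY : NullSingletonClass (μ.map (m⁻¹ * ·)) :=
    nullSingletonClass_map (by fun_prop) (mul_right_injective₀ hc.ne')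
  have hnegY : (μ.map (m⁻¹ * ·)).map Neg.neg = (μ.map Neg.neg).map (m⁻¹ * ·) := by
    rw [Measure.map_map (by fun_prop) (by fun_prop), Measure.map_map (by fun_prop) (by fun_prop)]
    congr 1
    funext y
    simp
  have hiY : Integrable (fun y => y) (μ.map (m⁻¹ * ·)) := by
    rw [← hYlaw.map_eq, integrable_map_measure (by fun_prop) hYlaw.aemeasurable]
    exact hm.1.const_mul _
  have hmY : ∫ y, y ∂μ.map (m⁻¹ * ·) = 0 := by
    rw [← hYlaw.map_eq, integral_map hYlaw.aemeasurable (by fun_prop), integral_const_mul, hm.2,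
      mul_zero]
  have haY : ∫ y, |y| ∂μ.map (m⁻¹ * ·) = 1 := by
    rw [← hYlaw.map_eq, integral_map hYlaw.aemeasurable (by fun_prop)]
    simp only [abs_mul, abs_of_pos hc]
    rw [integral_const_mul, ← hmdef, inv_mul_cancel₀ hm0.ne']
  obtain ⟨t, ht, hle⟩ := exists_stopLoss_le_extremal (hr.map_const_mul hc)
    (by rw [hnegY]; exact hl.map_const_mul hc) hiY hmY haY
  refine ⟨t, ht, stopLoss (μ.map (m⁻¹ * ·)), fun x hx => hle x hx.le, fun p hp0 hp1 => ?_⟩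
  rw [← lintegral_enorm_rpow_eq_stopLossMoment hiY haY hp0 hp1, ← hYlaw.map_eq,
    lintegral_map' (by fun_prop) hYlaw.aemeasurable, ← lintegral_enorm_const_mul_rpow hm0]
  simp only [mul_inv_cancel_left₀ hm0.ne']

theorem ofReal_gammaRoot {p : ℝ} (hp : -1 < p) (hp0 : p ≠ 0) :
    ENNReal.ofReal (gammaRoot p) = ENNReal.ofReal (Real.Gamma (p + 1)) ^ (1 / p) := by
  rw [gammaRoot, if_neg hp0, ENNReal.ofReal_rpow_of_pos (Real.Gamma_pos_of_pos (by linarith))]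

theorem gammaRoot_one : gammaRoot 1 = 1 := by
  rw [gammaRoot, if_neg one_ne_zero]
  norm_num

theorem oneSidedConst_eq {p : ℝ} (hp0 : p ≠ 0) (hp1 : p ≠ 1) :
    oneSidedConst p = stopLossMoment p (extremalStopLoss 1) ^ (1 / p) := by
  rw [stopLossMoment_extremal_one hp0 hp1, oneSidedConst,
    ← momentNorm_const_mul (by positivity) hp0, momentNorm, if_neg hp0]

theorem oneSidedConst_one : oneSidedConst 1 = 1 := by
  rw [oneSidedConst, ← momentNorm_const_mul (by positivity) one_ne_zero,
    momentNorm_one (hasMeanZero_sub_one_expMeasure.1.const_mul _)]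
  have h := integral_abs_oneSidedLaw
  rw [oneSidedLaw, integral_map (by fun_prop) (by fun_prop)] at h
  rw [h, ENNReal.ofReal_one]

theorem integrable_abs_rpow (hm : AEMeasurable X P) (h0 : ∀ᵐ ω ∂P, X ω ≠ 0) {q : ℝ}
    (hfin : ∫⁻ ω, ‖X ω‖ₑ ^ q ∂P ≠ ⊤) : Integrable (fun ω => |X ω| ^ q) P ∧
      ENNReal.ofReal (∫ ω, |X ω| ^ q ∂P) = ∫⁻ ω, ‖X ω‖ₑ ^ q ∂P := by
  have e : ∫⁻ ω, ‖X ω‖ₑ ^ q ∂P = ∫⁻ ω, ENNReal.ofReal (|X ω| ^ q) ∂P := by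
    refine lintegral_congr_ae ?_
    filter_upwards [h0] with ω hω
    rw [← ENNReal.ofReal_rpow_of_pos (abs_pos.2 hω), Real.enorm_eq_ofReal_abs]
  have hpos : ∀ ω, 0 ≤ |X ω| ^ q := fun ω => Real.rpow_nonneg (abs_nonneg _) _
  have hi : Integrable (fun ω => |X ω| ^ q) P := by
    refine ⟨AEMeasurable.aestronglyMeasurable (by fun_prop), ?_⟩
    rw [hasFiniteIntegral_iff_ofReal (.of_forall hpos), ← e]
    exact hfin.lt_top
  exact ⟨hi, by rw [e, ofReal_integral_eq_lintegral_ofReal hi (.of_forall hpos)]⟩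

/-- The logarithm is below `|X|` and, since `q < 0`, above `-|X|^q / (-q)`. -/
theorem integrable_log_abs (hX : Integrable X P) (h0 : ∀ᵐ ω ∂P, X ω ≠ 0) {q : ℝ} (hq : q < 0)
    (hfin : ∫⁻ ω, ‖X ω‖ₑ ^ q ∂P ≠ ⊤) : Integrable (fun ω => Real.log |X ω|) P := by
  have hm : AEMeasurable X P := hX.aemeasurable
  obtain ⟨hi, -⟩ := integrable_abs_rpow hm h0 hfin
  refine (hX.abs.add (hi.div_const (-q))).mono'
    (AEMeasurable.aestronglyMeasurable (by fun_prop)) ?_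
  filter_upwards [h0] with ω hω
  have hpos : 0 < |X ω| := abs_pos.2 hω
  have hr : 0 ≤ |X ω| ^ q / -q := div_nonneg (Real.rpow_nonneg hpos.le _) (by linarith)
  have h1 := Real.log_le_sub_one_of_pos hpos
  have h2 := Real.log_le_rpow_div (inv_nonneg.2 hpos.le) (neg_pos.2 hq)
  rw [Real.log_inv, Real.inv_rpow hpos.le, Real.rpow_neg hpos.le, inv_inv] at h2
  simp only [Pi.add_apply]
  rw [Real.norm_eq_abs, abs_le]
  constructor <;> linarith

theorem momentNorm_zero_eq (hlog : Integrable (fun ω => Real.log |X ω|) P)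
    (h0 : ∀ᵐ ω ∂P, X ω ≠ 0) :
    momentNorm X 0 P = ENNReal.ofReal (Real.exp (∫ ω, Real.log |X ω| ∂P)) := by
  have e : ∀ᵐ ω ∂P, ENNReal.log ‖X ω‖ₑ = (Real.log |X ω| : EReal) := by
    filter_upwards [h0] with ω hω
    rw [Real.enorm_eq_ofReal_abs, ENNReal.log_ofReal_of_pos (abs_pos.2 hω)]
  have e1 : ∫⁻ ω, (ENNReal.log ‖X ω‖ₑ).toENNReal ∂P = ∫⁻ ω, ENNReal.ofReal (Real.log |X ω|) ∂P :=
    lintegral_congr_ae (by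
      filter_upwards [e] with ω h
      rw [h, EReal.toENNReal_of_ne_top (by simp)]; simp)
  have e2 : ∫⁻ ω, (-ENNReal.log ‖X ω‖ₑ).toENNReal ∂P =
      ∫⁻ ω, ENNReal.ofReal (-Real.log |X ω|) ∂P :=
    lintegral_congr_ae (by
      filter_upwards [e] with ω h
      rw [h, ← EReal.coe_neg, EReal.toENNReal_of_ne_top (by simp)]; simp)
  have f1 : ∫⁻ ω, ENNReal.ofReal (Real.log |X ω|) ∂P ≠ ⊤ := hlog.lintegral_lt_top.ne
  have f2 : ∫⁻ ω, ENNReal.ofReal (-Real.log |X ω|) ∂P ≠ ⊤ := hlog.neg.lintegral_lt_top.ne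
  rw [momentNorm, if_pos rfl, expLogAbs, e1, e2, ← EReal.exp_coe,
    integral_eq_lintegral_pos_part_sub_lintegral_neg_part hlog, EReal.coe_sub,
    EReal.coe_ennreal_toReal f1, EReal.coe_ennreal_toReal f2]

/-- Jensen's inequality for the exponential of `q log|X|`, valid for either sign of `q`. -/
theorem exp_mul_integral_log_le [IsProbabilityMeasure P]
    (hlog : Integrable (fun ω => Real.log |X ω|) P) (h0 : ∀ᵐ ω ∂P, X ω ≠ 0) {q : ℝ}
    (hi : Integrable (fun ω => |X ω| ^ q) P) :
    Real.exp (∫ ω, Real.log |X ω| ∂P) ^ q ≤ ∫ ω, |X ω| ^ q ∂P := by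
  have e : (fun ω => |X ω| ^ q) =ᵐ[P] fun ω => Real.exp (Real.log |X ω| * q) := by
    filter_upwards [h0] with ω hω
    rw [Real.rpow_def_of_pos (abs_pos.2 hω)]
  rw [← Real.exp_mul, ← integral_mul_const, integral_congr_ae e]
  exact convexOn_exp.map_integral_le Real.continuous_exp.continuousOn isClosed_univ (by simp)
    (hlog.mul_const q) (hi.congr e)

theorem momentNorm_le_momentNorm_zero [IsProbabilityMeasure P] (hX : Integrable X P)
    (h0 : ∀ᵐ ω ∂P, X ω ≠ 0) {q : ℝ} (hq : q < 0) : momentNorm X q P ≤ momentNorm X 0 P := by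
  -- For `q < 0` an infinite moment makes the norm `0`, so nothing need be known about `log|X|`.
  by_cases hfin : ∫⁻ ω, ‖X ω‖ₑ ^ q ∂P = ⊤
  · rw [momentNorm, if_neg hq.ne, hfin, ENNReal.top_rpow_of_neg (one_div_neg.2 hq)]
    exact zero_le
  obtain ⟨hi, he⟩ := integrable_abs_rpow hX.aemeasurable h0 hfin
  have hlog := integrable_log_abs hX h0 hq hfin
  have h := exp_mul_integral_log_le hlog h0 hi
  rw [momentNorm_zero_eq hlog h0, momentNorm, if_neg hq.ne, ← he]
  have hp := Real.exp_pos (∫ ω, Real.log |X ω| ∂P)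
  have hpq := Real.rpow_pos_of_pos hp q
  rw [ENNReal.ofReal_rpow_of_pos (hpq.trans_le h)]
  refine ENNReal.ofReal_le_ofReal
    ((Real.rpow_le_rpow_of_nonpos hpq h (one_div_neg.2 hq).le).trans_eq ?_)
  rw [← Real.rpow_mul hp.le, mul_one_div_cancel hq.ne, Real.rpow_one]

theorem momentNorm_zero_le_momentNorm [IsProbabilityMeasure P]
    (hlog : Integrable (fun ω => Real.log |X ω|) P) (h0 : ∀ᵐ ω ∂P, X ω ≠ 0)
    (hm : AEMeasurable X P) {q : ℝ} (hq : 0 < q) : momentNorm X 0 P ≤ momentNorm X q P := by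
  by_cases hfin : ∫⁻ ω, ‖X ω‖ₑ ^ q ∂P = ⊤
  · rw [momentNorm.eq_def X q, if_neg hq.ne', hfin, ENNReal.top_rpow_of_pos (one_div_pos.2 hq)]
    exact le_top
  obtain ⟨hi, he⟩ := integrable_abs_rpow hm h0 hfin
  have h := exp_mul_integral_log_le hlog h0 hi
  rw [momentNorm_zero_eq hlog h0, momentNorm, if_neg hq.ne', ← he]
  have hp := Real.exp_pos (∫ ω, Real.log |X ω| ∂P)
  have hpq := Real.rpow_pos_of_pos hp q
  rw [ENNReal.ofReal_rpow_of_pos (hpq.trans_le h)]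
  refine ENNReal.ofReal_le_ofReal (le_trans (le_of_eq ?_)
    (Real.rpow_le_rpow hpq.le h (one_div_pos.2 hq).le))
  rw [← Real.rpow_mul hp.le, mul_one_div_cancel hq.ne', Real.rpow_one]

end

end

/-! ### The transition point and the final comparison. -/

section

theorem stopLossMoment_exp_ne_top {p : ℝ} (hp : 1 < p) :
    stopLossMoment p (fun x => Real.exp (-x)) ≠ ⊤ := by
  rw [stopLossMoment_exp (by linarith) (by linarith) hp.ne']
  exact ENNReal.ofReal_ne_top

theorem stopLossMoment_extremal_one_lt {p q : ℝ} (hp : 1 < p) (hpq : p < q)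
    (hle : stopLossMoment q (extremalStopLoss 1) ≤ stopLossMoment q fun x => Real.exp (-x)) :
    stopLossMoment p (extremalStopLoss 1) < stopLossMoment p fun x => Real.exp (-x) := by
  obtain ⟨c, hc, hx, hlt⟩ := exists_crossesAt_exp one_pos le_rfl
  exact hx.stopLossMoment_lt hc (isStopLoss_extremal zero_le_one le_rfl) isStopLoss_exp hpq hp hlt
    (stopLossMoment_exp_ne_top hp) (stopLossMoment_exp_ne_top (hp.trans hpq)) hle

theorem ofReal_gammaRoot_eq_stopLossMoment {p : ℝ} (hp : -1 < p) (hp0 : p ≠ 0) (hp1 : p ≠ 1) :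
    ENNReal.ofReal (gammaRoot p) = (stopLossMoment p fun x => Real.exp (-x)) ^ (1 / p) := by
  rw [ofReal_gammaRoot hp hp0, stopLossMoment_exp hp hp0 hp1]

theorem tendsto_ofReal_gammaRoot :
    Tendsto (fun p => ENNReal.ofReal (gammaRoot p)) (𝓝[≠] 0) (𝓝 (ENNReal.ofReal (gammaRoot 0))) := by
  refine ENNReal.tendsto_ofReal (tendsto_gammaRoot_zero.congr' ?_)
  filter_upwards [self_mem_nhdsWithin] with p hp
  rw [gammaRoot, if_neg (show p ≠ 0 from hp)]

theorem hasMeanZero_doubleExp : HasMeanZero (fun x : ℝ => x) doubleExp :=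
  ⟨integrable_id_doubleExp, integral_id_doubleExp⟩

theorem momentNorm_one_doubleExp : momentNorm (fun x : ℝ => x) 1 doubleExp = 1 := by
  rw [momentNorm_one integrable_id_doubleExp, integral_abs_doubleExp, ENNReal.ofReal_one]

theorem momentNorm_doubleExp_of_ne_zero {p : ℝ} (hp : -1 < p) (hp0 : p ≠ 0) :
    momentNorm (fun x : ℝ => x) p doubleExp = ENNReal.ofReal (gammaRoot p) := by
  rw [momentNorm, if_neg hp0, lintegral_enorm_rpow_doubleExp hp, ofReal_gammaRoot hp hp0]

/-- `p` is a point `≥ 2.94` where the constants of the two extremal laws agree. -/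
structure IsTransition (p : ℝ) : Prop where
  le : 2.94 ≤ p
  eq : extremalMoment p 1 = Real.Gamma (p + 1)

namespace IsTransition

variable {p₀ : ℝ}

theorem stopLossMoment_eq (h : IsTransition p₀) : stopLossMoment p₀ (extremalStopLoss 1) =
    stopLossMoment p₀ fun x => Real.exp (-x) := by
  have hle := h.le
  rw [stopLossMoment_exp (by linarith) (by linarith) (by linarith),
    stopLossMoment_extremal (by linarith) zero_le_one le_rfl, h.eq]

/-- The moment is largest at an end of the family, and at `p₀` both ends have the same moment. -/
theorem stopLossMoment_le_exp (h : IsTransition p₀) {t : ℝ} (ht : t ∈ Icc (0 : ℝ) 1) :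
    stopLossMoment p₀ (extremalStopLoss t) ≤ stopLossMoment p₀ fun x => Real.exp (-x) :=
  (stopLossMoment_extremal_le_max h.le ht).trans (max_le le_rfl h.stopLossMoment_eq.le)

/-- The single crossing carries the comparison from `p₀` down to smaller exponents, so the delicate
analysis in `t` is never needed below `2.94`. -/
theorem extremal_le_exp (h : IsTransition p₀) {t : ℝ} (ht : t ∈ Icc (0 : ℝ) 1) {p : ℝ}
    (hp : p < 0 ∨ 1 < p) (hpp : p ≤ p₀) :
    stopLossMoment p (extremalStopLoss t) ≤ stopLossMoment p fun x => Real.exp (-x) := by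
  have hle := h.le
  rcases hpp.eq_or_lt with rfl | hpp
  · exact h.stopLossMoment_le_exp ht
  rcases ht.1.eq_or_lt with rfl | ht0
  · exact stopLossMoment_mono (hp.imp_left le_of_lt) fun x hx => (extremalStopLoss_zero hx).le
  obtain ⟨c, hc, hx, -⟩ := exists_crossesAt_exp ht0 ht.2
  exact hx.stopLossMoment_le hc (isStopLoss_extremal ht.1 ht.2) isStopLoss_exp hpp (by linarith) hp
    (stopLossMoment_exp_ne_top (by linarith)) (h.stopLossMoment_le_exp ht)

theorem exp_le_extremal (h : IsTransition p₀) {t : ℝ} (ht : t ∈ Icc (0 : ℝ) 1) {p : ℝ}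
    (hp : 0 < p) (hp1 : p < 1) :
    stopLossMoment p (fun x => Real.exp (-x)) ≤ stopLossMoment p (extremalStopLoss t) := by
  have hle := h.le
  rcases ht.1.eq_or_lt with rfl | ht0
  · exact stopLossMoment_anti hp hp1.le fun x hx => (extremalStopLoss_zero hx).le
  obtain ⟨c, hc, hx, -⟩ := exists_crossesAt_exp ht0 ht.2
  exact hx.le_stopLossMoment hc (isStopLoss_extremal ht.1 ht.2) isStopLoss_exp (by linarith) hp hp1
    (stopLossMoment_exp_ne_top (by linarith)) (h.stopLossMoment_le_exp ht)

theorem exp_lt_extremal_one (h : IsTransition p₀) {p : ℝ} (hp : p₀ < p) :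
    (stopLossMoment p fun x => Real.exp (-x)) < stopLossMoment p (extremalStopLoss 1) := by
  by_contra! hle
  have := h.le
  exact (stopLossMoment_extremal_one_lt (by linarith) hp hle).ne h.stopLossMoment_eq

theorem oneSidedConst_lt (h : IsTransition p₀) {p : ℝ} (hp : 1 < p) (hpp : p < p₀) :
    oneSidedConst p < ENNReal.ofReal (gammaRoot p) := by
  rw [oneSidedConst_eq (by linarith) hp.ne',
    ofReal_gammaRoot_eq_stopLossMoment (by linarith) (by linarith) hp.ne']
  exact ENNReal.rpow_lt_rpow (stopLossMoment_extremal_one_lt hp hpp h.stopLossMoment_eq.le)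
    (one_div_pos.2 (by linarith))

theorem oneSidedConst_eq_gammaRoot (h : IsTransition p₀) :
    ENNReal.ofReal (gammaRoot p₀) = oneSidedConst p₀ := by
  have := h.le
  rw [oneSidedConst_eq (by linarith) (by linarith),
    ofReal_gammaRoot_eq_stopLossMoment (by linarith) (by linarith) (by linarith), h.stopLossMoment_eq]

theorem lt_oneSidedConst (h : IsTransition p₀) {p : ℝ} (hpp : p₀ < p) :
    ENNReal.ofReal (gammaRoot p) < oneSidedConst p := by
  have := h.le
  rw [oneSidedConst_eq (by linarith) (by linarith),
    ofReal_gammaRoot_eq_stopLossMoment (by linarith) (by linarith) (by linarith)]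
  exact ENNReal.rpow_lt_rpow (h.exp_lt_extremal_one hpp) (one_div_pos.2 (by linarith))

/-- Domination by `D` at one exponent is strict at every smaller exponent above `1`, so equality can
occur only once. -/
theorem gammaRoot_eq_oneSidedConst_iff (h : IsTransition p₀) {p : ℝ} (hp : 1 < p) :
    ENNReal.ofReal (gammaRoot p) = oneSidedConst p ↔ p = p₀ := by
  refine ⟨fun he => ?_, fun he => he ▸ h.oneSidedConst_eq_gammaRoot⟩
  rcases lt_trichotomy p p₀ with hlt | heq | hgt
  · exact absurd he (h.oneSidedConst_lt hp hlt).ne'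
  · exact heq
  · exact absurd he (h.lt_oneSidedConst hgt).ne

theorem sharpConst_of_le (h : IsTransition p₀) {p : ℝ} (hp : 1 ≤ p) (hpp : p ≤ p₀) :
    sharpConst p = ENNReal.ofReal (gammaRoot p) := by
  refine max_eq_left ?_
  rcases hp.eq_or_lt with rfl | hp
  · rw [oneSidedConst_one, gammaRoot_one, ENNReal.ofReal_one]
  rcases hpp.eq_or_lt with rfl | hpp
  · exact h.oneSidedConst_eq_gammaRoot.ge
  · exact (h.oneSidedConst_lt hp hpp).le

theorem sharpConst_of_ge (h : IsTransition p₀) {p : ℝ} (hpp : p₀ ≤ p) :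
    sharpConst p = oneSidedConst p := by
  refine max_eq_right ?_
  rcases hpp.eq_or_lt with rfl | hpp
  · exact h.oneSidedConst_eq_gammaRoot.le
  · exact (h.lt_oneSidedConst hpp).le

theorem sharpConst_ne_top (h : IsTransition p₀) {p : ℝ} (hp : 1 ≤ p) : sharpConst p ≠ ⊤ := by
  rcases le_total p p₀ with hpp | hpp
  · rw [h.sharpConst_of_le hp hpp]
    exact ENNReal.ofReal_ne_top
  · have := h.le
    rw [h.sharpConst_of_ge hpp, oneSidedConst_eq (by linarith) (by linarith),
      stopLossMoment_extremal (by linarith) zero_le_one le_rfl]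
    exact ENNReal.rpow_ne_top_of_nonneg (by positivity) ENNReal.ofReal_ne_top

section

variable {Ω : Type*} [MeasurableSpace Ω] {P : Measure Ω} [IsProbabilityMeasure P] {X : Ω → ℝ}

theorem momentNorm_le (h : IsTransition p₀) (hX : IsLogConcave X P) (hm : HasMeanZero X P) {p : ℝ}
    (hp : 1 ≤ p) : momentNorm X p P ≤ sharpConst p * momentNorm X 1 P := by
  rcases hp.eq_or_lt with rfl | hp
  · rw [sharpConst, gammaRoot_one, oneSidedConst_one, ENNReal.ofReal_one, max_self, one_mul]
  obtain ⟨hm0, t, ht, π, hπ, he⟩ := exists_lintegral_enorm_rpow_eq hX hm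
  have hp0 : p ≠ 0 := by linarith
  have hpos : 0 ≤ 1 / p := by positivity
  have hc0 := (ENNReal.ofReal_pos.2 hm0).ne'
  rw [momentNorm_one hm.1, momentNorm, if_neg hp0, he p hp0 hp.ne',
    ENNReal.mul_rpow_of_nonneg _ _ hpos, ← ENNReal.rpow_mul, mul_one_div_cancel hp0,
    ENNReal.rpow_one, mul_comm]
  refine mul_le_mul' ?_ le_rfl
  have h1 : stopLossMoment p π ≤ stopLossMoment p (extremalStopLoss t) :=
    stopLossMoment_mono (.inr hp) hπ
  rcases le_total p p₀ with hpp | hpp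
  · rw [h.sharpConst_of_le hp.le hpp, ofReal_gammaRoot_eq_stopLossMoment (by linarith) hp0 hp.ne']
    exact ENNReal.rpow_le_rpow (h1.trans (h.extremal_le_exp ht (.inr hp) hpp)) hpos
  · rw [sharpConst, ofReal_gammaRoot_eq_stopLossMoment (by linarith) hp0 hp.ne',
      oneSidedConst_eq hp0 hp.ne',
      ← (ENNReal.monotone_rpow_of_nonneg hpos).map_max]
    exact ENNReal.rpow_le_rpow (h1.trans (stopLossMoment_extremal_le_max (h.le.trans hpp) ht)) hpos

theorem le_momentNorm_of_ne_zero (h : IsTransition p₀) (hX : IsLogConcave X P)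
    (hm : HasMeanZero X P) {p : ℝ} (hp : -1 < p) (hp1 : p ≤ 1) (hp0 : p ≠ 0) :
    ENNReal.ofReal (gammaRoot p) * momentNorm X 1 P ≤ momentNorm X p P := by
  rcases hp1.eq_or_lt with rfl | hp1
  · rw [gammaRoot_one, ENNReal.ofReal_one, one_mul]
  have hle := h.le
  obtain ⟨hm0, t, ht, π, hπ, he⟩ := exists_lintegral_enorm_rpow_eq hX hm
  have hc0 := (ENNReal.ofReal_pos.2 hm0).ne'
  rw [momentNorm_one hm.1, momentNorm, if_neg hp0, he p hp0 hp1.ne,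
    ennreal_mul_rpow (ENNReal.rpow_pos hc0.bot_lt ENNReal.ofReal_ne_top).ne'
      (ENNReal.rpow_ne_top_of_ne_zero hc0 ENNReal.ofReal_ne_top), ← ENNReal.rpow_mul,
    mul_one_div_cancel hp0, ENNReal.rpow_one, mul_comm]
  refine mul_le_mul' le_rfl ?_
  rw [ofReal_gammaRoot_eq_stopLossMoment hp hp0 hp1.ne]
  rcases hp0.lt_or_gt with hneg | hpos
  · exact ennreal_rpow_le_rpow_of_nonpos ((stopLossMoment_mono (.inl hneg.le) hπ).trans
      (h.extremal_le_exp ht (.inl hneg) (by linarith))) (one_div_neg.2 hneg).le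
  · exact ENNReal.rpow_le_rpow ((h.exp_le_extremal ht hpos hp1).trans
      (stopLossMoment_anti hpos hp1.le hπ)) (one_div_pos.2 hpos).le

end

theorem le_momentNorm (h : IsTransition p₀) {Ω : Type*} [MeasurableSpace Ω] {P : Measure Ω}
    [IsProbabilityMeasure P] {X : Ω → ℝ} (hX : IsLogConcave X P) (hm : HasMeanZero X P) {p : ℝ}
    (hp : -1 < p) (hp1 : p ≤ 1) :
    ENNReal.ofReal (gammaRoot p) * momentNorm X 1 P ≤ momentNorm X p P := by
  by_cases hp0 : p = 0
  swap
  · exact h.le_momentNorm_of_ne_zero hX hm hp hp1 hp0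
  subst hp0
  -- The case `p = 0` is approached through negative exponents, where Jensen's inequality gives
  -- `‖X‖_q ≤ ‖X‖_0`.
  have hlim : Tendsto (fun q => ENNReal.ofReal (gammaRoot q) * momentNorm X 1 P) (𝓝[<] 0)
      (𝓝 (ENNReal.ofReal (gammaRoot 0) * momentNorm X 1 P)) := by
    refine ENNReal.Tendsto.mul_const (tendsto_ofReal_gammaRoot.mono_left
      (nhdsWithin_mono _ fun q hq => ne_of_lt hq)) (.inr ?_)
    rw [momentNorm_one hm.1]
    exact ENNReal.ofReal_ne_top
  refine le_of_tendsto hlim ?_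
  filter_upwards [Ioo_mem_nhdsLT (show (-1 : ℝ) < 0 by norm_num)] with q hq
  exact (h.le_momentNorm_of_ne_zero hX hm hq.1 (by linarith [hq.2]) hq.2.ne).trans
    (momentNorm_le_momentNorm_zero hm.1 hX.ae_ne_zero hq.2)

theorem momentNorm_doubleExp (h : IsTransition p₀) {p : ℝ} (hp : -1 < p) :
    momentNorm (fun x : ℝ => x) p doubleExp = ENNReal.ofReal (gammaRoot p) := by
  by_cases hp0 : p = 0
  swap
  · exact momentNorm_doubleExp_of_ne_zero hp hp0
  subst hp0
  refine le_antisymm ?_ ?_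
  -- The upper estimate for `‖D‖_0` uses positive exponents instead; the lower one is the general
  -- bound applied to `D`.
  · have hlim := tendsto_ofReal_gammaRoot.mono_left
      (nhdsWithin_mono (0 : ℝ) fun q (hq : q ∈ Ioi 0) => ne_of_gt hq)
    refine ge_of_tendsto hlim ?_
    filter_upwards [self_mem_nhdsWithin] with q hq
    have hq : 0 < q := hq
    rw [← momentNorm_doubleExp_of_ne_zero (by linarith) hq.ne']
    have h0 := isLogConcave_doubleExp.ae_ne_zero
    refine momentNorm_zero_le_momentNorm (integrable_log_abs integrable_id_doubleExp h0
      (q := -(1 / 2)) (by norm_num) ?_) h0 (by fun_prop) hq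
    rw [lintegral_enorm_rpow_doubleExp (by norm_num)]
    exact ENNReal.ofReal_ne_top
  · have := h.le_momentNorm isLogConcave_doubleExp hasMeanZero_doubleExp hp zero_le_one
    rwa [momentNorm_one_doubleExp, mul_one] at this

end IsTransition

end

end LogConcaveMoments

end

theorem theorem2 :
    -- the two moment comparison inequalities
    (∀ (Ω : Type*) [MeasurableSpace Ω] (P : Measure Ω) [IsProbabilityMeasure P] (X : Ω → ℝ),
      IsLogConcave X P → HasMeanZero X P →
        (∀ p : ℝ, -1 < p → p ≤ 1 →
          ENNReal.ofReal (gammaRoot p) * momentNorm X 1 P ≤ momentNorm X p P) ∧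
        (∀ p : ℝ, 1 ≤ p →
          momentNorm X p P ≤ sharpConst p * momentNorm X 1 P)) ∧
    (∀ p : ℝ, 1 ≤ p → sharpConst p ≠ ⊤) ∧
    -- the double-exponential and the centred one-sided exponential variables are admissible
    (IsProbabilityMeasure doubleExp ∧
      IsLogConcave (fun x : ℝ => x) doubleExp ∧ HasMeanZero (fun x : ℝ => x) doubleExp) ∧
    (IsProbabilityMeasure (expMeasure 1) ∧
      IsLogConcave (fun x : ℝ => x - 1) (expMeasure 1) ∧
      HasMeanZero (fun x : ℝ => x - 1) (expMeasure 1)) ∧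
    -- sharpness of the lower bound
    (∀ p : ℝ, -1 < p → p ≤ 1 →
      momentNorm (fun x : ℝ => x) p doubleExp =
        ENNReal.ofReal (gammaRoot p) * momentNorm (fun x : ℝ => x) 1 doubleExp) ∧
    -- the phase transition, and sharpness of the upper bound
    (∃ p₀ : ℝ, 2.9414 < p₀ ∧ p₀ < 2.9415 ∧
      (∀ p : ℝ, 1 < p → (ENNReal.ofReal (gammaRoot p) = oneSidedConst p ↔ p = p₀)) ∧
      (∀ p : ℝ, 1 ≤ p → p ≤ p₀ →
        sharpConst p = ENNReal.ofReal (gammaRoot p) ∧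
        momentNorm (fun x : ℝ => x) p doubleExp =
          sharpConst p * momentNorm (fun x : ℝ => x) 1 doubleExp) ∧
      (∀ p : ℝ, p₀ ≤ p →
        sharpConst p = oneSidedConst p ∧
        momentNorm (fun x : ℝ => x - 1) p (expMeasure 1) =
          sharpConst p * momentNorm (fun x : ℝ => x - 1) 1 (expMeasure 1))) := by
  obtain ⟨p₀, hl, hu, he⟩ := exists_extremalMoment_one_eq_Gamma
  have h : IsTransition p₀ := ⟨by linarith, he⟩
  have hone : momentNorm (fun x : ℝ => x) 1 doubleExp = 1 := momentNorm_one_doubleExp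
  refine ⟨fun Ω _ P _ X hX hm => ⟨fun p hp hp1 => h.le_momentNorm hX hm hp hp1,
    fun p hp => h.momentNorm_le hX hm hp⟩, fun p hp => h.sharpConst_ne_top hp,
    ⟨inferInstance, isLogConcave_doubleExp, hasMeanZero_doubleExp⟩,
    ⟨inferInstance, isLogConcave_sub_one_expMeasure, hasMeanZero_sub_one_expMeasure⟩,
    fun p hp _ => ?_, p₀, hl, hu, fun p hp => h.gammaRoot_eq_oneSidedConst_iff hp,
    fun p hp hpp => ⟨h.sharpConst_of_le hp hpp, ?_⟩, fun p hpp => ⟨h.sharpConst_of_ge hpp, ?_⟩⟩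
  · rw [h.momentNorm_doubleExp hp, hone, mul_one]
  · rw [h.sharpConst_of_le hp hpp, h.momentNorm_doubleExp (by linarith), hone, mul_one]
  -- The normalisation `(e/2) ‖ℰ - 1‖_1 = 1` turns the definition of the constant into the equality
  -- case.
  · have h1 := oneSidedConst_one
    rw [oneSidedConst] at h1
    rw [h.sharpConst_of_ge hpp, oneSidedConst, mul_right_comm, h1, one_mul]
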